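/- Theorem 2.2. For $n\ge 1$ let $(X_{ij})_{1\le i,j\le n}$ be i.i.d. standard normal random variables and, for $\sigma\in\{-1,+1\}^n$, let $$E(\sigma)=\frac1{\sqrt n}\sum_{i,j=1}^n X_{ij}\sigma_i\sigma_j .$$ Since $E(\sigma)=E(-\sigma)$, the energy spectrum consists of $N=2^{n-1}$ values $E_1\le E_2\le\dots\le E_N$, one for each pair $\{\sigma,-\sigma\}$; almost surely they are distinct. Given $\alpha_n>0$, put $$\tilde\xi_n=\sqrt{2\pi n}\;2^{-(n-1)}e^{\alpha_n^2/(2n)},$$ and, for $t\ge 0$, let $N_n(t)$ be the number of points of the energy spectrum in $[\alpha_n,\alpha_n+t\tilde\xi_n]$. Let $r_n$ be the random index with $E_{r_n}<\alpha_n\le E_{r_n+1}$, that is, the number of points of the spectrum below $\alpha_n$. For integers $j>i>0$ let $$Q_{ij}=n^{1/2}q(\sigma^{(r_n+i)},\sigma^{(r_n+j)}),\qquad q(\sigma,\tilde\sigma)=\frac1n\sum_{k=1}^n\sigma_k\tilde\sigma_k,$$ where, given the couplings, $\sigma^{(r_n+i)}$ and $\sigma^{(r_n+j)}$ are chosen independently,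 each uniformly from the two configurations with energy $E_{r_n+i}$, respectively $E_{r_n+j}$ (if fewer than $j$ points of the spectrum are $\ge\alpha_n$, a missing configuration is replaced by $\pm(1,\dots,1)$ with a uniformly random sign). Say that the local REM conjecture holds for $(\alpha_n)$ if, as $n\to\infty$, the process $\{N_n(t)\}_{t\ge0}$ converges weakly to a Poisson process $\{N(t)\}_{t\ge 0}$ with density one (for all $0\le t_1\le\dots\le t_m$, the vector $(N_n(t_1),\dots,N_n(t_m))$ converges in distribution to $(N(t_1),\dots,N(t_m))$), and, for all fixed $j>i>0$, $Q_{ij}$ converges in distribution to a standard normal. There exists a constant $\epsilon_0>0$ such that the following statements hold for all sequences $(\alpha_n)_{n\ge 1}$ of positive real numbers with $\alpha_n\le\epsilon_0 n$ for all $n\ge1$: (i) $\mathbb E[N_n(t)]\to t$ as $n\to\infty$, for every $t\ge 0$. (ii) The local REM conjecture holds for $(\alpha_n)$ if and only if $\alpha_n=o(n)$. -/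

import Mathlib

open MeasureTheory ProbabilityTheory Filter Topology
open scoped NNReal

noncomputable section

namespace SK

/-- Spin configurations `σ ∈ {-1, +1}ⁿ`. -/
abbrev Spin (n : ℕ) : Type := Fin n → ℤˣ

/-- The couplings `X_{ij}`, `1 ≤ i, j ≤ n`. -/
abbrev Couplings (n : ℕ) : Type := Fin n × Fin n → ℝ

/-- The law of `n²` independent standard normal couplings. -/
abbrev disorder (n : ℕ) : Measure (Couplings n) :=
  Measure.pi fun _ => gaussianReal 0 1

/-- The energy `E(σ) = n^{-1/2} ∑_{i,j} X_{ij} σ_i σ_j`. -/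
def energy {n : ℕ} (X : Couplings n) (σ : Spin n) : ℝ :=
  (1 / √(n : ℝ)) * ∑ i, ∑ j, X (i, j) * ((σ i : ℤ) : ℝ) * ((σ j : ℤ) : ℝ)

/-- The overlap `q(σ, τ) = n⁻¹ ∑_k σ_k τ_k`. -/
def overlap {n : ℕ} (σ τ : Spin n) : ℝ :=
  (1 / (n : ℝ)) * ∑ k, ((σ k : ℤ) : ℝ) * ((τ k : ℤ) : ℝ)

theorem energy_neg {n : ℕ} (X : Couplings n) (σ : Spin n) :
    energy X (-σ) = energy X σ := by
  simp [energy]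

/-- Identification of `σ` with `-σ`. -/
def flipSetoid (n : ℕ) : Setoid (Spin n) where
  r σ τ := τ = σ ∨ τ = -σ
  iseqv :=
    { refl := fun _ => Or.inl rfl
      symm := by
        rintro σ τ (rfl | rfl)
        · exact Or.inl rfl
        · exact Or.inr (neg_neg σ).symm
      trans := by
        rintro σ τ υ (rfl | rfl) (rfl | rfl)
        · exact Or.inl rfl
        · exact Or.inr rfl
        · exact Or.inr rfl
        · exact Or.inl (neg_neg σ) }

/-- The `2^{n-1}` classes `{σ, -σ}`. -/
abbrev SpinClass (n : ℕ) : Type := Quotient (flipSetoid n)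

instance instFintypeSpinClass (n : ℕ) : Fintype (SpinClass n) := Fintype.ofFinite _

/-- The common energy of the two configurations of a class. -/
def classEnergy {n : ℕ} (X : Couplings n) : SpinClass n → ℝ :=
  Quotient.lift (energy X) (by
    rintro σ τ (rfl | rfl)
    · rfl
    · exact (energy_neg X σ).symm)

/-- The energy spectrum `E₁ ≤ E₂ ≤ … ≤ E_N`, with one entry for each class `{σ, -σ}`
(so `E_k` is the entry of index `k - 1`). -/
def energySpectrum {n : ℕ} (X : Couplings n) : List ℝ :=
  ((Finset.univ : Finset (SpinClass n)).val.map (classEnergy X)).sort (· ≤ ·)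

/-- The rescaling factor `√(2πn) 2^{-(n-1)} exp(a² / (2n))`, used for `n ≥ 1`. -/
def scale (n : ℕ) (a : ℝ) : ℝ :=
  √(2 * Real.pi * n) * ((2 : ℝ) ^ (n - 1))⁻¹ * Real.exp (a ^ 2 / (2 * n))

open scoped Classical in
/-- `N_n(t)`: the number of points of the spectrum in `[a, a + t · scale n a]`. -/
def count (n : ℕ) (a : ℝ) (t : ℝ≥0) (X : Couplings n) : ℕ :=
  (energySpectrum X).countP fun E => decide (E ∈ Set.Icc a (a + t * scale n a))

open scoped Classical in
/-- The random index `r` with `E_r < a ≤ E_{r+1}`: the number of energies below `a`. -/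
def rankBelow {n : ℕ} (a : ℝ) (X : Couplings n) : ℕ :=
  (energySpectrum X).countP fun E => decide (E < a)

/-- The configurations `σ` with `E(σ) = E_{r+i}` (for `i ≥ 1`). Almost surely this is a pair
`{σ, -σ}`, or empty if there are fewer than `i` energies at or above `a`. -/
def levelSet {n : ℕ} (a : ℝ) (i : ℕ) (X : Couplings n) : Set (Spin n) :=
  {σ | (energySpectrum X)[rankBelow a X + (i - 1)]? = some (energy X σ)}

open scoped Classical in
/-- The configuration of the level `E_{r+i}`: an arbitrary representative of the pair `{σ, -σ}` or
its negative, according to the outcome of a coin. (If the level does not exist, the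
representative is replaced by the constant configuration.) -/
def levelSpin {n : ℕ} (a : ℝ) (i : ℕ) (X : Couplings n) (coin : Bool) : Spin n :=
  let σ : Spin n := if h : (levelSet a i X).Nonempty then h.some else 1
  if coin then σ else -σ

/-- Law of two independent fair coins. -/
abbrev fairCoins : Measure (Bool × Bool) :=
  (PMF.uniformOfFintype (Bool × Bool)).toMeasure

/-- The rescaled overlap `Q_{ij} = n^{1/2} q(σ^{(r+i)}, σ^{(r+j)})`, where `σ^{(r+i)}` and
`σ^{(r+j)}` are drawn independently and uniformly from the two configurations with energy `E_{r+i}`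
and the two with energy `E_{r+j}`. -/
def rescaledOverlap (n : ℕ) (a : ℝ) (i j : ℕ) (ω : Couplings n × (Bool × Bool)) : ℝ :=
  √(n : ℝ) * overlap (levelSpin a i ω.1 ω.2.1) (levelSpin a j ω.1 ω.2.2)

/-- The time increments `t₀ - 0, t₁ - t₀, t₂ - t₁, …`. -/
def timeStep {m : ℕ} (t : Fin m → ℝ≥0) (i : Fin m) : ℝ≥0 :=
  t i - if h : (i : ℕ) = 0 then 0 else t ⟨(i : ℕ) - 1, by omega⟩

/-- Weak convergence of the counting processes `N_n` to the Poisson process `N` of density one: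
for all times `t₀ ≤ … ≤ t_{m-1}` the vector `(N_n(t₀), …, N_n(t_{m-1}))` converges in
distribution to `(N(t₀), …, N(t_{m-1}))`, which is the vector of partial sums of independent
Poisson variables with parameters `t₀, t₁ - t₀, …, t_{m-1} - t_{m-2}`. -/
def ConvergesToPoissonProcess (α : ℕ → ℝ) : Prop :=
  ∀ (m : ℕ) (t : Fin m → ℝ≥0), Monotone t →
    TendstoInDistribution
      (fun (n : ℕ) (X : Couplings n) (i : Fin m) => count n (α n) (t i) X) atTop
      (fun (Y : Fin m → ℕ) (i : Fin m) => ∑ k ∈ Finset.Iic i, Y k)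
      (fun n => disorder n)
      (Measure.pi fun i => poissonMeasure (timeStep t i))

/-- Convergence in distribution of `Q_{ij}` to a standard normal. -/
def OverlapConvergesToNormal (α : ℕ → ℝ) (i j : ℕ) : Prop :=
  TendstoInDistribution (fun n => rescaledOverlap n (α n) i j) atTop
    (id : ℝ → ℝ) (fun n => (disorder n).prod fairCoins) (gaussianReal 0 1)

/-- The local REM conjecture for the energy scale `α`. -/
def LocalREM (α : ℕ → ℝ) : Prop :=
  ConvergesToPoissonProcess α ∧
    ∀ i j : ℕ, 0 < i → i < j → OverlapConvergesToNormal α i j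

end SK

end

/-! The energies of k configurations form a centred Gaussian vector with covariance n·M, where M is
the matrix of squared overlaps. In units of `scale n α`, and relative to independent uniform points
of density 2^{-(n-1)}, their density is `relDensity`, which is (det M)^{-1/2} exp((kα² -
z·M⁻¹z)/(2n)) with all entries of z exponentially close to α. If the off-diagonal entries of M have
sum b, this differs from 1 by about b(k! + α²/n). A typical squared overlap is of order 1/n, so the
relevant size is (α/n)², and α = o(n) is exactly the condition for local independence.

Sufficiency of α = o(n). The errors are summed over all k-tuples of distinct classes (`totalErr`,
bounded in `exists_totalErr_le`). Nearly orthogonal tuples are controlled by an exponential moment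
of the overlaps (`sum_exp_offSum_le`). Tuples with a large overlap are exponentially rare, which
beats the crude density bound n·e^{α²/(2n)} per member, α/n being small. Linearly dependent tuples
are reduced to an independent subfamily of size r; in them some sign pattern of the subfamily is
missing, which costs a factor (1 - 2^{-r})^n (`exists_independent_subfamily`,
`ncard_degenerateFamilies_le`).

Closeness of all k-point laws is turned by a truncated Möbius expansion into closeness, uniformly
over bounded test functions, of the whole spectrum in a bounded window to 2^{n-1} i.i.d. points
(`tendsto_integral_clip_sub`). For i.i.d. points the characteristic function of the counts is (1 +
θ/N)^N with N = 2^{n-1}, which gives the Poisson limit. By exchangeability the classes at levels i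
and j are a uniform pair of distinct classes, so the characteristic function of the overlap is close
to the average cos(s/√n)^n over all pairs, which tends to e^{-s²/2}.

Necessity. For t = 1 the second factorial moment of the count is at least about 1 + (α/n)²/2
(`le_integral_count_mul`), while a Poisson variable of mean one has second factorial moment 1. The
third factorial moment stays bounded if α ≤ εn, so the counts have uniformly integrable second
factorial powers, and a Poisson limit forces α/n → 0.

The first moment involves no overlaps: it only requires that the Gaussian density be nearly constant
over an exponentially short window. -/

noncomputable section

namespace SK

/-! ### Gaussian vectors and the joint density of finitely many energies -/

open Matrix in
/-- The density of the centred Gaussian vector with covariance matrix `C`. -/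
def gaussDensity {ι : Type*} [Fintype ι] [DecidableEq ι] (C : Matrix ι ι ℝ) (y : ι → ℝ) : ℝ :=
  ((√(2 * Real.pi)) ^ Fintype.card ι)⁻¹ * (√C.det)⁻¹ * Real.exp (-(y ⬝ᵥ C⁻¹ *ᵥ y) / 2)

theorem pi_gaussianReal_eq_withDensity (ι : Type*) [Fintype ι] :
    (Measure.pi fun _ : ι => gaussianReal 0 1) =
      (volume : Measure (ι → ℝ)).withDensity
        fun y => ENNReal.ofReal (∏ i, gaussianPDFReal 0 1 (y i)) := by
  refine Measure.pi_eq fun s hs => ?_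
  rw [withDensity_apply _ (MeasurableSet.univ_pi hs), volume_pi, Measure.restrict_pi_pi,
    ← ofReal_integral_eq_lintegral_ofReal]
  · rw [integral_fintype_prod_eq_prod (f := fun _ y => gaussianPDFReal 0 1 y),
      ENNReal.ofReal_prod_of_nonneg]
    · refine Finset.prod_congr rfl fun i _ => ?_
      rw [gaussianReal_apply_eq_integral _ (by norm_num)]
    · intro i _
      exact integral_nonneg fun y => gaussianPDFReal_nonneg _ _ _
  · exact Integrable.fintype_prod (f := fun _ y => gaussianPDFReal 0 1 y)
      fun i => (integrable_gaussianPDFReal 0 1).restrict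
  · exact Eventually.of_forall fun y => Finset.prod_nonneg fun i _ => gaussianPDFReal_nonneg _ _ _

open Matrix in
theorem charFunDual_map_mulVec {ι κ : Type*} [Fintype ι] [Fintype κ] [DecidableEq ι]
    (W : Matrix ι κ ℝ) (L : StrongDual ℝ (ι → ℝ)) :
    charFunDual ((Measure.pi fun _ : κ => gaussianReal 0 1).map fun X => W *ᵥ X) L =
      Complex.exp (-((((fun a => L (Pi.single a 1)) ⬝ᵥ (W * Wᵀ) *ᵥ fun a => L (Pi.single a 1)) : ℝ) : ℂ) / 2) := by
  set s : ι → ℝ := fun a => L (Pi.single a 1) with hs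
  have hL : ∀ y, L y = s ⬝ᵥ y := by
    intro y
    conv_lhs => rw [pi_eq_sum_univ' y]
    simp [dotProduct, hs, mul_comm]
  have hm : Measurable fun X : κ → ℝ => W *ᵥ X := by
    apply Continuous.measurable
    fun_prop
  rw [charFunDual_apply, integral_map hm.aemeasurable (by fun_prop)]
  have h1 : ∀ X : κ → ℝ, Complex.exp (L (W *ᵥ X) * Complex.I) =
      ∏ c, Complex.exp (((s ᵥ* W) c : ℝ) * X c * Complex.I) := by
    intro X
    rw [hL, dotProduct_mulVec, ← Complex.exp_sum, dotProduct]
    push_cast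
    rw [Finset.sum_mul]
  simp_rw [h1]
  rw [integral_fintype_prod_eq_prod (f := fun c (x : ℝ) => Complex.exp (((s ᵥ* W) c : ℝ) * x * Complex.I))]
  have h2 : ∀ c, ∫ x : ℝ, Complex.exp (((s ᵥ* W) c : ℝ) * x * Complex.I) ∂(gaussianReal 0 1) =
      Complex.exp (-(((s ᵥ* W) c : ℝ) : ℂ) ^ 2 / 2) := by
    intro c
    rw [← charFun_apply_real, charFun_gaussianReal]
    congr 1
    push_cast
    ring
  simp_rw [h2]
  rw [← Complex.exp_sum]
  congr 1
  have : s ⬝ᵥ (W * Wᵀ) *ᵥ s = ∑ c, (s ᵥ* W) c ^ 2 := by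
    rw [← mulVec_mulVec, dotProduct_mulVec, mulVec_transpose, dotProduct]
    simp [sq]
  rw [this]
  push_cast
  rw [← Finset.sum_neg_distrib, Finset.sum_div]

-- W is rectangular, so a change of variables cannot be applied to it directly. But the
-- characteristic function of the image depends only on W Wᵀ, so W may be replaced by a square
-- invertible matrix with the same Gram matrix.
open Matrix in
theorem map_mulVec_pi_gaussianReal {ι κ : Type*} [Fintype ι] [Fintype κ] [DecidableEq ι]
    (W : Matrix ι κ ℝ) (hW : (W * Wᵀ).det ≠ 0) :
    (Measure.pi fun _ : κ => gaussianReal 0 1).map (fun X => W *ᵥ X) =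
      volume.withDensity fun y => ENNReal.ofReal (gaussDensity (W * Wᵀ) y) := by
  set C := W * Wᵀ with hC
  have hpsd : C.PosSemidef := by
    have := Matrix.posSemidef_self_mul_conjTranspose W
    rwa [conjTranspose_eq_transpose_of_trivial] at this
  obtain ⟨B, hB⟩ : ∃ B : Matrix ι ι ℝ, C = Bᵀ * B := by
    open scoped MatrixOrder Matrix.Norms.L2Operator in
    obtain ⟨B, hB⟩ := CStarAlgebra.nonneg_iff_eq_star_mul_self.mp hpsd.nonneg
    exact ⟨B, by rw [hB, star_eq_conjTranspose, conjTranspose_eq_transpose_of_trivial]⟩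
  have hdet : C.det = B.det ^ 2 := by rw [hB, det_mul, det_transpose, sq]
  have hBdet : B.det ≠ 0 := by
    intro h
    exact hW (by rw [hdet, h]; norm_num)
  have hBtu : IsUnit Bᵀ.det := by rw [det_transpose]; exact hBdet.isUnit
  have hmap : (Measure.pi fun _ : κ => gaussianReal 0 1).map (fun X => W *ᵥ X) =
      (Measure.pi fun _ : ι => gaussianReal 0 1).map (fun X => Bᵀ *ᵥ X) := by
    have hm1 : Measurable fun X : κ → ℝ => W *ᵥ X := Continuous.measurable (by fun_prop)
    have hm2 : Measurable fun X : ι → ℝ => Bᵀ *ᵥ X := Continuous.measurable (by fun_prop)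
    have := Measure.isProbabilityMeasure_map (μ := Measure.pi fun _ : κ => gaussianReal 0 1)
      hm1.aemeasurable
    have := Measure.isProbabilityMeasure_map (μ := Measure.pi fun _ : ι => gaussianReal 0 1)
      hm2.aemeasurable
    refine Measure.ext_of_charFunDual (funext fun L => ?_)
    rw [charFunDual_map_mulVec, charFunDual_map_mulVec, transpose_transpose, ← hC, hB]
  rw [hmap, pi_gaussianReal_eq_withDensity]
  have hm : Measurable fun X : ι → ℝ => Bᵀ *ᵥ X := Continuous.measurable (by fun_prop)
  have hvol := Real.map_matrix_volume_pi_eq_smul_volume_pi (M := Bᵀ) (by rwa [det_transpose])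
  have hp : Measurable fun y : ι → ℝ => ENNReal.ofReal (∏ i, gaussianPDFReal 0 1 (y i)) := by
    refine ENNReal.measurable_ofReal.comp (Finset.measurable_prod _ fun i _ => ?_)
    exact (measurable_gaussianPDFReal 0 1).comp (measurable_pi_apply i)
  refine Measure.ext_of_lintegral _ fun f hf => ?_
  have hg : Measurable fun y : ι → ℝ => ENNReal.ofReal (gaussDensity C y) := by
    refine ENNReal.measurable_ofReal.comp (Continuous.measurable ?_)
    unfold gaussDensity
    fun_prop
  have hfm : Measurable fun X : ι → ℝ => f (Bᵀ *ᵥ X) := hf.comp hm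
  rw [lintegral_map hf hm, lintegral_withDensity_eq_lintegral_mul _ hp hfm,
    lintegral_withDensity_eq_lintegral_mul _ hg hf]
  have key : ∀ y : ι → ℝ, ∏ i, gaussianPDFReal 0 1 (((Bᵀ)⁻¹ *ᵥ y) i) =
      |B.det| * gaussDensity C y := by
    intro y
    have hsq : √C.det = |B.det| := by rw [hdet, Real.sqrt_sq_eq_abs]
    have hq : y ⬝ᵥ C⁻¹ *ᵥ y = ∑ i, ((Bᵀ)⁻¹ *ᵥ y) i ^ 2 := by
      rw [hB, Matrix.mul_inv_rev, ← mulVec_mulVec, dotProduct_mulVec, ← mulVec_transpose,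
        transpose_nonsing_inv, dotProduct]
      simp [sq]
    have habs : |B.det| ≠ 0 := abs_ne_zero.mpr hBdet
    simp only [gaussianPDFReal, gaussDensity, hsq, hq]
    rw [Finset.prod_mul_distrib, ← Real.exp_sum]
    simp only [NNReal.coe_one, mul_one, sub_zero, Finset.prod_const, Finset.card_univ]
    rw [← Finset.sum_neg_distrib, Finset.sum_div, inv_pow]
    field_simp
  calc ∫⁻ x, ((fun y : ι → ℝ => ENNReal.ofReal (∏ i, gaussianPDFReal 0 1 (y i))) *
          fun X => f (Bᵀ *ᵥ X)) x
      = ∫⁻ x, (fun y => ENNReal.ofReal (|B.det| * gaussDensity C y) * f y) (Bᵀ *ᵥ x) := by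
        refine lintegral_congr fun x => ?_
        simp only [Pi.mul_apply]
        rw [← key, mulVec_mulVec, nonsing_inv_mul _ hBtu, one_mulVec]
    _ = ∫⁻ y, ENNReal.ofReal (|B.det| * gaussDensity C y) * f y
          ∂(Measure.map (fun x => Bᵀ *ᵥ x) volume) := by
        rw [lintegral_map _ hm]
        simp_rw [ENNReal.ofReal_mul (abs_nonneg B.det)]
        exact (hg.const_mul _).mul hf
    _ = _ := by
        have h2 : (fun x => Bᵀ *ᵥ x) = (toLin' Bᵀ : (ι → ℝ) → (ι → ℝ)) := rfl
        rw [h2, hvol, lintegral_smul_measure, smul_eq_mul, ← lintegral_const_mul _]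
        · refine lintegral_congr fun y => ?_
          simp only [Pi.mul_apply]
          rw [ENNReal.ofReal_mul (abs_nonneg B.det), ← mul_assoc, ← mul_assoc,
            ← ENNReal.ofReal_mul (abs_nonneg _), det_transpose, abs_inv,
            inv_mul_cancel₀ (abs_ne_zero.mpr hBdet), ENNReal.ofReal_one, one_mul]
        · simp_rw [ENNReal.ofReal_mul (abs_nonneg B.det)]
          exact (hg.const_mul _).mul hf

variable {n : ℕ} {ι : Type*}

/-- The matrix of squared overlaps of a family of configurations. -/
def overlapMatrix (τ : ι → Spin n) : Matrix ι ι ℝ := fun a b => overlap (τ a) (τ b) ^ 2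

/-- The energies of a family of configurations as a linear map of the couplings. -/
def couplingMatrix (τ : ι → Spin n) : Matrix ι (Fin n × Fin n) ℝ :=
  fun a p => (1 / √(n : ℝ)) * (((τ a p.1 : ℤ) : ℝ) * ((τ a p.2 : ℤ) : ℝ))

/-- The energies of a family of configurations, measured from `α` in units of `scale n α`. -/
def rescaledEnergies (α : ℝ) (τ : ι → Spin n) (X : Couplings n) (a : ι) : ℝ :=
  (energy X (τ a) - α) / scale n α

open Matrix in
theorem couplingMatrix_mulVec (τ : ι → Spin n) (X : Couplings n) (a : ι) :
    (couplingMatrix τ *ᵥ X) a = energy X (τ a) := by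
  simp only [mulVec, dotProduct, couplingMatrix, energy, Fintype.sum_prod_type, Finset.mul_sum]
  exact Finset.sum_congr rfl fun i _ => Finset.sum_congr rfl fun j _ => by ring

open Matrix in
theorem couplingMatrix_mul_transpose (τ : ι → Spin n) :
    couplingMatrix τ * (couplingMatrix τ)ᵀ = (n : ℝ) • overlapMatrix τ := by
  ext a b
  rcases Nat.eq_zero_or_pos n with rfl | hn
  · simp [Matrix.mul_apply]
  have hn' : (0 : ℝ) < n := by exact_mod_cast hn
  have hs : √(n : ℝ) * √(n : ℝ) = n := Real.mul_self_sqrt hn'.le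
  simp only [Matrix.mul_apply, transpose_apply, couplingMatrix, Matrix.smul_apply, smul_eq_mul,
    overlapMatrix, overlap, Fintype.sum_prod_type]
  rw [mul_pow, sq (∑ k, _), Finset.sum_mul_sum, Finset.mul_sum, Finset.mul_sum]
  refine Finset.sum_congr rfl fun i _ => ?_
  rw [Finset.mul_sum, Finset.mul_sum]
  refine Finset.sum_congr rfl fun j _ => ?_
  have h : (1 / √(n : ℝ)) * (1 / √(n : ℝ)) = (n : ℝ) * (1 / n) ^ 2 := by
    rw [div_mul_div_comm, hs]; field_simp
  linear_combination (((τ a i : ℤ) : ℝ) * ((τ a j : ℤ) : ℝ)) *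
    (((τ b i : ℤ) : ℝ) * ((τ b j : ℤ) : ℝ)) * h

theorem scale_pos (hn : 0 < n) (α : ℝ) : 0 < scale n α := by
  have : (0 : ℝ) < n := by exact_mod_cast hn
  unfold scale
  positivity

theorem measurable_rescaledEnergies (α : ℝ) (τ : ι → Spin n) :
    Measurable (rescaledEnergies α τ) := by
  refine measurable_pi_lambda _ fun a => ?_
  unfold rescaledEnergies energy
  fun_prop

variable [Fintype ι] [DecidableEq ι]

open Matrix in
/-- The density of the rescaled energies of a family of configurations with squared overlaps `M`,
relative to that of independent uniform points of density `2^{-(n-1)}`. -/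
def relDensity (n : ℕ) (α : ℝ) (M : Matrix ι ι ℝ) (y : ι → ℝ) : ℝ :=
  (√M.det)⁻¹ * Real.exp ((Fintype.card ι * α ^ 2 -
    (fun a => α + scale n α * y a) ⬝ᵥ M⁻¹ *ᵥ (fun a => α + scale n α * y a)) / (2 * n))

theorem continuous_relDensity (n : ℕ) (α : ℝ) (M : Matrix ι ι ℝ) :
    Continuous (relDensity n α M) := by
  unfold relDensity
  fun_prop

theorem relDensity_nonneg (n : ℕ) (α : ℝ) (M : Matrix ι ι ℝ) (y : ι → ℝ) :
    0 ≤ relDensity n α M y := by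
  unfold relDensity
  positivity

open Matrix in
theorem map_rescaledEnergies (hn : 0 < n) (α : ℝ) (τ : ι → Spin n)
    (hM : (overlapMatrix τ).det ≠ 0) :
    (disorder n).map (rescaledEnergies α τ) =
      volume.withDensity fun y => ENNReal.ofReal
        ((((2 : ℝ) ^ (n - 1))⁻¹) ^ Fintype.card ι * relDensity n α (overlapMatrix τ) y) := by
  have hn' : (0 : ℝ) < n := by exact_mod_cast hn
  have hξ := scale_pos hn α
  set ξ := scale n α with hξd
  set M := overlapMatrix τ
  set W := ξ⁻¹ • couplingMatrix τ with hW
  have hC : W * Wᵀ = (n / ξ ^ 2) • M := by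
    rw [hW, transpose_smul, Matrix.smul_mul, Matrix.mul_smul, couplingMatrix_mul_transpose, smul_smul,
      smul_smul]
    congr 1
    field_simp
  have hc : (0 : ℝ) < n / ξ ^ 2 := by positivity
  have hdet : (W * Wᵀ).det = (n / ξ ^ 2) ^ Fintype.card ι * M.det := by rw [hC, det_smul]
  have hdet0 : (W * Wᵀ).det ≠ 0 := by
    rw [hdet]
    exact mul_ne_zero (pow_ne_zero _ hc.ne') hM
  have hx : rescaledEnergies α τ = (fun y => y - fun _ => α / ξ) ∘ fun X => W *ᵥ X := by
    funext X a
    simp only [rescaledEnergies, Function.comp, Pi.sub_apply, hW, smul_mulVec, Pi.smul_apply,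
      couplingMatrix_mulVec, smul_eq_mul, ← hξd]
    field_simp
  have hm : Measurable fun X : Couplings n => W *ᵥ X := Continuous.measurable (by fun_prop)
  have hms : Measurable fun y : ι → ℝ => y - fun _ => α / ξ := by fun_prop
  rw [hx, ← Measure.map_map hms hm, map_mulVec_pi_gaussianReal W hdet0]
  have key : ∀ y, gaussDensity (W * Wᵀ) (y + fun _ => α / ξ) =
      (((2 : ℝ) ^ (n - 1))⁻¹) ^ Fintype.card ι * relDensity n α M y := by
    intro y
    have hinv : (W * Wᵀ)⁻¹ = (n / ξ ^ 2)⁻¹ • M⁻¹ := by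
      rw [hC]
      have := Matrix.inv_smul' (A := M) (Units.mk0 _ hc.ne') hM.isUnit
      simpa [Units.smul_def] using this
    have hz : (y + fun _ => α / ξ) = ξ⁻¹ • fun a => α + ξ * y a := by
      funext a
      simp only [Pi.add_apply, Pi.smul_apply, smul_eq_mul]
      field_simp
      ring
    have hsqrt : √((n / ξ ^ 2) ^ Fintype.card ι * M.det) =
        (√n / ξ) ^ Fintype.card ι * √M.det := by
      rw [Real.sqrt_mul (by positivity)]
      congr 1
      rw [← Real.sqrt_sq (show 0 ≤ (√n / ξ) ^ Fintype.card ι by positivity)]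
      congr 1
      rw [← pow_mul, mul_comm _ 2, pow_mul, div_pow (√(n : ℝ)), Real.sq_sqrt hn'.le]
    -- This identity is the reason for the choice of `scale`: ξ times the density of N(0, n) at α
    -- equals 2^{-(n-1)}.
    have hpow : (√(2 * Real.pi) ^ Fintype.card ι)⁻¹ * ((√n / ξ) ^ Fintype.card ι)⁻¹ =
        (((2 : ℝ) ^ (n - 1))⁻¹) ^ Fintype.card ι *
          Real.exp (Fintype.card ι * (α ^ 2 / (2 * n))) := by
      rw [Real.exp_nat_mul, ← mul_inv, ← mul_pow, ← mul_pow, ← inv_pow]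
      congr 1
      have h1 : √(2 * Real.pi) * √n = √(2 * Real.pi * n) := by
        rw [← Real.sqrt_mul (by positivity)]
      have h2 : √(2 * Real.pi * n) ≠ 0 := by positivity
      rw [← mul_div_assoc, h1, inv_div, hξd, scale]
      field_simp
    rw [gaussDensity, relDensity, hdet, hinv, hz, hsqrt, mul_inv, ← mul_assoc, hpow, ← hξd]
    rw [smul_mulVec, mulVec_smul, dotProduct_smul, dotProduct_smul, smul_dotProduct]
    rw [sub_div, Real.exp_sub]
    set q := (fun a => α + ξ * y a) ⬝ᵥ M⁻¹ *ᵥ fun a => α + ξ * y a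
    have : -((n / ξ ^ 2 : ℝ)⁻¹ • ξ⁻¹ • ξ⁻¹ • q) / 2 = -(q / (2 * n)) := by
      simp only [smul_eq_mul]
      field_simp
    rw [this, Real.exp_neg, mul_div_assoc]
    ring
  refine Measure.ext_of_lintegral _ fun f hf => ?_
  have hg : Measurable fun y : ι → ℝ => ENNReal.ofReal (gaussDensity (W * Wᵀ) y) := by
    refine ENNReal.measurable_ofReal.comp (Continuous.measurable ?_)
    unfold gaussDensity
    fun_prop
  have hr : Measurable fun y => ENNReal.ofReal
      ((((2 : ℝ) ^ (n - 1))⁻¹) ^ Fintype.card ι * relDensity n α M y) := by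
    refine ENNReal.measurable_ofReal.comp (Continuous.measurable ?_)
    exact continuous_const.mul (continuous_relDensity n α M)
  have hfs : Measurable fun y : ι → ℝ => f (y - fun _ => α / ξ) := hf.comp hms
  rw [lintegral_map hf hms, lintegral_withDensity_eq_lintegral_mul _ hg hfs,
    lintegral_withDensity_eq_lintegral_mul _ hr hf, ← lintegral_add_right_eq_self _ (fun _ => α / ξ)]
  refine lintegral_congr fun y => ?_
  simp only [Pi.mul_apply, key, add_sub_cancel_right]

/-! ### Probabilities that several energies fall into the window -/

/-- The cube `[0, T]^ι`. -/
def window (ι : Type*) (T : ℝ) : Set (ι → ℝ) := Set.univ.pi fun _ => Set.Icc 0 T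

theorem measurableSet_window (ι : Type*) [Countable ι] (T : ℝ) : MeasurableSet (window ι T) :=
  MeasurableSet.univ_pi fun _ => measurableSet_Icc

section

variable {n : ℕ} {ι : Type*} [Fintype ι]

theorem volume_real_window {T : ℝ} (hT : 0 ≤ T) :
    (volume : Measure (ι → ℝ)).real (window ι T) = T ^ Fintype.card ι := by
  rw [window, measureReal_def, volume_pi_pi]
  simp [hT]

theorem volume_window_lt_top (T : ℝ) : (volume : Measure (ι → ℝ)) (window ι T) < ⊤ := by
  rw [window, Set.pi_univ_Icc]
  exact isCompact_Icc.measure_lt_top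

variable [DecidableEq ι]

theorem integral_indicator_rescaledEnergies (hn : 0 < n) (α T : ℝ) (τ : ι → Spin n)
    (hM : (overlapMatrix τ).det ≠ 0) {G : (ι → ℝ) → ℂ} (hG : Measurable G) :
    ∫ X, (window ι T).indicator G (rescaledEnergies α τ X) ∂(disorder n) =
      ∫ y in window ι T, ((((((2 : ℝ) ^ (n - 1))⁻¹) ^ Fintype.card ι *
        relDensity n α (overlapMatrix τ) y : ℝ)) : ℂ) * G y := by
  have hm := measurable_rescaledEnergies α τ
  have hmw := measurableSet_window ι T
  rw [← integral_map hm.aemeasurable (hG.indicator hmw).aestronglyMeasurable,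
    map_rescaledEnergies hn α τ hM, integral_withDensity_eq_integral_toReal_smul,
    ← integral_indicator hmw]
  · refine integral_congr_ae (Eventually.of_forall fun y => ?_)
    simp only []
    rw [ENNReal.toReal_ofReal (mul_nonneg (by positivity) (relDensity_nonneg _ _ _ _))]
    by_cases hy : y ∈ window ι T
    · simp [hy]
    · simp [hy]
  · exact (ENNReal.measurable_ofReal.comp
      (continuous_const.mul (continuous_relDensity n α _)).measurable)
  · exact Eventually.of_forall fun y => ENNReal.ofReal_lt_top

theorem prob_window_eq (hn : 0 < n) (α T : ℝ) (τ : ι → Spin n)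
    (hM : (overlapMatrix τ).det ≠ 0) :
    (disorder n).real (rescaledEnergies α τ ⁻¹' window ι T) =
      (((2 : ℝ) ^ (n - 1))⁻¹) ^ Fintype.card ι *
        ∫ y in window ι T, relDensity n α (overlapMatrix τ) y := by
  have h := integral_indicator_rescaledEnergies hn α T τ hM (G := fun _ => 1) measurable_const
  have hm := measurable_rescaledEnergies α τ
  have hmw := measurableSet_window ι T
  have h1 : ∫ X, (window ι T).indicator (fun _ => (1 : ℂ)) (rescaledEnergies α τ X) ∂(disorder n) =
      ((disorder n).real (rescaledEnergies α τ ⁻¹' window ι T) : ℂ) := by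
    have : (fun X => (window ι T).indicator (fun _ => (1 : ℂ)) (rescaledEnergies α τ X)) =
        (rescaledEnergies α τ ⁻¹' window ι T).indicator (fun _ => (1 : ℂ)) := by
      rfl
    rw [this, integral_indicator (hm hmw)]
    simp
  rw [h1] at h
  simp only [mul_one] at h
  rw [integral_complex_ofReal, Complex.ofReal_inj, integral_const_mul] at h
  exact h

theorem integrableOn_relDensity (n : ℕ) (α T : ℝ) (M : Matrix ι ι ℝ) :
    IntegrableOn (relDensity n α M) (window ι T) := by
  rw [window, Set.pi_univ_Icc]
  exact (continuous_relDensity n α M).integrableOn_Icc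

theorem prob_window_le (hn : 0 < n) (α : ℝ) {T ρ : ℝ} (hT : 0 ≤ T) (τ : ι → Spin n)
    (hM : (overlapMatrix τ).det ≠ 0)
    (hρ : ∀ y ∈ window ι T, relDensity n α (overlapMatrix τ) y ≤ ρ) :
    (disorder n).real (rescaledEnergies α τ ⁻¹' window ι T) ≤
      (((2 : ℝ) ^ (n - 1))⁻¹ * T) ^ Fintype.card ι * ρ := by
  rw [prob_window_eq hn α T τ hM, mul_pow, mul_assoc]
  gcongr
  calc ∫ y in window ι T, relDensity n α (overlapMatrix τ) y
      ≤ ∫ y in window ι T, ρ := by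
        refine setIntegral_mono_on (integrableOn_relDensity _ _ _ _)
          (integrableOn_const (volume_window_lt_top T).ne) (measurableSet_window ι T) hρ
    _ = T ^ Fintype.card ι * ρ := by
        rw [setIntegral_const, volume_real_window hT, smul_eq_mul]

theorem le_prob_window (hn : 0 < n) (α : ℝ) {T ρ : ℝ} (hT : 0 ≤ T) (τ : ι → Spin n)
    (hM : (overlapMatrix τ).det ≠ 0)
    (hρ : ∀ y ∈ window ι T, ρ ≤ relDensity n α (overlapMatrix τ) y) :
    (((2 : ℝ) ^ (n - 1))⁻¹ * T) ^ Fintype.card ι * ρ ≤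
      (disorder n).real (rescaledEnergies α τ ⁻¹' window ι T) := by
  rw [prob_window_eq hn α T τ hM, mul_pow, mul_assoc]
  gcongr
  calc T ^ Fintype.card ι * ρ = ∫ y in window ι T, ρ := by
        rw [setIntegral_const, volume_real_window hT, smul_eq_mul]
    _ ≤ ∫ y in window ι T, relDensity n α (overlapMatrix τ) y := by
        refine setIntegral_mono_on (integrableOn_const (volume_window_lt_top T).ne)
          (integrableOn_relDensity _ _ _ _) (measurableSet_window ι T) hρ

/-- The bound is the same for all test functions `G` of norm at most one. This uniformity is needed
later, where the test functions depend on n. -/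
theorem norm_integral_sub_le_of_relDensity (hn : 0 < n) (α : ℝ) {T ρ : ℝ} (hT : 0 ≤ T)
    (τ : ι → Spin n) (hM : (overlapMatrix τ).det ≠ 0)
    (hρ : ∀ y ∈ window ι T, |relDensity n α (overlapMatrix τ) y - 1| ≤ ρ)
    {G : (ι → ℝ) → ℂ} (hG : Measurable G) (hG1 : ∀ y, ‖G y‖ ≤ 1) :
    ‖∫ X, (window ι T).indicator G (rescaledEnergies α τ X) ∂(disorder n) -
      ((((2 : ℝ) ^ (n - 1))⁻¹ ^ Fintype.card ι : ℝ) : ℂ) * ∫ y in window ι T, G y‖ ≤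
      (((2 : ℝ) ^ (n - 1))⁻¹ * T) ^ Fintype.card ι * ρ := by
  rw [integral_indicator_rescaledEnergies hn α T τ hM hG, ← integral_const_mul]
  have hfin := volume_window_lt_top (ι := ι) T
  have hGi : IntegrableOn G (window ι T) :=
    Measure.integrableOn_of_bounded hfin.ne hG.aestronglyMeasurable
      (Eventually.of_forall hG1)
  have hRi := integrableOn_relDensity (ι := ι) n α T (overlapMatrix τ)
  set R := relDensity n α (overlapMatrix τ) with hR
  set p : ℝ := (((2 : ℝ) ^ (n - 1))⁻¹) ^ Fintype.card ι with hp
  have hp0 : 0 ≤ p := by positivity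
  have hi : IntegrableOn (fun y => ((p * R y : ℝ) : ℂ) * G y) (window ι T) := by
    have : IntegrableOn (fun y => ((p * R y : ℝ) : ℂ)) (window ι T) :=
      (hRi.const_mul p).ofReal
    exact this.mul_bdd (c := 1) hG.aestronglyMeasurable (Eventually.of_forall hG1)
  rw [← integral_sub hi (hGi.const_mul _)]
  calc ‖∫ y in window ι T, (((p * R y : ℝ) : ℂ) * G y - (p : ℂ) * G y)‖
      ≤ (p * ρ) * (volume : Measure (ι → ℝ)).real (window ι T) := by
        refine norm_setIntegral_le_of_norm_le_const hfin fun y hy => ?_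
        have : ((p * R y : ℝ) : ℂ) * G y - (p : ℂ) * G y = ((p * (R y - 1) : ℝ) : ℂ) * G y := by
          push_cast; ring
        rw [this, norm_mul, Complex.norm_real, Real.norm_eq_abs, abs_mul, abs_of_nonneg hp0]
        calc p * |R y - 1| * ‖G y‖ ≤ p * ρ * 1 := by
              gcongr
              · exact mul_nonneg hp0 ((abs_nonneg _).trans (hρ y hy))
              · exact hρ y hy
              · exact hG1 y
          _ = p * ρ := mul_one _
    _ = (((2 : ℝ) ^ (n - 1))⁻¹ * T) ^ Fintype.card ι * ρ := by
        rw [volume_real_window hT, mul_pow]; ring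

end

/-! ### Elementary properties of overlaps -/

section Overlap

variable {n : ℕ}

theorem spin_mul_self (σ : Spin n) (i : Fin n) : ((σ i : ℤ) : ℝ) * ((σ i : ℤ) : ℝ) = 1 := by
  rcases Int.units_eq_one_or (σ i) with h | h <;> simp [h]

theorem overlap_self (hn : 0 < n) (σ : Spin n) : overlap σ σ = 1 := by
  have : (n : ℝ) ≠ 0 := by exact_mod_cast hn.ne'
  simp only [overlap, spin_mul_self]
  simp [this]

theorem overlap_comm (σ τ : Spin n) : overlap σ τ = overlap τ σ := by
  simp only [overlap, mul_comm]

theorem abs_overlap_le_one (σ τ : Spin n) : |overlap σ τ| ≤ 1 := by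
  rcases Nat.eq_zero_or_pos n with rfl | hn
  · simp [overlap]
  have hn' : (0 : ℝ) < n := by exact_mod_cast hn
  rw [overlap, abs_mul, abs_of_nonneg (by positivity : 0 ≤ 1 / (n : ℝ))]
  calc 1 / (n : ℝ) * |∑ k, ((σ k : ℤ) : ℝ) * ((τ k : ℤ) : ℝ)|
      ≤ 1 / (n : ℝ) * ∑ k : Fin n, (1 : ℝ) := by
        gcongr
        refine (Finset.abs_sum_le_sum_abs _ _).trans (Finset.sum_le_sum fun k _ => ?_)
        rcases Int.units_eq_one_or (σ k) with h | h <;>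
        rcases Int.units_eq_one_or (τ k) with h' | h' <;> simp [h, h']
    _ = 1 := by simp; field_simp

end Overlap

/-! ### Determinant and inverse of a matrix close to the identity -/

section Matrix

open Matrix

variable {ι : Type*} [Fintype ι] [DecidableEq ι]

/-- The sum of the off-diagonal entries. -/
def offSum (M : Matrix ι ι ℝ) : ℝ := ∑ a, ∑ b, if a = b then 0 else M a b

theorem offSum_nonneg {M : Matrix ι ι ℝ} (h0 : ∀ a b, 0 ≤ M a b) : 0 ≤ offSum M :=
  Finset.sum_nonneg fun a _ => Finset.sum_nonneg fun b _ => by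
    split_ifs
    · rfl
    · exact h0 a b

theorem le_offSum {M : Matrix ι ι ℝ} (h0 : ∀ a b, 0 ≤ M a b) {a b : ι} (hab : a ≠ b) :
    M a b ≤ offSum M := by
  have h1 : ∀ a b, (0 : ℝ) ≤ if a = b then 0 else M a b := by
    intro a b
    split_ifs
    · rfl
    · exact h0 a b
  calc M a b = if a = b then 0 else M a b := by simp [hab]
    _ ≤ ∑ b, if a = b then 0 else M a b :=
        Finset.single_le_sum (f := fun b => if a = b then 0 else M a b)
          (fun b _ => h1 a b) (Finset.mem_univ b)
    _ ≤ offSum M := Finset.single_le_sum (f := fun a => ∑ b, if a = b then 0 else M a b)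
          (fun a _ => Finset.sum_nonneg fun b _ => h1 a b) (Finset.mem_univ a)

/-- In the Leibniz formula the identity contributes 1. Any other permutation moves some index, so
its product contains an off-diagonal entry, and the remaining factors are at most 1. -/
theorem abs_det_sub_one_le {M : Matrix ι ι ℝ} (h0 : ∀ a b, 0 ≤ M a b) (h1 : ∀ a b, M a b ≤ 1)
    (hd : ∀ a, M a a = 1) : |M.det - 1| ≤ (Fintype.card ι).factorial * offSum M := by
  have hb := offSum_nonneg h0
  rw [det_apply, ← Finset.add_sum_erase _ _ (Finset.mem_univ (1 : Equiv.Perm ι))]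
  simp only [Equiv.Perm.sign_one, one_smul, Equiv.Perm.coe_one, id_eq, hd, Finset.prod_const_one,
    add_sub_cancel_left]
  refine (Finset.abs_sum_le_sum_abs _ _).trans ?_
  calc ∑ π ∈ Finset.univ.erase (1 : Equiv.Perm ι), |Equiv.Perm.sign π • ∏ i, M (π i) i|
      ≤ ∑ π ∈ Finset.univ.erase (1 : Equiv.Perm ι), offSum M := by
        refine Finset.sum_le_sum fun π hπ => ?_
        obtain ⟨i, hi⟩ : ∃ i, π i ≠ i := by
          by_contra! h
          exact (Finset.ne_of_mem_erase hπ) (Equiv.ext h)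
        have hprod : 0 ≤ ∏ i, M (π i) i := Finset.prod_nonneg fun i _ => h0 _ _
        have habs : |Equiv.Perm.sign π • ∏ i, M (π i) i| = ∏ i, M (π i) i := by
          rcases Int.units_eq_one_or (Equiv.Perm.sign π) with h | h
          · rw [h, one_smul, abs_of_nonneg hprod]
          · rw [h, Units.neg_smul, one_smul, abs_neg, abs_of_nonneg hprod]
        rw [habs, ← Finset.mul_prod_erase _ _ (Finset.mem_univ i)]
        calc M (π i) i * ∏ j ∈ Finset.univ.erase i, M (π j) j ≤ M (π i) i * 1 := by
              gcongr
              · exact h0 _ _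
              · exact Finset.prod_le_one (fun j _ => h0 _ _) fun j _ => h1 _ _
          _ ≤ offSum M := by rw [mul_one]; exact le_offSum h0 hi
    _ ≤ ∑ π : Equiv.Perm ι, offSum M :=
        Finset.sum_le_sum_of_subset_of_nonneg (Finset.erase_subset _ _) fun _ _ _ => hb
    _ = (Fintype.card ι).factorial * offSum M := by
        rw [Finset.sum_const, Finset.card_univ, Fintype.card_perm, nsmul_eq_mul]

/-- Write M = 1 + B. Then z = M⁻¹y satisfies z = y - Bz, and row sums of B at most 1/2 give |z| ≤ 2Y
in the supremum norm. The error is exactly -y·Bz. -/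
theorem abs_quadForm_inv_sub_le {M : Matrix ι ι ℝ} (h0 : ∀ a b, 0 ≤ M a b)
    (hd : ∀ a, M a a = 1) (hdet : M.det ≠ 0) (hb : offSum M ≤ 1 / 2) {Y : ℝ} {y : ι → ℝ}
    (hy : ∀ a, |y a| ≤ Y) :
    |y ⬝ᵥ M⁻¹ *ᵥ y - ∑ a, y a ^ 2| ≤ 2 * offSum M * Y ^ 2 := by
  rcases isEmpty_or_nonempty ι with he | he
  · have h0' := offSum_nonneg h0
    simp only [dotProduct, Finset.univ_eq_empty, Finset.sum_empty, sub_zero, abs_zero]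
    positivity
  have hb0 := offSum_nonneg h0
  set z := M⁻¹ *ᵥ y with hz
  have hMz : M *ᵥ z = y := by
    rw [hz, mulVec_mulVec, mul_nonsing_inv _ hdet.isUnit, one_mulVec]
  have hY : 0 ≤ Y := (abs_nonneg _).trans (hy (Classical.arbitrary ι))
  set B : Matrix ι ι ℝ := fun a b => if a = b then 0 else M a b with hB
  have hB0 : ∀ a b, 0 ≤ B a b := by
    intro a b
    simp only [hB]
    split_ifs
    · rfl
    · exact h0 a b
  have hyz : ∀ a, y a = z a + ∑ b, B a b * z b := by
    intro a
    conv_lhs => rw [← hMz]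
    simp only [mulVec, dotProduct]
    have : ∀ b, M a b * z b = (if a = b then z b else 0) + B a b * z b := by
      intro b
      simp only [hB]
      split_ifs with h
      · subst h; simp [hd]
      · simp
    rw [Finset.sum_congr rfl fun b _ => this b, Finset.sum_add_distrib]
    simp
  obtain ⟨a₀, ha₀⟩ := Finite.exists_max fun a => |z a|
  have hrow : ∀ a, ∑ b, B a b ≤ offSum M := fun a =>
    Finset.single_le_sum (f := fun a => ∑ b, B a b)
      (fun a _ => Finset.sum_nonneg fun b _ => hB0 a b) (Finset.mem_univ a)
  have hBz : ∀ a, |∑ b, B a b * z b| ≤ (∑ b, B a b) * |z a₀| := by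
    intro a
    rw [Finset.sum_mul]
    refine (Finset.abs_sum_le_sum_abs _ _).trans (Finset.sum_le_sum fun b _ => ?_)
    rw [abs_mul, abs_of_nonneg (hB0 a b)]
    exact mul_le_mul_of_nonneg_left (ha₀ b) (hB0 a b)
  have hzY : |z a₀| ≤ 2 * Y := by
    have h1 : |z a₀| ≤ |y a₀| + |∑ b, B a₀ b * z b| := by
      have : z a₀ = y a₀ - ∑ b, B a₀ b * z b := by rw [hyz a₀]; ring
      rw [this]
      exact abs_sub _ _
    have h2 : (∑ b, B a₀ b) * |z a₀| ≤ 1 / 2 * |z a₀| := by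
      gcongr
      exact (hrow a₀).trans hb
    linarith [hy a₀, hBz a₀]
  have hdiff : y ⬝ᵥ z - ∑ a, y a ^ 2 = -∑ a, y a * ∑ b, B a b * z b := by
    rw [dotProduct, ← Finset.sum_sub_distrib, ← Finset.sum_neg_distrib]
    refine Finset.sum_congr rfl fun a _ => ?_
    have : z a = y a - ∑ b, B a b * z b := by rw [hyz a]; ring
    rw [this]
    ring
  rw [hdiff, abs_neg]
  calc |∑ a, y a * ∑ b, B a b * z b| ≤ ∑ a, Y * ((∑ b, B a b) * (2 * Y)) := by
        refine (Finset.abs_sum_le_sum_abs _ _).trans (Finset.sum_le_sum fun a _ => ?_)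
        rw [abs_mul]
        gcongr
        · exact hy a
        · refine (hBz a).trans ?_
          gcongr
          exact Finset.sum_nonneg fun b _ => hB0 a b
    _ = 2 * offSum M * Y ^ 2 := by
        rw [← Finset.mul_sum, ← Finset.sum_mul, offSum]
        simp only [hB]
        ring

theorem exp_bounds_inv_sqrt {d e : ℝ} (he : |d - 1| ≤ e) (he2 : e ≤ 1 / 2) :
    Real.exp (-e) ≤ (√d)⁻¹ ∧ (√d)⁻¹ ≤ Real.exp e := by
  have he0 : 0 ≤ e := (abs_nonneg _).trans he
  obtain ⟨h1, h2⟩ := abs_le.mp he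
  have hd : 0 < d := by linarith
  have hs : 0 < √d := Real.sqrt_pos.mpr hd
  constructor
  · rw [Real.exp_neg]
    refine inv_anti₀ hs ?_
    rw [Real.sqrt_le_left (Real.exp_pos e).le, ← Real.exp_nat_mul]
    push_cast
    linarith [Real.add_one_le_exp (2 * e)]
  · rw [← inv_inv (Real.exp e), ← Real.exp_neg]
    refine inv_anti₀ (Real.exp_pos _) ?_
    refine Real.le_sqrt_of_sq_le ?_
    rw [← Real.exp_nat_mul]
    push_cast
    have h3 : Real.exp (2 * -e) * Real.exp (2 * e) = 1 := by
      rw [← Real.exp_add]; simp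
    have h4 := Real.add_one_le_exp (2 * e)
    have h5 := Real.exp_pos (2 * -e)
    have h6 : Real.exp (2 * -e) * (1 + 2 * e) ≤ 1 := by nlinarith
    -- The condition e ≤ 1/2 enters through (1 - e)(1 + 2e) ≥ 1.
    nlinarith

/-- With L the exponent on the right, the relative density lies between e^{-L} and e^L, and e^{-L} ≥
2 - e^L makes the bound symmetric. The part of L proportional to `offSum` comes from the determinant
and the correlations, the other part from the variation of the energy over the window. -/
theorem abs_relDensity_sub_one_le {n : ℕ} (hn : 0 < n) {α T : ℝ} (hα : 0 ≤ α)
    {M : Matrix ι ι ℝ} (h0 : ∀ a b, 0 ≤ M a b) (h1 : ∀ a b, M a b ≤ 1) (hd : ∀ a, M a a = 1)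
    (hb : (Fintype.card ι).factorial * offSum M ≤ 1 / 2) {y : ι → ℝ} (hy : y ∈ window ι T) :
    |relDensity n α M y - 1| ≤ Real.exp (offSum M * ((Fintype.card ι).factorial +
      (α + scale n α * T) ^ 2 / n) +
      Fintype.card ι * ((α + scale n α * T) ^ 2 - α ^ 2) / (2 * n)) - 1 := by
  have hn' : (0 : ℝ) < n := by exact_mod_cast hn
  have hξ := scale_pos hn α
  set ξ := scale n α with hξd
  set Y := α + ξ * T with hY
  set k := Fintype.card ι with hk
  have hb0 := offSum_nonneg h0
  have hfac : (1 : ℝ) ≤ k.factorial := by exact_mod_cast k.factorial_pos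
  have hb1 : offSum M ≤ 1 / 2 := by nlinarith
  have hde := abs_det_sub_one_le h0 h1 hd
  have hdet : M.det ≠ 0 := by
    intro h
    rw [h] at hde
    norm_num at hde
    linarith
  obtain ⟨hs1, hs2⟩ := exp_bounds_inv_sqrt hde hb
  have hyI : ∀ a, y a ∈ Set.Icc 0 T := fun a => hy a (Set.mem_univ a)
  have hup : ∀ a, α + ξ * y a ≤ Y := fun a => by
    rw [hY]; gcongr; exact (hyI a).2
  have hlo : ∀ a, α ≤ α + ξ * y a := fun a => by
    have := mul_nonneg hξ.le (hyI a).1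
    linarith
  have hq := abs_quadForm_inv_sub_le (y := fun a => α + ξ * y a) (Y := Y) h0 hd hdet hb1
    (fun a => by rw [abs_of_nonneg (hα.trans (hlo a))]; exact hup a)
  have hsum1 : k * α ^ 2 ≤ ∑ a, (α + ξ * y a) ^ 2 := by
    have : ∑ a : ι, α ^ 2 ≤ ∑ a, (α + ξ * y a) ^ 2 := Finset.sum_le_sum fun a _ => by
      have := hlo a
      gcongr
    simpa [hk] using this
  have hsum2 : ∑ a, (α + ξ * y a) ^ 2 ≤ k * Y ^ 2 := by
    have : ∑ a, (α + ξ * y a) ^ 2 ≤ ∑ a : ι, Y ^ 2 := Finset.sum_le_sum fun a _ => by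
      have := hlo a
      have := hup a
      have : 0 ≤ α + ξ * y a := hα.trans (hlo a)
      gcongr
    simpa [hk] using this
  set Q := (fun a => α + ξ * y a) ⬝ᵥ M⁻¹ *ᵥ fun a => α + ξ * y a with hQ
  obtain ⟨hq1, hq2⟩ := abs_le.mp hq
  set L := offSum M * (k.factorial + Y ^ 2 / n) + k * (Y ^ 2 - α ^ 2) / (2 * n) with hL
  have hLe : L = k.factorial * offSum M +
      (2 * offSum M * Y ^ 2 + k * (Y ^ 2 - α ^ 2)) / (2 * n) := by
    rw [hL]; field_simp; ring
  have hR : relDensity n α M y = (√M.det)⁻¹ * Real.exp ((k * α ^ 2 - Q) / (2 * n)) := rfl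
  have hup' : relDensity n α M y ≤ Real.exp L := by
    rw [hR, hLe, Real.exp_add]
    gcongr
    have : 0 ≤ (k : ℝ) * (Y ^ 2 - α ^ 2) := by linarith
    linarith
  have hlo' : Real.exp (-L) ≤ relDensity n α M y := by
    rw [hR, hLe, neg_add, Real.exp_add, ← neg_div]
    gcongr
    linarith
  have h3 := Real.add_one_le_exp L
  have h4 := Real.add_one_le_exp (-L)
  have h5 : 2 - Real.exp L ≤ Real.exp (-L) := by
    have h6 : Real.exp (-L) * Real.exp L = 1 := by rw [← Real.exp_add]; simp
    nlinarith [sq_nonneg (Real.exp L - 1), Real.exp_pos L, Real.exp_pos (-L)]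
  rw [abs_le]
  constructor <;> linarith

end Matrix

/-! ### Crude density bounds for arbitrary independent families -/

section OverlapMatrix

open Matrix

variable {n : ℕ} {ι : Type*}

theorem overlapMatrix_nonneg (τ : ι → Spin n) (a b : ι) : 0 ≤ overlapMatrix τ a b := sq_nonneg _

theorem overlapMatrix_le_one (τ : ι → Spin n) (a b : ι) : overlapMatrix τ a b ≤ 1 := by
  rw [overlapMatrix, sq_le_one_iff_abs_le_one]
  exact abs_overlap_le_one _ _

theorem overlapMatrix_self (hn : 0 < n) (τ : ι → Spin n) (a : ι) : overlapMatrix τ a a = 1 := by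
  rw [overlapMatrix, overlap_self hn, one_pow]

variable [Fintype ι]

theorem posSemidef_overlapMatrix (hn : 0 < n) (τ : ι → Spin n) :
    (overlapMatrix τ).PosSemidef := by
  have hn' : (0 : ℝ) < n := by exact_mod_cast hn
  have h := Matrix.posSemidef_self_mul_conjTranspose (couplingMatrix τ)
  rw [conjTranspose_eq_transpose_of_trivial, couplingMatrix_mul_transpose] at h
  have h2 := h.smul (inv_nonneg.mpr hn'.le)
  rwa [smul_smul, inv_mul_cancel₀ hn'.ne', one_smul] at h2

variable [DecidableEq ι]

/-- The matrix n²M has integer entries, so its determinant, being positive, is at least 1. -/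
theorem inv_sqrt_det_overlapMatrix_le (hn : 0 < n) (τ : ι → Spin n)
    (hM : (overlapMatrix τ).det ≠ 0) : (√(overlapMatrix τ).det)⁻¹ ≤ (n : ℝ) ^ Fintype.card ι := by
  have hn' : (0 : ℝ) < n := by exact_mod_cast hn
  have hpos : 0 < (overlapMatrix τ).det :=
    lt_of_le_of_ne (posSemidef_overlapMatrix hn τ).det_nonneg hM.symm
  set A : Matrix ι ι ℤ := fun a b => (∑ k, ((τ a k : ℤ)) * (τ b k : ℤ)) ^ 2 with hA
  have hAM : A.map (Int.cast : ℤ → ℝ) = ((n : ℝ) ^ 2) • overlapMatrix τ := by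
    ext a b
    have h : A.map (Int.cast : ℤ → ℝ) a b = (((∑ k, ((τ a k : ℤ)) * (τ b k : ℤ)) ^ 2 : ℤ) : ℝ) :=
      rfl
    rw [h]
    simp only [Matrix.smul_apply, overlapMatrix, overlap, smul_eq_mul]
    push_cast
    field_simp
  have hdet : ((A.det : ℤ) : ℝ) = ((n : ℝ) ^ 2) ^ Fintype.card ι * (overlapMatrix τ).det := by
    have := (Int.castRingHom ℝ).map_det A
    simp only [eq_intCast, RingHom.mapMatrix_apply] at this
    rw [this, ← det_smul, ← hAM]
    rfl
  have h1 : (1 : ℝ) ≤ (A.det : ℤ) := by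
    have : 0 < A.det := by
      have : (0 : ℝ) < (A.det : ℤ) := by rw [hdet]; positivity
      exact_mod_cast this
    exact_mod_cast this
  rw [hdet] at h1
  rw [inv_le_comm₀ (Real.sqrt_pos.mpr hpos) (by positivity)]
  refine Real.le_sqrt_of_sq_le ?_
  rw [inv_pow, inv_le_iff_one_le_mul₀ (by positivity), ← pow_mul, mul_comm _ 2, pow_mul]
  linarith

/-- The quadratic form is nonnegative and is dropped. The price is a factor n·exp(α²/(2n)) per
member, affordable only for exponentially rare families. -/
theorem relDensity_le (hn : 0 < n) (α : ℝ) (τ : ι → Spin n)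
    (hM : (overlapMatrix τ).det ≠ 0) (y : ι → ℝ) :
    relDensity n α (overlapMatrix τ) y ≤
      (n : ℝ) ^ Fintype.card ι * Real.exp (α ^ 2 / (2 * n)) ^ Fintype.card ι := by
  have hn' : (0 : ℝ) < n := by exact_mod_cast hn
  have hq : 0 ≤ (fun a => α + scale n α * y a) ⬝ᵥ
      (overlapMatrix τ)⁻¹ *ᵥ (fun a => α + scale n α * y a) := by
    have := (posSemidef_overlapMatrix hn τ).inv.dotProduct_mulVec_nonneg
      (fun a => α + scale n α * y a)
    simpa using this
  rw [relDensity, ← Real.exp_nat_mul]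
  gcongr
  · exact inv_sqrt_det_overlapMatrix_le hn τ hM
  · rw [← mul_div_assoc]
    gcongr
    linarith

theorem prob_window_le_of_det_ne_zero (hn : 0 < n) (α : ℝ) {T : ℝ} (hT : 0 ≤ T) (τ : ι → Spin n)
    (hM : (overlapMatrix τ).det ≠ 0) :
    (disorder n).real (rescaledEnergies α τ ⁻¹' window ι T) ≤
      (((2 : ℝ) ^ (n - 1))⁻¹ * T * (n * Real.exp (α ^ 2 / (2 * n)))) ^ Fintype.card ι := by
  have := prob_window_le hn α hT τ hM fun y _ => relDensity_le hn α τ hM y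
  rwa [← mul_pow, ← mul_pow] at this

end OverlapMatrix

/-! ### Exponential moments of the overlaps -/

section Averages

variable {n : ℕ}

theorem sum_spin_exp_mul (σ : Spin n) (x : ℝ) :
    ∑ τ : Spin n, Real.exp (x * ∑ k, ((σ k : ℤ) : ℝ) * ((τ k : ℤ) : ℝ)) =
      2 ^ n * Real.cosh x ^ n := by
  have h : ∀ τ : Spin n, Real.exp (x * ∑ k, ((σ k : ℤ) : ℝ) * ((τ k : ℤ) : ℝ)) =
      ∏ k, Real.exp (x * (((σ k : ℤ) : ℝ) * ((τ k : ℤ) : ℝ))) := by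
    intro τ
    rw [Finset.mul_sum, Real.exp_sum]
  simp_rw [h]
  have h2 := Finset.prod_univ_sum (fun _ : Fin n => (Finset.univ : Finset ℤˣ))
    fun k s => Real.exp (x * (((σ k : ℤ) : ℝ) * ((s : ℤ) : ℝ)))
  rw [Fintype.piFinset_univ] at h2
  rw [← h2]
  have h3 : ∀ k, ∑ s : ℤˣ, Real.exp (x * (((σ k : ℤ) : ℝ) * ((s : ℤ) : ℝ))) =
      2 * Real.cosh x := by
    intro k
    rw [Real.cosh_eq]
    have hu : (Finset.univ : Finset ℤˣ) = {1, -1} := rfl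
    rw [hu, Finset.sum_pair (by decide)]
    rcases Int.units_eq_one_or (σ k) with h | h <;> simp [h] <;> ring
  rw [Finset.prod_congr rfl fun k _ => h3 k, Finset.prod_const, Finset.card_univ, Fintype.card_fin,
    mul_pow]

theorem integral_exp_sq_div_four_gaussianReal :
    Integrable (fun g : ℝ => Real.exp (g ^ 2 / 4)) (gaussianReal 0 1) ∧
      ∫ g, Real.exp (g ^ 2 / 4) ∂(gaussianReal 0 1) = √2 := by
  have hpt : ∀ g : ℝ, gaussianPDFReal 0 1 g * Real.exp (g ^ 2 / 4) =
      (√(2 * Real.pi))⁻¹ * Real.exp (-(1 / 4) * g ^ 2) := by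
    intro g
    rw [gaussianPDFReal]
    simp only [NNReal.coe_one, mul_one, sub_zero]
    rw [mul_assoc, ← Real.exp_add]
    congr 2
    ring
  constructor
  · rw [gaussianReal_of_var_ne_zero _ (by norm_num), gaussianPDF_def,
      integrable_withDensity_iff_integrable_smul' (by fun_prop)
        (Eventually.of_forall fun _ => ENNReal.ofReal_lt_top)]
    refine ((integrable_exp_neg_mul_sq (b := 1 / 4) (by norm_num)).const_mul
      ((√(2 * Real.pi))⁻¹)).congr (Eventually.of_forall fun g => ?_)
    simp only [smul_eq_mul]
    rw [ENNReal.toReal_ofReal (gaussianPDFReal_nonneg _ _ _), hpt]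
  · rw [integral_gaussianReal_eq_integral_smul (by norm_num)]
    simp_rw [smul_eq_mul, hpt]
    rw [integral_const_mul, integral_gaussian]
    rw [← Real.sqrt_inv, ← Real.sqrt_mul (by positivity)]
    congr 1
    field_simp
    norm_num

/-- Gaussian linearisation: with S = n·overlap, exp(S²/(4n)) is the expectation of exp(Sg/√(2n)) for
a standard normal g. The sum over τ then factorises into cosh(g/√(2n))^n ≤ exp(g²/4), whose
expectation is at most √2. -/
theorem sum_exp_overlap_sq_le (hn : 0 < n) (σ : Spin n) :
    ∑ τ : Spin n, Real.exp (n * overlap σ τ ^ 2 / 4) ≤ 2 * 2 ^ n := by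
  have hn' : (0 : ℝ) < n := by exact_mod_cast hn
  set S : Spin n → ℝ := fun τ => ∑ k, ((σ k : ℤ) : ℝ) * ((τ k : ℤ) : ℝ) with hS
  set r : ℝ := √(2 * n) with hr
  have hr0 : 0 < r := by positivity
  have hr2 : r ^ 2 = 2 * n := Real.sq_sqrt (by positivity)
  have h1 : ∀ τ, Real.exp (n * overlap σ τ ^ 2 / 4) =
      ∫ g, Real.exp (S τ / r * g) ∂(gaussianReal 0 1) := by
    intro τ
    have := mgf_gaussianReal (X := id) (p := gaussianReal 0 1) (μ := 0) (v := 1)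
      (by simp) (S τ / r)
    rw [mgf] at this
    simp only [id_eq] at this
    rw [this]
    congr 1
    simp only [overlap]
    rw [div_pow, hr2]
    push_cast
    field_simp
    ring
  have h_int : ∀ τ, Integrable (fun g => Real.exp (S τ / r * g)) (gaussianReal 0 1) := fun τ => by
    simpa using integrable_exp_mul_gaussianReal (μ := 0) (v := 1) (S τ / r)
  simp_rw [h1]
  rw [← integral_finsetSum _ fun τ _ => h_int τ]
  obtain ⟨hi, hv⟩ := integral_exp_sq_div_four_gaussianReal
  calc ∫ g, ∑ τ, Real.exp (S τ / r * g) ∂(gaussianReal 0 1)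
      ≤ ∫ g, 2 ^ n * Real.exp (g ^ 2 / 4) ∂(gaussianReal 0 1) := by
        refine integral_mono (integrable_finsetSum _ fun τ _ => h_int τ) (hi.const_mul _) fun g => ?_
        have h2 : ∀ τ, S τ / r * g = g / r * S τ := fun τ => by ring
        simp only [h2]
        simp only [hS]
        rw [sum_spin_exp_mul]
        gcongr
        calc Real.cosh (g / r) ^ n ≤ Real.exp ((g / r) ^ 2 / 2) ^ n := by
              gcongr
              exact Real.cosh_le_exp_half_sq _
          _ = Real.exp (g ^ 2 / 4) := by
              rw [← Real.exp_nat_mul, div_pow, hr2]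
              congr 1
              field_simp
              ring
    _ = 2 ^ n * √2 := by rw [integral_const_mul, hv]
    _ ≤ 2 * 2 ^ n := by
        rw [mul_comm]
        gcongr
        rw [Real.sqrt_le_left (by norm_num)]
        norm_num

variable {ι : Type*} [Fintype ι] [DecidableEq ι]

theorem sum_exp_overlapMatrix_entry_le (hn : 0 < n) (a b : ι) :
    ∑ τ : ι → Spin n, Real.exp (n * (if a = b then 0 else overlapMatrix τ a b) / 4) ≤
      2 * (2 ^ n) ^ Fintype.card ι := by
  have hcard : Fintype.card (Spin n) = 2 ^ n := by simp [Spin]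
  by_cases hab : a = b
  · simp only [hab, if_true, mul_zero, zero_div, Real.exp_zero, Finset.sum_const, Finset.card_univ,
      Fintype.card_fun, hcard, nsmul_eq_mul, mul_one]
    push_cast
    linarith [pow_pos (pow_pos (two_pos : (0 : ℝ) < 2) n) (Fintype.card ι)]
  · simp only [hab, if_false]
    -- With all members except `b` held fixed, only the sum over the configuration at `b` matters,
    -- and it does not depend on the configuration at `a`.
    rw [← (Equiv.funSplitAt b (Spin n)).symm.sum_comp, Fintype.sum_prod_type, Finset.sum_comm]
    have h : ∀ (ρ : {j // j ≠ b} → Spin n), ∑ s : Spin n,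
        Real.exp (n * overlapMatrix ((Equiv.funSplitAt b (Spin n)).symm (s, ρ)) a b / 4) ≤
          2 * 2 ^ n := by
      intro ρ
      refine le_trans (le_of_eq (Finset.sum_congr rfl fun s _ => ?_))
        (sum_exp_overlap_sq_le hn (ρ ⟨a, hab⟩))
      simp [overlapMatrix, hab]
    refine (Finset.sum_le_sum fun ρ _ => h ρ).trans (le_of_eq ?_)
    rw [Finset.sum_const, Finset.card_univ, Fintype.card_fun, hcard, nsmul_eq_mul,
      Fintype.card_subtype_compl, Fintype.card_subtype_eq]
    have hpos : 0 < Fintype.card ι := Fintype.card_pos_iff.mpr ⟨a⟩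
    obtain ⟨m, hm⟩ : ∃ m, Fintype.card ι = m + 1 := ⟨Fintype.card ι - 1, by omega⟩
    rw [hm, Nat.add_sub_cancel, pow_succ]
    push_cast
    ring

/-- The factor k² in the denominator makes the exponent an average over the k² ordered pairs, so
that Jensen's inequality reduces the claim to a single pair. -/
theorem sum_exp_offSum_le (hn : 0 < n) :
    ∑ τ : ι → Spin n, Real.exp (n * offSum (overlapMatrix τ) / (4 * Fintype.card ι ^ 2)) ≤
      2 * (2 ^ n) ^ Fintype.card ι := by
  have hcard : Fintype.card (Spin n) = 2 ^ n := by simp [Spin]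
  rcases isEmpty_or_nonempty ι with he | he
  · simp [offSum]
  have hk : (0 : ℝ) < Fintype.card ι := by exact_mod_cast Fintype.card_pos
  set k : ℝ := (Fintype.card ι : ℝ) with hkd
  have hJ : ∀ τ : ι → Spin n, Real.exp (n * offSum (overlapMatrix τ) / (4 * k ^ 2)) ≤
      ∑ p : ι × ι, (1 / k ^ 2) *
        Real.exp (n * (if p.1 = p.2 then 0 else overlapMatrix τ p.1 p.2) / 4) := by
    intro τ
    have := convexOn_exp.map_sum_le (t := (Finset.univ : Finset (ι × ι)))
      (w := fun _ => 1 / k ^ 2)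
      (p := fun p => n * (if p.1 = p.2 then 0 else overlapMatrix τ p.1 p.2) / 4)
      (fun _ _ => by positivity)
      (by
        rw [Finset.sum_const, Finset.card_univ, Fintype.card_prod, nsmul_eq_mul]
        push_cast
        rw [← hkd]
        field_simp) (fun _ _ => Set.mem_univ _)
    simp only [smul_eq_mul] at this
    refine le_trans (le_of_eq ?_) this
    congr 1
    rw [← Finset.mul_sum, ← Finset.sum_div, ← Finset.mul_sum, Fintype.sum_prod_type, offSum]
    field_simp
  refine (Finset.sum_le_sum fun τ _ => hJ τ).trans ?_
  rw [Finset.sum_comm]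
  calc ∑ p : ι × ι, ∑ τ : ι → Spin n, (1 / k ^ 2) *
        Real.exp (n * (if p.1 = p.2 then 0 else overlapMatrix τ p.1 p.2) / 4)
      ≤ ∑ p : ι × ι, (1 / k ^ 2) * (2 * (2 ^ n) ^ Fintype.card ι) := by
        refine Finset.sum_le_sum fun p _ => ?_
        rw [← Finset.mul_sum]
        gcongr
        exact sum_exp_overlapMatrix_entry_le hn p.1 p.2
    _ = 2 * (2 ^ n) ^ Fintype.card ι := by
        rw [Finset.sum_const, Finset.card_univ, Fintype.card_prod, nsmul_eq_mul]
        push_cast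
        rw [← hkd]
        field_simp

end Averages

/-! ### Linearly dependent families and missing sign patterns -/

section Degenerate

open Matrix

variable {n : ℕ} {ι : Type*}

theorem spin_eq_or_eq_neg_of_mul_eq (hn : 0 < n) {σ τ : Spin n}
    (h : ∀ i j, ((σ i : ℤ) : ℝ) * ((σ j : ℤ) : ℝ) = ((τ i : ℤ) : ℝ) * ((τ j : ℤ) : ℝ)) :
    σ = τ ∨ σ = -τ := by
  have hu : ∀ i j, σ i * σ j = τ i * τ j := by
    intro i j
    have := h i j
    ext
    push_cast
    exact_mod_cast this
  set z : Fin n := ⟨0, hn⟩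
  have h2 : ∀ j, σ j = σ z * τ z * τ j := by
    intro j
    have := hu z j
    rw [mul_assoc, ← this, ← mul_assoc, Int.units_mul_self, one_mul]
  rcases Int.units_eq_one_or (σ z * τ z) with h3 | h3
  · left
    funext j
    rw [h2 j, h3, one_mul]
  · right
    funext j
    rw [h2 j, h3]
    simp

/-- If the sites i and j carry the same pattern, the expansion gives σ_iσ_j = σ_iσ_i. Hence σ is a
function of the pattern of the family. -/
theorem eq_of_pattern_eq {S : Finset ι} {τ : ι → Spin n} {σ : Spin n} {c : ι → ℝ}
    (hc : ∀ i j, ((σ i : ℤ) : ℝ) * ((σ j : ℤ) : ℝ) =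
      ∑ a ∈ S, c a * (((τ a i : ℤ) : ℝ) * ((τ a j : ℤ) : ℝ))) {i j : Fin n}
    (hij : ∀ a ∈ S, τ a i = τ a j) : σ i = σ j := by
  have h1 : ((σ i : ℤ) : ℝ) * ((σ j : ℤ) : ℝ) = ((σ i : ℤ) : ℝ) * ((σ i : ℤ) : ℝ) := by
    rw [hc i j, hc i i]
    exact Finset.sum_congr rfl fun a ha => by rw [hij a ha]
  have h2 : ((σ i : ℤ) : ℝ) ≠ 0 := by exact_mod_cast (σ i).ne_zero
  have h3 := mul_left_cancel₀ h2 h1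
  ext
  exact_mod_cast h3.symm

variable [DecidableEq ι]

/-- If every pattern of signs occurs, a tensor square in the span of the tensor squares of the
family is one of them. -/
theorem exists_eq_or_eq_neg_of_forall_pattern (hn : 0 < n) {S : Finset ι} {τ : ι → Spin n}
    {σ : Spin n} {c : ι → ℝ}
    (hc : ∀ i j, ((σ i : ℤ) : ℝ) * ((σ j : ℤ) : ℝ) =
      ∑ a ∈ S, c a * (((τ a i : ℤ) : ℝ) * ((τ a j : ℤ) : ℝ)))
    (hp : ∀ p : ι → ℤˣ, ∃ i, ∀ a ∈ S, τ a i = p a) : ∃ a ∈ S, σ = τ a ∨ σ = -τ a := by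
  have hsum : ∑ a ∈ S, c a = 1 := by
    have := hc ⟨0, hn⟩ ⟨0, hn⟩
    simp only [spin_mul_self, mul_one] at this
    exact this.symm
  -- Compare a site where all members are +1 with one where only the member `a` is -1: the entry
  -- σ_iσ_j = ±1 equals 1 - 2c_a, since the diagonal entries give ∑ c = 1.
  have h01 : ∀ a ∈ S, c a = 0 ∨ c a = 1 := by
    intro a ha
    obtain ⟨i, hi⟩ := hp 1
    obtain ⟨j, hj⟩ := hp (Function.update 1 a (-1))
    have h1 : ∑ b ∈ S, c b * (((τ b i : ℤ) : ℝ) * ((τ b j : ℤ) : ℝ)) = 1 - 2 * c a := by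
      rw [← hsum, ← Finset.add_sum_erase _ _ ha, ← Finset.add_sum_erase _ c ha]
      have h2 : ∑ b ∈ S.erase a, c b * (((τ b i : ℤ) : ℝ) * ((τ b j : ℤ) : ℝ)) =
          ∑ b ∈ S.erase a, c b := by
        refine Finset.sum_congr rfl fun b hb => ?_
        have hbS := Finset.mem_of_mem_erase hb
        rw [hi b hbS, hj b hbS, Function.update_of_ne (Finset.ne_of_mem_erase hb)]
        simp
      rw [h2, hi a ha, hj a ha, Function.update_self]
      simp
      ring
    have h3 := hc i j
    rw [h1] at h3
    rcases Int.units_eq_one_or (σ i) with h4 | h4 <;>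
    rcases Int.units_eq_one_or (σ j) with h5 | h5 <;>
    simp only [h4, h5, Units.val_one, Units.val_neg, Int.cast_one, Int.cast_neg, mul_one, mul_neg,
      neg_neg] at h3
    · left; linarith
    · right; linarith
    · right; linarith
    · left; linarith
  obtain ⟨a, ha, hca⟩ : ∃ a ∈ S, c a = 1 := by
    by_contra! h
    have : ∑ a ∈ S, c a = 0 := Finset.sum_eq_zero fun a ha => (h01 a ha).resolve_right (h a ha)
    rw [this] at hsum
    norm_num at hsum
  have hz : ∀ b ∈ S.erase a, c b = 0 := by
    have h1 : ∑ b ∈ S.erase a, c b = 0 := by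
      have := Finset.add_sum_erase _ c ha
      linarith
    have h2 : ∀ b ∈ S.erase a, 0 ≤ c b := fun b hb => by
      rcases h01 b (Finset.mem_of_mem_erase hb) with h | h <;> rw [h]
      norm_num
    exact (Finset.sum_eq_zero_iff_of_nonneg h2).mp h1
  refine ⟨a, ha, spin_eq_or_eq_neg_of_mul_eq hn fun i j => ?_⟩
  rw [hc i j, ← Finset.add_sum_erase _ _ ha, hca, one_mul, Finset.sum_eq_zero, add_zero]
  intro b hb
  rw [hz b hb, zero_mul]

/-- Families whose members outside `S` are functions of the patterns of the members in `S`,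
where some pattern does not occur. -/
def degenerateFamilies (n : ℕ) (S : Finset ι) : Set (ι → Spin n) :=
  {τ | (∃ p : S → ℤˣ, ∀ i, (fun a : S => τ a i) ≠ p) ∧
    ∃ F : ι → (S → ℤˣ) → ℤˣ, ∀ b ∉ S, ∀ i, τ b i = F b fun a : S => τ a i}

/-- A family is encoded by a missing pattern, the functions for the outer members, and at each site
a pattern different from the missing one. Only the last factor depends on n, and it falls short of
2^{rn}, with r the size of `S`, by (1 - 2^{-r})^n. -/
theorem ncard_degenerateFamilies_le [Fintype ι] (n : ℕ) (S : Finset ι) :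
    (degenerateFamilies n S).ncard ≤
      2 ^ S.card * (2 ^ 2 ^ S.card) ^ Fintype.card ι * (2 ^ S.card - 1) ^ n := by
  classical
  let Φ : (Σ p : S → ℤˣ, (ι → (S → ℤˣ) → ℤˣ) × (Fin n → {q : S → ℤˣ // q ≠ p})) → (ι → Spin n) :=
    fun x b i => if h : b ∈ S then (x.2.2 i).1 ⟨b, h⟩ else x.2.1 b (x.2.2 i).1
  have hsub : degenerateFamilies n S ⊆ Set.range Φ := by
    rintro τ ⟨⟨p, hp⟩, F, hF⟩
    refine ⟨⟨p, F, fun i => ⟨fun a => τ a i, hp i⟩⟩, ?_⟩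
    funext b i
    by_cases h : b ∈ S
    · simp [Φ, h]
    · simp [Φ, h, hF b h i]
  calc (degenerateFamilies n S).ncard ≤ (Set.range Φ).ncard :=
        Set.ncard_le_ncard hsub (Set.toFinite _)
    _ ≤ Nat.card (Σ p : S → ℤˣ, (ι → (S → ℤˣ) → ℤˣ) × (Fin n → {q : S → ℤˣ // q ≠ p})) := by
        rw [← Set.image_univ]
        refine (Set.ncard_image_le (Set.toFinite _)).trans ?_
        rw [Set.ncard_univ]
    _ = _ := by
        rw [Nat.card_eq_fintype_card, Fintype.card_sigma]
        simp [Fintype.card_subtype_compl]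
        ring

variable [Fintype ι]

theorem det_overlapMatrix_ne_zero_of_linearIndependent (hn : 0 < n) (τ : ι → Spin n)
    (h : LinearIndependent ℝ (couplingMatrix τ)) : (overlapMatrix τ).det ≠ 0 := by
  have hn' : (0 : ℝ) < n := by exact_mod_cast hn
  intro h0
  have h1 : (couplingMatrix τ * (couplingMatrix τ)ᵀ).det = 0 := by
    rw [couplingMatrix_mul_transpose, det_smul, h0, mul_zero]
  obtain ⟨c, hc0, hc⟩ := exists_vecMul_eq_zero_iff.mpr h1
  have h2 : c ᵥ* couplingMatrix τ = 0 := by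
    rw [← dotProduct_self_eq_zero]
    have : (c ᵥ* couplingMatrix τ) ⬝ᵥ (c ᵥ* couplingMatrix τ) =
        (c ᵥ* (couplingMatrix τ * (couplingMatrix τ)ᵀ)) ⬝ᵥ c := by
      rw [← vecMul_vecMul, vecMul_transpose, ← dotProduct_mulVec, dotProduct_comm]
    rw [this, hc, zero_dotProduct]
  apply hc0
  have h3 := Fintype.linearIndependent_iff.mp h c (by
    rw [← h2]
    funext p
    simp [vecMul, dotProduct])
  exact funext h3

/-- A maximal linearly independent subfamily is taken. A member outside it lies in its span; if
every pattern occurred, that member would be ± a member of the subfamily, although the classes are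
distinct. -/
theorem exists_independent_subfamily (hn : 0 < n) (τ : ι → Spin n)
    (hτ : Function.Injective fun a => (Quotient.mk (flipSetoid n) (τ a))) :
    ∃ S : Finset ι, (overlapMatrix fun a : S => τ a).det ≠ 0 ∧
      (S = Finset.univ ∨ τ ∈ degenerateFamilies n S) := by
  have hn' : (0 : ℝ) < n := by exact_mod_cast hn
  set w : ι → (Fin n × Fin n → ℝ) := couplingMatrix τ with hw
  obtain ⟨S, -, hS⟩ := Finite.exists_le_maximal (p := fun S : Finset ι => LinearIndepOn ℝ w (S : Set ι))
    (a := ∅) (by simp)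
  refine ⟨S, ?_, ?_⟩
  · refine det_overlapMatrix_ne_zero_of_linearIndependent hn _ ?_
    exact hS.prop
  by_cases hSu : S = Finset.univ
  · exact Or.inl hSu
  right
  have hspan : ∀ b ∉ S, ∃ c : ι → ℝ, ∀ i j, ((τ b i : ℤ) : ℝ) * ((τ b j : ℤ) : ℝ) =
      ∑ a ∈ S, c a * (((τ a i : ℤ) : ℝ) * ((τ a j : ℤ) : ℝ)) := by
    intro b hb
    have hmem : w b ∈ Submodule.span ℝ (w '' S) := by
      refine hS.prop.mem_span_iff.mpr fun h => ?_
      have h2 := hS.le_of_ge (y := insert b S) (by simpa using h) (Finset.subset_insert b S)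
      exact h2 (Finset.mem_insert_self b S)
    obtain ⟨c, hc⟩ := (Submodule.mem_span_image_finset_iff_exists_fun' ℝ).mp hmem
    refine ⟨c, fun i j => ?_⟩
    have h3 := congrFun hc (i, j)
    have hs : (1 / √(n : ℝ)) ≠ 0 := by positivity
    simp only [Finset.sum_apply, Pi.smul_apply, smul_eq_mul, hw, couplingMatrix] at h3
    apply mul_left_cancel₀ hs
    rw [← h3, Finset.mul_sum]
    exact Finset.sum_congr rfl fun a _ => by ring
  constructor
  · obtain ⟨b, hb⟩ : ∃ b, b ∉ S := by
      by_contra! h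
      exact hSu (Finset.eq_univ_iff_forall.mpr h)
    obtain ⟨c, hc⟩ := hspan b hb
    by_contra! hp
    obtain ⟨a, ha, hab⟩ := exists_eq_or_eq_neg_of_forall_pattern hn hc fun p => by
      obtain ⟨i, hi⟩ := hp fun a => p a
      exact ⟨i, fun a ha => congrFun hi ⟨a, ha⟩⟩
    have : a = b := hτ (Quotient.sound hab)
    exact hb (this ▸ ha)
  · have hF : ∀ b, ∃ f : (S → ℤˣ) → ℤˣ, b ∉ S → ∀ i, τ b i = f fun a : S => τ a i := by
      intro b
      by_cases hb : b ∈ S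
      · exact ⟨fun _ => 1, fun h => absurd hb h⟩
      obtain ⟨c, hc⟩ := hspan b hb
      -- The value at patterns that never occur is irrelevant and is set to 1.
      refine ⟨fun p => if h : ∃ i, (fun a : S => τ a i) = p then τ b h.choose else 1,
        fun _ i => ?_⟩
      have hex : ∃ j, (fun a : S => τ a j) = fun a : S => τ a i := ⟨i, rfl⟩
      simp only []
      rw [dif_pos hex]
      refine eq_of_pattern_eq hc fun a ha => ?_
      exact (congrFun hex.choose_spec ⟨a, ha⟩).symm
    choose F hF using hF
    exact ⟨F, hF⟩

end Degenerate

/-! ### The error of one tuple and the sum of the errors -/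

section TupleError

variable {n : ℕ} {ι : Type*} [Fintype ι] [DecidableEq ι]

open scoped Classical in
/-- A bound for the distance between the law of the rescaled energies of the family `τ` and
the uniform law of density `2^{-(n-1)}` on the cube `[0, T]^ι`. -/
def tupleErr (α T : ℝ) (τ : ι → Spin n) : ℝ :=
  if (Fintype.card ι).factorial * offSum (overlapMatrix τ) ≤ 1 / 2 then
    (((2 : ℝ) ^ (n - 1))⁻¹ * T) ^ Fintype.card ι *
      (Real.exp (offSum (overlapMatrix τ) * ((Fintype.card ι).factorial +
        (α + scale n α * T) ^ 2 / n) +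
        Fintype.card ι * ((α + scale n α * T) ^ 2 - α ^ 2) / (2 * n)) - 1)
  else (disorder n).real (rescaledEnergies α τ ⁻¹' window ι T) +
    (((2 : ℝ) ^ (n - 1))⁻¹ * T) ^ Fintype.card ι

theorem det_overlapMatrix_ne_zero_of_offSum_le (hn : 0 < n) (τ : ι → Spin n)
    (hb : (Fintype.card ι).factorial * offSum (overlapMatrix τ) ≤ 1 / 2) :
    (overlapMatrix τ).det ≠ 0 := by
  intro h
  have hde := abs_det_sub_one_le (overlapMatrix_nonneg τ) (overlapMatrix_le_one τ)
    (overlapMatrix_self hn τ)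
  rw [h] at hde
  norm_num at hde
  linarith

theorem norm_integral_sub_le_tupleErr (hn : 0 < n) {α T : ℝ} (hα : 0 ≤ α) (hT : 0 ≤ T)
    (τ : ι → Spin n) {G : (ι → ℝ) → ℂ} (hG : Measurable G) (hG1 : ∀ y, ‖G y‖ ≤ 1) :
    ‖∫ X, (window ι T).indicator G (rescaledEnergies α τ X) ∂(disorder n) -
      ((((2 : ℝ) ^ (n - 1))⁻¹ ^ Fintype.card ι : ℝ) : ℂ) * ∫ y in window ι T, G y‖ ≤
      tupleErr α T τ := by
  unfold tupleErr
  split_ifs with hb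
  · exact norm_integral_sub_le_of_relDensity hn α hT τ
      (det_overlapMatrix_ne_zero_of_offSum_le hn τ hb)
      (fun y hy => abs_relDensity_sub_one_le hn hα (overlapMatrix_nonneg τ)
        (overlapMatrix_le_one τ) (overlapMatrix_self hn τ) hb hy) hG hG1
  -- For strongly correlated tuples no cancellation is available, and both terms are bounded
  -- separately.
  · refine (norm_sub_le _ _).trans (add_le_add ?_ ?_)
    · have hm := measurable_rescaledEnergies α τ
      have hmw := measurableSet_window ι T
      have : (fun X => (window ι T).indicator G (rescaledEnergies α τ X)) =
          (rescaledEnergies α τ ⁻¹' window ι T).indicator fun X => G (rescaledEnergies α τ X) := rfl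
      rw [this, integral_indicator (hm hmw)]
      refine (norm_setIntegral_le_of_norm_le_const (C := 1) (measure_lt_top _ _)
        fun X _ => hG1 _).trans (le_of_eq (one_mul _))
    · rw [norm_mul, Complex.norm_real, Real.norm_of_nonneg (by positivity), mul_pow]
      gcongr
      refine (norm_setIntegral_le_of_norm_le_const (C := 1) (volume_window_lt_top T)
        fun y _ => hG1 y).trans (le_of_eq ?_)
      rw [one_mul, volume_real_window hT]

/-- The constraints on members outside a maximal independent subfamily are forgotten. Either nothing
is lost or the family is degenerate, hence rare. -/
theorem prob_window_le_of_classInjective (hn : 0 < n) (α : ℝ) {T : ℝ} (hT : 0 ≤ T)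
    (τ : ι → Spin n) (hτ : Function.Injective fun a => (Quotient.mk (flipSetoid n) (τ a))) :
    (disorder n).real (rescaledEnergies α τ ⁻¹' window ι T) ≤
      (((2 : ℝ) ^ (n - 1))⁻¹ * T * (n * Real.exp (α ^ 2 / (2 * n)))) ^ Fintype.card ι +
      ∑ S : Finset ι with S ≠ Finset.univ, (degenerateFamilies n S).indicator
        (fun _ => (((2 : ℝ) ^ (n - 1))⁻¹ * T * (n * Real.exp (α ^ 2 / (2 * n)))) ^ S.card) τ := by
  obtain ⟨S, hS, h⟩ := exists_independent_subfamily hn τ hτ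
  set q := ((2 : ℝ) ^ (n - 1))⁻¹ * T * (n * Real.exp (α ^ 2 / (2 * n))) with hq
  have hq0 : 0 ≤ q := by positivity
  have hle : (disorder n).real (rescaledEnergies α τ ⁻¹' window ι T) ≤ q ^ S.card := by
    have h1 := prob_window_le_of_det_ne_zero hn α hT (fun a : S => τ a) hS
    rw [Fintype.card_coe] at h1
    refine le_trans (measureReal_mono ?_) h1
    intro X hX a _
    exact hX a (Set.mem_univ _)
  have hnn : ∀ S : Finset ι, 0 ≤ (degenerateFamilies n S).indicator (fun _ => q ^ S.card) τ :=
    fun S => Set.indicator_nonneg (fun _ _ => by positivity) _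
  by_cases hSu : S = Finset.univ
  · rw [hSu, Finset.card_univ] at hle
    refine hle.trans (le_add_of_nonneg_right (Finset.sum_nonneg fun S _ => hnn S))
  · have hd := h.resolve_left hSu
    refine hle.trans (le_add_of_nonneg_of_le (by positivity) ?_)
    refine le_trans (le_of_eq ?_) (Finset.single_le_sum (f := fun S =>
      (degenerateFamilies n S).indicator (fun _ => q ^ S.card) τ) (fun S _ => hnn S)
      (show S ∈ _ by simpa using hSu))
    simp [hd]

/-- The convex exponential lies below its chord over [0, c₀Y]. This extracts the small factor c/c₀
while keeping a fixed rate c₀ for which the exponential moment is known. -/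
theorem exp_sub_one_le_chord {c c₀ Y : ℝ} (hc : 0 ≤ c) (hc₀ : 0 < c₀) (hcc : c ≤ c₀) :
    Real.exp (c * Y) - 1 ≤ c / c₀ * Real.exp (c₀ * Y) := by
  have h := convexOn_exp.2 (Set.mem_univ (c₀ * Y)) (Set.mem_univ 0)
    (show 0 ≤ c / c₀ by positivity) (show 0 ≤ 1 - c / c₀ by
      rw [sub_nonneg, div_le_one hc₀]; exact hcc) (by ring)
  simp only [smul_eq_mul, mul_zero, add_zero, Real.exp_zero, mul_one] at h
  have h2 : c / c₀ * (c₀ * Y) = c * Y := by field_simp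
  rw [h2] at h
  have : 0 ≤ c / c₀ := by positivity
  linarith

theorem sum_degenerate_le (hn : 0 < n) (α : ℝ) {T : ℝ} (hT : 0 ≤ T) (S : Finset ι) :
    ∑ τ : ι → Spin n, (degenerateFamilies n S).indicator
        (fun _ => (((2 : ℝ) ^ (n - 1))⁻¹ * T * (n * Real.exp (α ^ 2 / (2 * n)))) ^ S.card) τ ≤
      2 ^ Fintype.card ι * (2 ^ 2 ^ Fintype.card ι) ^ Fintype.card ι *
        (((1 + 2 * T) * (n * Real.exp (α ^ 2 / (2 * n)))) ^ Fintype.card ι *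
          (1 - (2 ^ Fintype.card ι)⁻¹) ^ n) := by
  classical
  set A := n * Real.exp (α ^ 2 / (2 * n)) with hA
  have hn' : (1 : ℝ) ≤ n := by exact_mod_cast hn
  have hA1 : 1 ≤ A := by
    have : 1 ≤ Real.exp (α ^ 2 / (2 * n)) := Real.one_le_exp (by positivity)
    nlinarith
  set k := Fintype.card ι with hk
  set r := S.card with hr
  have hrk : r ≤ k := Finset.card_le_univ S
  have hN : ((2 : ℝ) ^ (n - 1))⁻¹ = 2 / 2 ^ n := by
    obtain ⟨m, rfl⟩ : ∃ m, n = m + 1 := ⟨n - 1, by omega⟩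
    rw [Nat.add_sub_cancel, pow_succ]
    field_simp
  have hcard := ncard_degenerateFamilies_le n S
  rw [← hr, ← hk] at hcard
  have hcast : (((2 : ℕ) ^ r - 1 : ℕ) : ℝ) = (2 : ℝ) ^ r - 1 := by
    rw [Nat.cast_sub Nat.one_le_two_pow]; push_cast; ring
  have hcard' : ((degenerateFamilies n S).ncard : ℝ) ≤
      2 ^ k * (2 ^ 2 ^ k) ^ k * ((2 : ℝ) ^ r - 1) ^ n := by
    have h1 : ((degenerateFamilies n S).ncard : ℝ) ≤
        ((2 ^ r * (2 ^ 2 ^ r) ^ k * (2 ^ r - 1) ^ n : ℕ) : ℝ) := by exact_mod_cast hcard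
    refine h1.trans ?_
    rw [Nat.cast_mul, Nat.cast_pow (2 ^ r - 1), hcast]
    push_cast
    have h2 : (1 : ℝ) ≤ 2 ^ r := one_le_pow₀ one_le_two
    have h3 : (0 : ℝ) ≤ 2 ^ r - 1 := sub_nonneg.mpr h2
    gcongr <;> exact one_le_two
  have hsum : ∑ τ : ι → Spin n, (degenerateFamilies n S).indicator
      (fun _ => (((2 : ℝ) ^ (n - 1))⁻¹ * T * A) ^ r) τ =
      (degenerateFamilies n S).ncard * (((2 : ℝ) ^ (n - 1))⁻¹ * T * A) ^ r := by
    rw [Finset.sum_indicator_eq_sum_filter, Finset.sum_const, nsmul_eq_mul,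
      Set.ncard_eq_toFinset_card']
    congr 3
    ext τ
    simp
  rw [hsum]
  calc ((degenerateFamilies n S).ncard : ℝ) * (((2 : ℝ) ^ (n - 1))⁻¹ * T * A) ^ r
      ≤ 2 ^ k * (2 ^ 2 ^ k) ^ k * ((2 : ℝ) ^ r - 1) ^ n *
          (((2 : ℝ) ^ (n - 1))⁻¹ * T * A) ^ r := by gcongr
    _ = 2 ^ k * (2 ^ 2 ^ k) ^ k * ((2 * T * A) ^ r * (1 - (2 ^ r)⁻¹) ^ n) := by
        have h3 : (1 - ((2 : ℝ) ^ r)⁻¹) ^ n = ((2 : ℝ) ^ r - 1) ^ n / (2 ^ n) ^ r := by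
          rw [← pow_mul, mul_comm n r, pow_mul, ← div_pow]
          congr 1
          field_simp
        rw [h3, hN]
        have h4 : 2 / (2 : ℝ) ^ n * T * A = 2 * T * A / 2 ^ n := by ring
        rw [h4, div_pow]
        ring
    _ ≤ 2 ^ k * (2 ^ 2 ^ k) ^ k * (((1 + 2 * T) * A) ^ k * (1 - (2 ^ k)⁻¹) ^ n) := by
        have h5 : (1 : ℝ) ≤ 2 ^ r := one_le_pow₀ one_le_two
        have h6 : 1 - ((2 : ℝ) ^ r)⁻¹ ≤ 1 - (2 ^ k)⁻¹ := by
          gcongr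
          exact one_le_two
        have h7 : 0 ≤ 1 - ((2 : ℝ) ^ r)⁻¹ := sub_nonneg.mpr (inv_le_one_of_one_le₀ h5)
        -- The summand 1 makes the base at least 1, so that the power can be raised from r to k.
        have h8 : (2 * T * A) ^ r ≤ ((1 + 2 * T) * A) ^ k := by
          calc (2 * T * A) ^ r ≤ ((1 + 2 * T) * A) ^ r := by
                gcongr
                linarith
            _ ≤ ((1 + 2 * T) * A) ^ k := by
                refine pow_le_pow_right₀ ?_ hrk
                nlinarith
        gcongr

-- The three terms correspond to nearly orthogonal tuples (chord bound and exponential moment), to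
-- tuples with a large overlap (Markov's inequality for the same exponential moment), and to
-- degenerate tuples.
open scoped Classical in
theorem sum_tupleErr_le (hn : 0 < n) {α T : ℝ} (hα : 0 ≤ α) (hT : 0 ≤ T) {c₀ c s A : ℝ}
    (hk : 0 < Fintype.card ι)
    (hc₀ : c₀ = 1 / (4 * (Fintype.card ι : ℝ) ^ 2))
    (hc : c = ((Fintype.card ι).factorial + (α + scale n α * T) ^ 2 / n) / n)
    (hs : s = Fintype.card ι * ((α + scale n α * T) ^ 2 - α ^ 2) / (2 * n))
    (hA : A = n * Real.exp (α ^ 2 / (2 * n))) (hcc : c ≤ c₀) :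
    ∑ τ : ι → Spin n with Function.Injective fun a => (Quotient.mk (flipSetoid n) (τ a)),
      tupleErr α T τ ≤
      (2 * T) ^ Fintype.card ι * (2 * Real.exp s * (c / c₀) + (Real.exp s - 1)) +
      2 * (2 * T) ^ Fintype.card ι * ((A ^ Fintype.card ι + 1) *
        Real.exp (-(c₀ / (2 * (Fintype.card ι).factorial)) * n)) +
      2 ^ Fintype.card ι * (2 ^ Fintype.card ι * (2 ^ 2 ^ Fintype.card ι) ^ Fintype.card ι *
        (((1 + 2 * T) * A) ^ Fintype.card ι * (1 - (2 ^ Fintype.card ι)⁻¹) ^ n)) := by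
  have hn' : (0 : ℝ) < n := by exact_mod_cast hn
  have hξ := scale_pos hn α
  set k := Fintype.card ι with hkd
  have hk' : (0 : ℝ) < k := by exact_mod_cast hk
  have hc₀0 : 0 < c₀ := by rw [hc₀]; positivity
  have hc0 : 0 ≤ c := by rw [hc]; positivity
  have hs0 : 0 ≤ s := by
    rw [hs]
    have : 0 ≤ scale n α * T := by positivity
    have : α ^ 2 ≤ (α + scale n α * T) ^ 2 := by gcongr; linarith
    have : 0 ≤ (α + scale n α * T) ^ 2 - α ^ 2 := by linarith
    positivity
  have hA0 : 0 ≤ A := by rw [hA]; positivity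
  set p := ((2 : ℝ) ^ (n - 1))⁻¹ * T with hp
  have hp0 : 0 ≤ p := by positivity
  have hpN : p ^ k * (2 ^ n) ^ k = (2 * T) ^ k := by
    rw [← mul_pow]
    congr 1
    obtain ⟨m, rfl⟩ : ∃ m, n = m + 1 := ⟨n - 1, by omega⟩
    rw [hp, Nat.add_sub_cancel, pow_succ]
    field_simp
  set Z : (ι → Spin n) → ℝ := fun τ => Real.exp (c₀ * (n * offSum (overlapMatrix τ))) with hZ
  have hZsum : ∑ τ, Z τ ≤ 2 * (2 ^ n) ^ k := by
    refine le_trans (le_of_eq (Finset.sum_congr rfl fun τ _ => ?_)) (sum_exp_offSum_le (ι := ι) hn)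
    simp only [hZ]
    rw [hc₀]
    congr 1
    ring
  set E := Real.exp (-(c₀ / (2 * k.factorial)) * n) with hE
  set D : (ι → Spin n) → ℝ := fun τ => ∑ S : Finset ι with S ≠ Finset.univ,
    (degenerateFamilies n S).indicator (fun _ => (p * A) ^ S.card) τ with hD
  have hD0 : ∀ τ, 0 ≤ D τ := fun τ => Finset.sum_nonneg fun S _ =>
    Set.indicator_nonneg (fun _ _ => by positivity) _
  have hexps : 0 ≤ Real.exp s - 1 := by linarith [Real.add_one_le_exp s]
  have hpt : ∀ τ : ι → Spin n, Function.Injective (fun a => (Quotient.mk (flipSetoid n) (τ a))) →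
      tupleErr α T τ ≤ p ^ k * (Real.exp s * (c / c₀) * Z τ + (Real.exp s - 1)) +
        p ^ k * (A ^ k + 1) * E * Z τ + D τ := by
    intro τ hτ
    have hZ0 : 0 < Z τ := Real.exp_pos _
    unfold tupleErr
    split_ifs with hb
    · have h1 : offSum (overlapMatrix τ) * (k.factorial + (α + scale n α * T) ^ 2 / n) +
          k * ((α + scale n α * T) ^ 2 - α ^ 2) / (2 * n) =
          c * (n * offSum (overlapMatrix τ)) + s := by
        rw [hc, hs]; field_simp
      rw [h1, Real.exp_add]
      have h2 := exp_sub_one_le_chord (Y := n * offSum (overlapMatrix τ)) hc0 hc₀0 hcc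
      have h3 : Real.exp (c * (n * offSum (overlapMatrix τ))) * Real.exp s - 1 ≤
          Real.exp s * (c / c₀) * Z τ + (Real.exp s - 1) := by
        have := mul_le_mul_of_nonneg_left h2 (Real.exp_pos s).le
        simp only [hZ]
        linarith
      have h4 : 0 ≤ p ^ k * (A ^ k + 1) * E * Z τ := by positivity
      have h5 := mul_le_mul_of_nonneg_left h3 (pow_nonneg hp0 k)
      linarith [hD0 τ]
    · have h1 := prob_window_le_of_classInjective hn α hT τ hτ
      rw [← hA, ← hp, ← hkd] at h1
      -- Markov's inequality in pointwise form: failure of the threshold on `offSum` makes Z at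
      -- least 1/E.
      have h2 : 1 ≤ E * Z τ := by
        rw [hE, hZ, ← Real.exp_add]
        apply Real.one_le_exp
        push Not at hb
        have h3 : 1 / (2 * (k.factorial : ℝ)) ≤ offSum (overlapMatrix τ) := by
          rw [div_le_iff₀ (by positivity)]
          linarith
        have h4 := mul_le_mul_of_nonneg_left h3 (by positivity : 0 ≤ c₀ * n)
        have h5 : c₀ * n * (1 / (2 * (k.factorial : ℝ))) = c₀ / (2 * k.factorial) * n := by ring
        linarith
      have h3 : (p * A) ^ k + p ^ k ≤ p ^ k * (A ^ k + 1) * E * Z τ := by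
        have h6 : (p * A) ^ k + p ^ k = p ^ k * (A ^ k + 1) := by rw [mul_pow]; ring
        rw [h6, mul_assoc _ E]
        exact le_mul_of_one_le_right (by positivity) h2
      have h4 : 0 ≤ p ^ k * (Real.exp s * (c / c₀) * Z τ + (Real.exp s - 1)) := by positivity
      have h7 : (disorder n).real (rescaledEnergies α τ ⁻¹' window ι T) ≤ (p * A) ^ k + D τ := h1
      linarith
  have hnn : ∀ τ : ι → Spin n, 0 ≤ p ^ k * (Real.exp s * (c / c₀) * Z τ + (Real.exp s - 1)) +
        p ^ k * (A ^ k + 1) * E * Z τ + D τ := by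
    intro τ
    have hZ0 : 0 < Z τ := Real.exp_pos _
    have := hD0 τ
    positivity
  have hcardS : Fintype.card (ι → Spin n) = (2 ^ n) ^ k := by simp [Spin, hkd]
  have hDsum : ∑ τ, D τ ≤ 2 ^ k * (2 ^ k * (2 ^ 2 ^ k) ^ k *
        (((1 + 2 * T) * A) ^ k * (1 - (2 ^ k)⁻¹) ^ n)) := by
    simp only [hD]
    rw [Finset.sum_comm]
    set B : ℝ := 2 ^ k * (2 ^ 2 ^ k) ^ k * (((1 + 2 * T) * A) ^ k * (1 - (2 ^ k)⁻¹) ^ n) with hB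
    have hB0 : 0 ≤ B := by
      have : (0 : ℝ) ≤ 1 - (2 ^ k)⁻¹ :=
        sub_nonneg.mpr (inv_le_one_of_one_le₀ (one_le_pow₀ one_le_two))
      positivity
    calc ∑ S : Finset ι with S ≠ Finset.univ, ∑ τ : ι → Spin n,
          (degenerateFamilies n S).indicator (fun _ => (p * A) ^ S.card) τ
        ≤ ∑ S : Finset ι with S ≠ Finset.univ, B := by
          refine Finset.sum_le_sum fun S _ => ?_
          have := sum_degenerate_le hn α hT S
          rw [← hA, ← hp] at this
          exact this
      _ ≤ ∑ S : Finset ι, B := Finset.sum_le_sum_of_subset_of_nonneg (Finset.filter_subset _ _)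
          fun _ _ _ => hB0
      _ = 2 ^ k * B := by
          rw [Finset.sum_const, Finset.card_univ, Fintype.card_finset, nsmul_eq_mul]
          push_cast
          rfl
  calc ∑ τ : ι → Spin n with Function.Injective fun a => (Quotient.mk (flipSetoid n) (τ a)),
        tupleErr α T τ
      ≤ ∑ τ : ι → Spin n with Function.Injective fun a => (Quotient.mk (flipSetoid n) (τ a)),
        (p ^ k * (Real.exp s * (c / c₀) * Z τ + (Real.exp s - 1)) +
        p ^ k * (A ^ k + 1) * E * Z τ + D τ) :=
        Finset.sum_le_sum fun τ hτ => hpt τ (by simpa using hτ)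
    _ ≤ ∑ τ : ι → Spin n, (p ^ k * (Real.exp s * (c / c₀) * Z τ + (Real.exp s - 1)) +
        p ^ k * (A ^ k + 1) * E * Z τ + D τ) :=
        Finset.sum_le_sum_of_subset_of_nonneg (Finset.filter_subset _ _) fun τ _ _ => hnn τ
    _ = p ^ k * (Real.exp s * (c / c₀) * ∑ τ, Z τ + (2 ^ n) ^ k * (Real.exp s - 1)) +
        p ^ k * (A ^ k + 1) * E * ∑ τ, Z τ + ∑ τ, D τ := by
        rw [Finset.sum_add_distrib, Finset.sum_add_distrib, ← Finset.mul_sum, ← Finset.mul_sum,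
          Finset.sum_add_distrib, ← Finset.mul_sum, Finset.sum_const, Finset.card_univ, hcardS,
          nsmul_eq_mul]
        push_cast
        rfl
    _ ≤ p ^ k * (Real.exp s * (c / c₀) * (2 * (2 ^ n) ^ k) + (2 ^ n) ^ k * (Real.exp s - 1)) +
        p ^ k * (A ^ k + 1) * E * (2 * (2 ^ n) ^ k) + 2 ^ k * (2 ^ k * (2 ^ 2 ^ k) ^ k *
        (((1 + 2 * T) * A) ^ k * (1 - (2 ^ k)⁻¹) ^ n)) := by
        gcongr
    _ = _ := by
        rw [← hpN]
        ring

end TupleError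

/-! ### Asymptotics of the total error -/

section Asymptotics

/-- An upper bound for `scale n α` if `|α| ≤ n`. -/
def scaleBound (n : ℕ) : ℝ :=
  √(2 * Real.pi * n) * ((2 : ℝ) ^ (n - 1))⁻¹ * Real.exp (n / 2)

theorem scale_le_scaleBound {n : ℕ} (hn : 0 < n) {α : ℝ} (hα : 0 ≤ α) (hαn : α ≤ n) :
    scale n α ≤ scaleBound n := by
  have hn' : (0 : ℝ) < n := by exact_mod_cast hn
  unfold scale scaleBound
  gcongr ?_ * Real.exp ?_
  rw [div_le_div_iff₀ (by positivity) (by positivity)]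
  nlinarith

theorem tendsto_pow_mul_scaleBound (j : ℕ) :
    Tendsto (fun n : ℕ => (n : ℝ) ^ j * scaleBound n) atTop (𝓝 0) := by
  -- Since e < 4, the factor 2^{-n} beats the largest possible e^{α²/(2n)} = e^{n/2}.
  have hρ : |Real.exp (1 / 2) / 2| < 1 := by
    rw [abs_of_pos (by positivity), div_lt_one (by norm_num)]
    have h1 : Real.exp (1 / 2) ^ 2 < 2 ^ 2 := by
      rw [← Real.exp_nat_mul]
      norm_num
      linarith [Real.exp_one_lt_d9]
    exact lt_of_pow_lt_pow_left₀ 2 (by norm_num) h1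
  have h := (tendsto_pow_const_mul_const_pow_of_abs_lt_one (j + 1) hρ).const_mul (2 * √(2 * Real.pi))
  rw [mul_zero] at h
  refine squeeze_zero' (Eventually.of_forall fun n => by unfold scaleBound; positivity) ?_ h
  filter_upwards [eventually_ge_atTop 1] with n hn
  have hn' : (1 : ℝ) ≤ n := by exact_mod_cast hn
  obtain ⟨m, rfl⟩ : ∃ m, n = m + 1 := ⟨n - 1, by omega⟩
  unfold scaleBound
  have h1 : √(2 * Real.pi * ((m + 1 : ℕ) : ℝ)) ≤ √(2 * Real.pi) * ((m + 1 : ℕ) : ℝ) := by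
    rw [Real.sqrt_mul (by positivity)]
    gcongr
    rw [Real.sqrt_le_left (by positivity)]
    nlinarith
  have h2 : Real.exp (((m + 1 : ℕ) : ℝ) / 2) = Real.exp (1 / 2) ^ (m + 1) := by
    rw [← Real.exp_nat_mul]
    congr 1
    ring
  calc ((m + 1 : ℕ) : ℝ) ^ j * (√(2 * Real.pi * ((m + 1 : ℕ) : ℝ)) *
        ((2 : ℝ) ^ (m + 1 - 1))⁻¹ * Real.exp (((m + 1 : ℕ) : ℝ) / 2))
      ≤ ((m + 1 : ℕ) : ℝ) ^ j * ((√(2 * Real.pi) * ((m + 1 : ℕ) : ℝ)) *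
        ((2 : ℝ) ^ (m + 1 - 1))⁻¹ * Real.exp (((m + 1 : ℕ) : ℝ) / 2)) := by gcongr
    _ = _ := by
        rw [h2, Nat.add_sub_cancel, div_pow, pow_succ (2 : ℝ), pow_succ _ j]
        field_simp

theorem tendsto_scaleBound : Tendsto scaleBound atTop (𝓝 0) := by
  simpa using tendsto_pow_mul_scaleBound 0

/-- The three conditions after ε ≤ 1 make, in this order, the Markov term decay, the degenerate term
decay, and the rate c smaller than c₀ for large n. -/
theorem exists_small_exponent (k : ℕ) (hk : 0 < k) : ∃ ε : ℝ, 0 < ε ∧ ε ≤ 1 ∧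
    k * (ε ^ 2 / 2) < 1 / (4 * (k : ℝ) ^ 2) / (2 * k.factorial) ∧
    Real.exp (k * (ε ^ 2 / 2)) * (1 - (2 ^ k)⁻¹) < 1 ∧
    2 * ε ^ 2 ≤ 1 / (4 * (k : ℝ) ^ 2) / 2 := by
  have hk' : (0 : ℝ) < k := by exact_mod_cast hk
  have h1 : ∀ᶠ ε : ℝ in 𝓝 0, ε < 1 := eventually_lt_nhds (by norm_num)
  have h2 : ∀ᶠ ε : ℝ in 𝓝 0, k * (ε ^ 2 / 2) < 1 / (4 * (k : ℝ) ^ 2) / (2 * k.factorial) := by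
    have hc : ContinuousAt (fun ε : ℝ => k * (ε ^ 2 / 2)) 0 := by fun_prop
    refine hc.eventually_lt continuousAt_const ?_
    simp only [ne_eq, OfNat.ofNat_ne_zero, not_false_eq_true, zero_pow, zero_div, mul_zero]
    positivity
  have h3 : ∀ᶠ ε : ℝ in 𝓝 0, Real.exp (k * (ε ^ 2 / 2)) * (1 - (2 ^ k)⁻¹) < 1 := by
    have hc : ContinuousAt (fun ε : ℝ => Real.exp (k * (ε ^ 2 / 2)) * (1 - (2 ^ k)⁻¹)) 0 := by
      fun_prop
    refine hc.eventually_lt continuousAt_const ?_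
    simp
  have h4 : ∀ᶠ ε : ℝ in 𝓝 0, 2 * ε ^ 2 < 1 / (4 * (k : ℝ) ^ 2) / 2 := by
    have hc : ContinuousAt (fun ε : ℝ => 2 * ε ^ 2) 0 := by fun_prop
    refine hc.eventually_lt continuousAt_const ?_
    simp only [ne_eq, OfNat.ofNat_ne_zero, not_false_eq_true, zero_pow, mul_zero]
    positivity
  have h5 : ∀ᶠ ε : ℝ in 𝓝[>] 0, 0 < ε ∧ ε ≤ 1 ∧
      k * (ε ^ 2 / 2) < 1 / (4 * (k : ℝ) ^ 2) / (2 * k.factorial) ∧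
      Real.exp (k * (ε ^ 2 / 2)) * (1 - (2 ^ k)⁻¹) < 1 ∧
      2 * ε ^ 2 ≤ 1 / (4 * (k : ℝ) ^ 2) / 2 := by
    filter_upwards [self_mem_nhdsWithin, nhdsWithin_le_nhds h1, nhdsWithin_le_nhds h2,
      nhdsWithin_le_nhds h3, nhdsWithin_le_nhds h4] with ε e0 e1 e2 e3 e4
    exact ⟨e0, e1.le, e2, e3, e4.le⟩
  exact h5.exists

open scoped Classical in
/-- The sum of the errors over all families of `k` configurations from distinct classes. -/
def totalErr (n k : ℕ) (α T : ℝ) : ℝ :=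
  ∑ τ : Fin k → Spin n with Function.Injective fun a => (Quotient.mk (flipSetoid n) (τ a)),
    tupleErr α T τ

/-- The admissible ε depends on k. This is harmless: if α = o(n), every ε is eventually admissible,
and the converse direction only uses k = 3. -/
theorem exists_totalErr_le (k : ℕ) : ∃ ε : ℝ, 0 < ε ∧ ∀ α : ℕ → ℝ,
    (∀ᶠ n : ℕ in atTop, 0 ≤ α n ∧ α n ≤ ε * n) → ∀ T : ℝ, 0 ≤ T →
      ∃ (C : ℝ) (e : ℕ → ℝ), 0 ≤ C ∧ Tendsto e atTop (𝓝 0) ∧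
        ∀ᶠ n : ℕ in atTop, totalErr n k (α n) T ≤ C * (α n / n) ^ 2 + e n := by
  classical
  rcases Nat.eq_zero_or_pos k with rfl | hk
  · refine ⟨1, one_pos, fun α _ T _ => ⟨0, fun _ => 0, le_rfl, tendsto_const_nhds,
      Eventually.of_forall fun n => ?_⟩⟩
    simp [totalErr, tupleErr, offSum]
  have hk' : (0 : ℝ) < k := by exact_mod_cast hk
  obtain ⟨ε, hε, hε1, hε2, hε3, hε4⟩ := exists_small_exponent k hk
  refine ⟨ε, hε, fun α hα T hT => ?_⟩
  set c₀ : ℝ := 1 / (4 * (k : ℝ) ^ 2) with hc₀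
  have hc₀0 : 0 < c₀ := by positivity
  set ρ : ℝ := 1 - (2 ^ k)⁻¹ with hρ
  have hρ0 : 0 ≤ ρ := sub_nonneg.mpr (inv_le_one_of_one_le₀ (one_le_pow₀ one_le_two))
  set ζ : ℕ → ℝ := scaleBound with hζ
  have hζ0 : ∀ n, 0 ≤ ζ n := fun n => by rw [hζ]; unfold scaleBound; positivity
  have hζt : Tendsto ζ atTop (𝓝 0) := tendsto_scaleBound
  set s : ℕ → ℝ := fun n => k * (ζ n * T + (ζ n * T) ^ 2) with hs
  have hst : Tendsto s atTop (𝓝 0) := by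
    have h1 : Tendsto (fun n => ζ n * T) atTop (𝓝 0) := by simpa using hζt.mul_const T
    have h2 := (h1.add (h1.pow 2)).const_mul (k : ℝ)
    simpa using h2
  set A : ℕ → ℝ := fun n => n * Real.exp (ε ^ 2 / 2) ^ n with hA
  have hAk : ∀ n, A n ^ k = n ^ k * Real.exp (k * (ε ^ 2 / 2)) ^ n := by
    intro n
    simp only [hA]
    rw [mul_pow, ← pow_mul, mul_comm n k, pow_mul, ← Real.exp_nat_mul]
  set u : ℕ → ℝ := fun n => k.factorial / n + 2 * (ζ n * T) ^ 2 with hu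
  have hut : Tendsto u atTop (𝓝 0) := by
    have h1 : Tendsto (fun n => ζ n * T) atTop (𝓝 0) := by simpa using hζt.mul_const T
    have h2 := (tendsto_const_div_atTop_nhds_zero_nat (k.factorial : ℝ)).add ((h1.pow 2).const_mul 2)
    simpa using h2
  set E : ℝ := Real.exp (-(c₀ / (2 * k.factorial))) with hE
  have hE1 : |E| < 1 := by
    rw [abs_of_pos (Real.exp_pos _), Real.exp_lt_one_iff]
    have : 0 < c₀ / (2 * k.factorial) := by positivity
    linarith
  have hAE : Tendsto (fun n => (A n ^ k + 1) * E ^ n) atTop (𝓝 0) := by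
    have hr : |Real.exp (k * (ε ^ 2 / 2)) * E| < 1 := by
      rw [hE, ← Real.exp_add, abs_of_pos (Real.exp_pos _), Real.exp_lt_one_iff]
      linarith
    have h1 := (tendsto_pow_const_mul_const_pow_of_abs_lt_one k hr).add
      (tendsto_pow_atTop_nhds_zero_of_abs_lt_one hE1)
    rw [add_zero] at h1
    refine h1.congr fun n => ?_
    rw [hAk, mul_pow _ E]
    ring
  have hAρ : Tendsto (fun n => ((1 + 2 * T) * A n) ^ k * ρ ^ n) atTop (𝓝 0) := by
    have hr : |Real.exp (k * (ε ^ 2 / 2)) * ρ| < 1 := by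
      rw [abs_of_nonneg (by positivity)]
      exact hε3
    have h1 := (tendsto_pow_const_mul_const_pow_of_abs_lt_one k hr).const_mul ((1 + 2 * T) ^ k)
    rw [mul_zero] at h1
    refine h1.congr fun n => ?_
    rw [mul_pow (1 + 2 * T), hAk, mul_pow _ ρ]
    ring
  have hest : Tendsto (fun n => Real.exp (s n) - 1) atTop (𝓝 0) := by
    have := (Real.continuous_exp.tendsto 0).comp hst
    simpa using this.sub_const 1
  set K : ℝ := 2 ^ k * (2 ^ k * (2 ^ 2 ^ k) ^ k) with hK
  -- The 8 is 2·2·2: the constant of the exponential moment, the bound e^s ≤ 2, and (a + b)² ≤ 2a² +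
  -- 2b².
  refine ⟨(2 * T) ^ k * (8 / c₀), fun n => (2 * T) ^ k * (4 / c₀ * u n + (Real.exp (s n) - 1)) +
    2 * (2 * T) ^ k * ((A n ^ k + 1) * E ^ n) + K * (((1 + 2 * T) * A n) ^ k * ρ ^ n),
    by positivity, ?_, ?_⟩
  · have h1 := ((((hut.const_mul (4 / c₀)).add hest).const_mul ((2 * T) ^ k)).add
      (hAE.const_mul (2 * (2 * T) ^ k))).add (hAρ.const_mul K)
    simpa using h1
  · have hus : ∀ᶠ n in atTop, u n < c₀ / 2 := hut.eventually_lt_const (by positivity)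
    have hss : ∀ᶠ n in atTop, s n < Real.log 2 :=
      hst.eventually_lt_const (Real.log_pos one_lt_two)
    filter_upwards [hα, hus, hss, eventually_ge_atTop 1] with n hαn hun hsn hn
    obtain ⟨hα0, hα1⟩ := hαn
    have hn' : (1 : ℝ) ≤ n := by exact_mod_cast hn
    have hαn1 : α n ≤ n := hα1.trans (by nlinarith)
    have hξ := scale_pos (n := n) hn (α n)
    have hξζ := scale_le_scaleBound (n := n) hn hα0 hαn1
    have hξT : scale n (α n) * T ≤ ζ n * T := mul_le_mul_of_nonneg_right hξζ hT
    have hξT0 : 0 ≤ scale n (α n) * T := by positivity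
    set x := scale n (α n) * T with hx
    have hc : (k.factorial + (α n + x) ^ 2 / n) / n ≤ 2 * (α n / n) ^ 2 + u n := by
      have h1 : (k.factorial + (α n + x) ^ 2 / n) / n = k.factorial / n + (α n / n + x / n) ^ 2 := by
        field_simp
      have h2 : x / n ≤ ζ n * T := (div_le_self hξT0 hn').trans hξT
      have h3 : 0 ≤ x / n := by positivity
      have h4 : (x / n) ^ 2 ≤ (ζ n * T) ^ 2 := by gcongr
      rw [h1, hu]
      simp only []
      nlinarith [sq_nonneg (α n / n - x / n)]
    have hαr : (α n / n) ^ 2 ≤ ε ^ 2 := by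
      have : α n / n ≤ ε := by rw [div_le_iff₀ (by linarith)]; exact hα1
      gcongr
    have hcc : (k.factorial + (α n + x) ^ 2 / n) / n ≤ c₀ := by linarith
    have hse : k * ((α n + x) ^ 2 - α n ^ 2) / (2 * n) ≤ s n := by
      have h1 : k * ((α n + x) ^ 2 - α n ^ 2) / (2 * n) =
          k * (α n / n * x + x ^ 2 / (2 * n)) := by
        field_simp
        ring
      rw [h1, hs]
      simp only []
      have h2 : α n / n ≤ 1 := by rw [div_le_one (by linarith)]; exact hαn1
      have h3 : x ^ 2 / (2 * n) ≤ (ζ n * T) ^ 2 := by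
        refine (div_le_self (by positivity) (by linarith)).trans ?_
        gcongr
      have h4 : α n / n * x ≤ ζ n * T := by
        calc α n / n * x ≤ 1 * x := by gcongr
          _ ≤ ζ n * T := by rw [one_mul]; exact hξT
      gcongr
    have hAe : n * Real.exp (α n ^ 2 / (2 * n)) ≤ A n := by
      simp only [hA]
      rw [← Real.exp_nat_mul]
      gcongr
      rw [div_le_iff₀ (by positivity)]
      have : α n ^ 2 ≤ (ε * n) ^ 2 := by gcongr
      nlinarith
    have hmain := sum_tupleErr_le (ι := Fin k) (n := n) hn hα0 hT (c₀ := c₀)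
      (by simpa using hk) (by simp [hc₀]) rfl rfl rfl (by simpa [hx] using hcc)
    simp only [Fintype.card_fin] at hmain
    refine hmain.trans ?_
    rw [← hx, mul_comm (-(c₀ / (2 * (k.factorial : ℝ)))) (n : ℝ), Real.exp_nat_mul, ← hE, ← hρ]
    set s' := k * ((α n + x) ^ 2 - α n ^ 2) / (2 * n) with hs'
    set c' := (k.factorial + (α n + x) ^ 2 / n) / n with hc'
    set A' := n * Real.exp (α n ^ 2 / (2 * n)) with hA'
    have hc'0 : 0 ≤ c' := by positivity
    have he2 : Real.exp s' ≤ 2 := by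
      rw [← Real.exp_log two_pos]
      exact Real.exp_le_exp.mpr (hse.trans hsn.le)
    have hA'0 : 0 ≤ A' := by positivity
    have hE0 : 0 < E := Real.exp_pos _
    have t1 : 2 * Real.exp s' * (c' / c₀) + (Real.exp s' - 1) ≤
        8 / c₀ * (α n / n) ^ 2 + (4 / c₀ * u n + (Real.exp (s n) - 1)) := by
      have h1 : 2 * Real.exp s' * (c' / c₀) ≤ 2 * 2 * ((2 * (α n / n) ^ 2 + u n) / c₀) := by
        gcongr
      have h2 : Real.exp s' ≤ Real.exp (s n) := Real.exp_le_exp.mpr hse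
      have h3 : 2 * 2 * ((2 * (α n / n) ^ 2 + u n) / c₀) =
          8 / c₀ * (α n / n) ^ 2 + 4 / c₀ * u n := by ring
      linarith
    have t2 : (A' ^ k + 1) * E ^ n ≤ (A n ^ k + 1) * E ^ n := by gcongr
    have t3 : ((1 + 2 * T) * A') ^ k * ρ ^ n ≤ ((1 + 2 * T) * A n) ^ k * ρ ^ n := by gcongr
    have u1 := mul_le_mul_of_nonneg_left t1 (by positivity : 0 ≤ (2 * T) ^ k)
    have u2 := mul_le_mul_of_nonneg_left t2 (by positivity : 0 ≤ 2 * (2 * T) ^ k)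
    have u3 := mul_le_mul_of_nonneg_left t3 (by positivity : 0 ≤ K)
    have h5 : (2 : ℝ) ^ k * (2 ^ k * (2 ^ 2 ^ k) ^ k * (((1 + 2 * T) * A') ^ k * ρ ^ n)) =
        K * (((1 + 2 * T) * A') ^ k * ρ ^ n) := by rw [hK]; ring
    rw [h5]
    linarith

end Asymptotics

/-! ### Truncated Möbius expansion of functions on finite sets -/

section Moebius

variable {V : Type*}

open scoped Classical in
/-- Finite differences of a function on finite sets. -/
def finDiff (g : Finset V → ℂ) (η : Finset V) : ℂ :=
  ∑ ζ ∈ η.powerset, (-1) ^ (η \ ζ).card * g ζ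

open scoped Classical in
theorem finDiff_insert (g : Finset V → ℂ) {a : V} {η : Finset V} (ha : a ∉ η) :
    finDiff g (insert a η) = finDiff (fun ζ => g (insert a ζ)) η - finDiff g η := by
  unfold finDiff
  rw [Finset.sum_powerset_insert ha, add_comm, sub_eq_add_neg, ← Finset.sum_neg_distrib]
  congr 1
  · refine Finset.sum_congr rfl fun ζ hζ => ?_
    have : insert a η \ insert a ζ = η \ ζ := by
      ext b
      simp only [Finset.mem_sdiff, Finset.mem_insert]
      constructor
      · rintro ⟨h1, h2⟩
        push Not at h2
        exact ⟨h1.resolve_left h2.1, h2.2⟩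
      · rintro ⟨h1, h2⟩
        refine ⟨Or.inr h1, ?_⟩
        rintro (rfl | h3)
        · exact ha h1
        · exact h2 h3
    rw [this]
  · refine Finset.sum_congr rfl fun ζ hζ => ?_
    have haζ : a ∉ ζ := fun h => ha (Finset.mem_powerset.mp hζ h)
    rw [Finset.insert_sdiff_of_notMem _ haζ,
      Finset.card_insert_of_notMem fun h => ha (Finset.mem_sdiff.mp h).1, pow_succ]
    ring

theorem sum_finDiff (g : Finset V → ℂ) (A : Finset V) : ∑ η ∈ A.powerset, finDiff g η = g A := by
  classical
  induction A using Finset.induction_on generalizing g with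
  | empty => simp [finDiff]
  | insert a B ha ih =>
    rw [Finset.sum_powerset_insert ha]
    have : ∀ η ∈ B.powerset, finDiff g (insert a η) =
        finDiff (fun ζ => g (insert a ζ)) η - finDiff g η := fun η hη =>
      finDiff_insert g fun h => ha (Finset.mem_powerset.mp hη h)
    rw [Finset.sum_congr rfl this, Finset.sum_sub_distrib, ih, ih]
    ring

theorem norm_finDiff_le {g : Finset V → ℂ} (hg : ∀ ζ, ‖g ζ‖ ≤ 1) (η : Finset V) :
    ‖finDiff g η‖ ≤ 2 ^ η.card := by
  unfold finDiff
  refine (norm_sum_le _ _).trans ?_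
  have h : ∑ ζ ∈ η.powerset, (1 : ℝ) = 2 ^ η.card := by simp
  rw [← h]
  refine Finset.sum_le_sum fun ζ _ => ?_
  rw [norm_mul, norm_pow, norm_neg, norm_one, one_pow, one_mul]
  exact hg ζ

/-- A Bonferroni-type estimate. For |A| < K the expansion is exact. Otherwise each term is bounded
trivially, and C(m,k) ≤ C(m,K)·C(K,k) together with ∑_{k<K} 2^k C(K,k) = 3^K - 2^K expresses
everything through C(|A|,K), whose mean is a factorial moment. -/
theorem norm_sub_sum_finDiff_le {g : Finset V → ℂ} (hg : ∀ ζ, ‖g ζ‖ ≤ 1) (A : Finset V) (K : ℕ) :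
    ‖g A - ∑ η ∈ A.powerset with η.card < K, finDiff g η‖ ≤ 3 ^ K * (A.card.choose K : ℝ) := by
  by_cases hA : A.card < K
  · have : A.powerset.filter (fun η => η.card < K) = A.powerset :=
      Finset.filter_true_of_mem fun η hη =>
        (Finset.card_le_card (Finset.mem_powerset.mp hη)).trans_lt hA
    rw [this, sum_finDiff, sub_self, norm_zero]
    positivity
  push Not at hA
  have hch : ∀ k < K, A.card.choose k ≤ A.card.choose K * K.choose k := by
    intro k hk
    rw [Nat.choose_mul hk.le]
    exact Nat.le_mul_of_pos_right _ (Nat.choose_pos (by omega))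
  have hsum : ‖∑ η ∈ A.powerset with η.card < K, finDiff g η‖ ≤
      (A.card.choose K : ℝ) * (3 ^ K - 2 ^ K) := by
    calc ‖∑ η ∈ A.powerset with η.card < K, finDiff g η‖
        ≤ ∑ η ∈ A.powerset with η.card < K, (2 : ℝ) ^ η.card :=
          (norm_sum_le _ _).trans (Finset.sum_le_sum fun η _ => norm_finDiff_le hg η)
      _ = ∑ η ∈ A.powerset, if η.card < K then (2 : ℝ) ^ η.card else 0 := by
          rw [Finset.sum_filter]
      _ = ∑ k ∈ Finset.range (A.card + 1), A.card.choose k •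
            (if k < K then (2 : ℝ) ^ k else 0) :=
          Finset.sum_powerset_apply_card fun k => if k < K then (2 : ℝ) ^ k else 0
      _ = ∑ k ∈ Finset.range K, (A.card.choose k : ℝ) * 2 ^ k := by
          have hsub : Finset.range K ⊆ Finset.range (A.card + 1) :=
            Finset.range_subset_range.mpr (by omega)
          rw [← Finset.sum_subset hsub]
          · refine Finset.sum_congr rfl fun k hk => ?_
            rw [if_pos (Finset.mem_range.mp hk), nsmul_eq_mul]
          · intro k _ hk
            rw [if_neg (by simpa using hk), smul_zero]
      _ ≤ ∑ k ∈ Finset.range K, (A.card.choose K : ℝ) * (2 ^ k * K.choose k) := by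
          refine Finset.sum_le_sum fun k hk => ?_
          have : (A.card.choose k : ℝ) ≤ A.card.choose K * K.choose k := by
            exact_mod_cast hch k (Finset.mem_range.mp hk)
          nlinarith [pow_pos (two_pos : (0 : ℝ) < 2) k]
      _ = (A.card.choose K : ℝ) * (3 ^ K - 2 ^ K) := by
          rw [← Finset.mul_sum]
          congr 1
          have h := add_pow (2 : ℝ) 1 K
          rw [Finset.sum_range_succ] at h
          simp only [one_pow, mul_one, Nat.choose_self, Nat.cast_one] at h
          norm_num at h
          linarith
  have h1 : (1 : ℝ) ≤ A.card.choose K := by exact_mod_cast Nat.choose_pos hA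
  have h2 : (1 : ℝ) ≤ 2 ^ K := one_le_pow₀ one_le_two
  calc ‖g A - ∑ η ∈ A.powerset with η.card < K, finDiff g η‖
      ≤ ‖g A‖ + ‖∑ η ∈ A.powerset with η.card < K, finDiff g η‖ := norm_sub_le _ _
    _ ≤ 1 + (A.card.choose K : ℝ) * (3 ^ K - 2 ^ K) := add_le_add (hg A) hsum
    _ ≤ 3 ^ K * (A.card.choose K : ℝ) := by nlinarith

end Moebius

/-! ### From k-point laws to the whole configuration in the window -/

section Comparison

variable {V : Type*}

open scoped Classical in
/-- Move all points with index outside of `A` to `-1`. -/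
def res (A : Finset V) (x : V → ℝ) : V → ℝ := fun v => if v ∈ A then x v else -1

/-- Configurations with the points of index in `η` in `[0, T]`. -/
def cyl (η : Finset V) (T : ℝ) : Set (V → ℝ) := {x | ∀ v ∈ η, x v ∈ Set.Icc 0 T}

theorem measurableSet_cyl (η : Finset V) (T : ℝ) : MeasurableSet (cyl η T) := by
  have : cyl η T = ⋂ v ∈ η, (fun x : V → ℝ => x v) ⁻¹' Set.Icc 0 T := by
    ext x
    simp [cyl]
  rw [this]
  exact Finset.measurableSet_biInter _ fun v _ => measurable_pi_apply v measurableSet_Icc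

theorem measurable_res (A : Finset V) : Measurable (res A : (V → ℝ) → V → ℝ) := by
  refine measurable_pi_lambda _ fun v => ?_
  unfold res
  split_ifs
  · exact measurable_pi_apply v
  · exact measurable_const

theorem res_res (A : Finset V) {B : Finset V} (h : A ⊆ B) (x : V → ℝ) :
    res A (res B x) = res A x := by
  funext v
  unfold res
  split_ifs with h1 h2
  · rfl
  · exact absurd (h h1) h2
  · rfl

/-- `d η` bounds the distance between the laws, on `[0, T]^η`, of the points of index in `η`. -/
def CylClose (μ ν : Measure (V → ℝ)) (T : ℝ) (η : Finset V) (d : ℝ) : Prop :=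
  ∀ G : (V → ℝ) → ℂ, Measurable G → (∀ x, ‖G x‖ ≤ 1) → (∀ x, G (res η x) = G x) →
    ‖∫ x, (cyl η T).indicator G x ∂μ - ∫ x, (cyl η T).indicator G x ∂ν‖ ≤ d

theorem CylClose.abs_measureReal_sub_le {μ ν : Measure (V → ℝ)} [IsFiniteMeasure μ]
    [IsFiniteMeasure ν] {T : ℝ} {η : Finset V} {d : ℝ} (h : CylClose μ ν T η d) :
    |μ.real (cyl η T) - ν.real (cyl η T)| ≤ d := by
  have h1 := h (fun _ => 1) measurable_const (by simp) (by simp)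
  rw [integral_indicator (measurableSet_cyl η T), integral_indicator (measurableSet_cyl η T)] at h1
  simp only [integral_const, measureReal_restrict_apply_univ, Complex.real_smul, mul_one] at h1
  rwa [← Complex.ofReal_sub, Complex.norm_real, Real.norm_eq_abs] at h1

variable [Fintype V]

open scoped Classical in
/-- The indices of the points in `[0, T]`. -/
def occ (T : ℝ) (x : V → ℝ) : Finset V := {v | x v ∈ Set.Icc 0 T}

/-- Move all points outside of `[0, T]` to `-1`. -/
def clip (T : ℝ) (x : V → ℝ) : V → ℝ := res (occ T x) x

theorem mem_cyl_iff {η : Finset V} {T : ℝ} {x : V → ℝ} : x ∈ cyl η T ↔ η ⊆ occ T x := by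
  simp [cyl, occ, Finset.subset_iff]

theorem measurable_clip (T : ℝ) : Measurable (clip T : (V → ℝ) → V → ℝ) := by
  classical
  refine measurable_pi_lambda _ fun v => ?_
  have : (fun x : V → ℝ => clip T x v) = fun x => if x v ∈ Set.Icc 0 T then x v else -1 := by
    funext x
    simp [clip, res, occ]
  rw [this]
  exact Measurable.ite (measurable_pi_apply v measurableSet_Icc) (measurable_pi_apply v)
    measurable_const

theorem sum_indicator_cyl (K : ℕ) (T : ℝ) (x : V → ℝ) :
    ∑ η ∈ Finset.powersetCard K Finset.univ, (cyl η T).indicator (fun _ => (1 : ℝ)) x =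
      ((occ T x).card.choose K : ℝ) := by
  classical
  rw [← Finset.card_powersetCard]
  simp only [Set.indicator_apply, mem_cyl_iff]
  rw [Finset.sum_ite, Finset.sum_const_zero, add_zero, Finset.sum_const, nsmul_eq_mul, mul_one]
  congr 2
  ext η
  simp [Finset.mem_powersetCard, and_comm]

variable {F : (V → ℝ) → ℂ}

/-- The Möbius expansion is applied to ζ ↦ F(res ζ x) on the random set of indices of points in
[0,T]. A set η contributes exactly when all of its points are in [0,T], so only k-point laws enter.
-/
theorem norm_integral_clip_sub_le (μ : Measure (V → ℝ)) [IsProbabilityMeasure μ] (T : ℝ) (K : ℕ)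
    (hF : Measurable F) (hF1 : ∀ x, ‖F x‖ ≤ 1) :
    ‖∫ x, F (clip T x) ∂μ - ∑ η : Finset V with η.card < K,
      ∫ x, (cyl η T).indicator (fun x => finDiff (fun ζ => F (res ζ x)) η) x ∂μ‖ ≤
      3 ^ K * ∑ η ∈ Finset.powersetCard K Finset.univ, μ.real (cyl η T) := by
  classical
  have hmD : ∀ η : Finset V, Measurable fun x => finDiff (fun ζ => F (res ζ x)) η := fun η =>
    Finset.measurable_sum _ fun ζ _ => (hF.comp (measurable_res ζ)).const_mul _
  have hbD : ∀ (η : Finset V) x, ‖finDiff (fun ζ => F (res ζ x)) η‖ ≤ 2 ^ η.card := fun η x =>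
    norm_finDiff_le (fun ζ => hF1 _) η
  have hiD : ∀ η : Finset V, Integrable
      ((cyl η T).indicator fun x => finDiff (fun ζ => F (res ζ x)) η) μ := fun η =>
    (Integrable.of_bound (hmD η).aestronglyMeasurable (2 ^ η.card)
      (Eventually.of_forall (hbD η))).indicator (measurableSet_cyl η T)
  have hiF : Integrable (fun x => F (clip T x)) μ :=
    Integrable.of_bound (hF.comp (measurable_clip T)).aestronglyMeasurable 1
      (Eventually.of_forall fun x => hF1 _)
  have hi1 : ∀ η : Finset V, Integrable ((cyl η T).indicator fun _ => (1 : ℝ)) μ := fun η =>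
    (integrable_const _).indicator (measurableSet_cyl η T)
  rw [← integral_finsetSum _ fun η _ => hiD η, ← integral_sub hiF (integrable_finsetSum _
    fun η _ => hiD η)]
  have hr : 3 ^ K * ∑ η ∈ Finset.powersetCard K Finset.univ, μ.real (cyl η T) =
      ∫ x, 3 ^ K * ((occ T x).card.choose K : ℝ) ∂μ := by
    simp_rw [← sum_indicator_cyl]
    rw [integral_const_mul, integral_finsetSum _ fun η _ => hi1 η]
    congr 1
    refine Finset.sum_congr rfl fun η _ => ?_
    rw [integral_indicator (measurableSet_cyl η T)]
    simp
  rw [hr]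
  refine norm_integral_le_of_norm_le ?_ (Eventually.of_forall fun x => ?_)
  · simp_rw [← sum_indicator_cyl]
    exact (integrable_finsetSum _ fun η _ => hi1 η).const_mul _
  · have h := norm_sub_sum_finDiff_le (g := fun ζ => F (res ζ x)) (fun ζ => hF1 _) (occ T x) K
    refine le_trans (le_of_eq ?_) h
    congr 2
    simp only [Set.indicator_apply, mem_cyl_iff]
    rw [← Finset.sum_filter, Finset.filter_filter]
    refine Finset.sum_congr ?_ fun _ _ => rfl
    ext η
    simp [and_comm]

theorem norm_integral_clip_sub_integral_clip_le (μ ν : Measure (V → ℝ)) [IsProbabilityMeasure μ]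
    [IsProbabilityMeasure ν] {T : ℝ} {d : Finset V → ℝ} (hd : ∀ η, CylClose μ ν T η (d η)) (K : ℕ)
    (hF : Measurable F) (hF1 : ∀ x, ‖F x‖ ≤ 1) :
    ‖∫ x, F (clip T x) ∂μ - ∫ x, F (clip T x) ∂ν‖ ≤
      (∑ k ∈ Finset.range K, 2 ^ k * ∑ η ∈ Finset.powersetCard k Finset.univ, d η) +
      3 ^ K * ((∑ η ∈ Finset.powersetCard K Finset.univ, d η) +
        2 * ∑ η ∈ Finset.powersetCard K Finset.univ, ν.real (cyl η T)) := by
  classical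
  have h1 := norm_integral_clip_sub_le μ T K hF hF1
  have h2 := norm_integral_clip_sub_le ν T K hF hF1
  set I : Measure (V → ℝ) → Finset V → ℂ := fun μ η =>
    ∫ x, (cyl η T).indicator (fun x => finDiff (fun ζ => F (res ζ x)) η) x ∂μ with hI
  have h3 : ∀ η, ‖I μ η - I ν η‖ ≤ 2 ^ η.card * d η := by
    intro η
    -- The finite difference is bounded by 2^|η| and involves only coordinates in η, so after
    -- normalisation it is admissible in `CylClose`.
    set G : (V → ℝ) → ℂ := fun x => (2 ^ η.card : ℂ)⁻¹ * finDiff (fun ζ => F (res ζ x)) η with hG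
    have hGm : Measurable G := (Finset.measurable_sum _ fun ζ _ =>
      (hF.comp (measurable_res ζ)).const_mul _).const_mul _
    have h2pow : (0 : ℝ) < 2 ^ η.card := by positivity
    have hGb : ∀ x, ‖G x‖ ≤ 1 := by
      intro x
      simp only [hG]
      rw [norm_mul, norm_inv, norm_pow, Complex.norm_ofNat, inv_mul_le_iff₀ h2pow, mul_one]
      exact norm_finDiff_le (fun ζ => hF1 _) η
    have hGr : ∀ x, G (res η x) = G x := by
      intro x
      simp only [hG, finDiff]
      congr 1
      refine Finset.sum_congr rfl fun ζ hζ => ?_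
      rw [res_res ζ (Finset.mem_powerset.mp hζ)]
    have h := hd η G hGm hGb hGr
    have hIG : ∀ μ : Measure (V → ℝ), I μ η = 2 ^ η.card * ∫ x, (cyl η T).indicator G x ∂μ := by
      intro μ
      simp only [hI]
      rw [← integral_const_mul]
      congr 1
      funext x
      by_cases hx : x ∈ cyl η T
      · simp [hx, hG]
      · simp [hx]
    rw [hIG, hIG, ← mul_sub, norm_mul, norm_pow, Complex.norm_ofNat]
    gcongr
  have hfib : ∑ η : Finset V with η.card < K, (2 : ℝ) ^ η.card * d η =
      ∑ k ∈ Finset.range K, 2 ^ k * ∑ η ∈ Finset.powersetCard k Finset.univ, d η := by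
    rw [← Finset.sum_fiberwise_of_maps_to (g := Finset.card) (t := Finset.range K)
      (fun η hη => by simpa using hη)]
    refine Finset.sum_congr rfl fun k hk => ?_
    rw [Finset.mul_sum, Finset.filter_filter]
    refine Finset.sum_congr ?_ fun η hη => ?_
    · ext η
      simp only [Finset.mem_filter, Finset.mem_univ, true_and, Finset.mem_powersetCard,
        Finset.subset_univ]
      constructor
      · exact fun h => h.2
      · exact fun h => ⟨h ▸ Finset.mem_range.mp hk, h⟩
    · rw [(Finset.mem_powersetCard.mp hη).2]
  -- The remainder under μ is also controlled by ν, so a bound on the factorial moments of the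
  -- reference law suffices.
  have hK : ∑ η ∈ Finset.powersetCard K Finset.univ, μ.real (cyl η T) ≤
      (∑ η ∈ Finset.powersetCard K Finset.univ, d η) +
        ∑ η ∈ Finset.powersetCard K Finset.univ, ν.real (cyl η T) := by
    rw [← Finset.sum_add_distrib]
    refine Finset.sum_le_sum fun η _ => ?_
    have := (abs_le.mp (hd η).abs_measureReal_sub_le).2
    linarith
  have hsum : ‖∑ η : Finset V with η.card < K, I μ η - ∑ η : Finset V with η.card < K, I ν η‖ ≤
      ∑ η : Finset V with η.card < K, 2 ^ η.card * d η := by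
    rw [← Finset.sum_sub_distrib]
    exact (norm_sum_le _ _).trans (Finset.sum_le_sum fun η _ => h3 η)
  rw [hfib] at hsum
  set a := ∫ x, F (clip T x) ∂μ
  set b := ∫ x, F (clip T x) ∂ν
  set a' := ∑ η : Finset V with η.card < K, I μ η
  set b' := ∑ η : Finset V with η.card < K, I ν η
  have h4 : ‖a - b‖ ≤ ‖a - a'‖ + ‖a' - b'‖ + ‖b - b'‖ := by
    have : a - b = (a - a') + (a' - b') - (b - b') := by ring
    rw [this]
    exact (norm_sub_le _ _).trans (add_le_add (norm_add_le _ _) le_rfl)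
  have h5 := mul_le_mul_of_nonneg_left hK (by positivity : (0 : ℝ) ≤ 3 ^ K)
  linarith

end Comparison

/-! ### The reference law of independent points -/

section Reference

/-- The law of a point: uniform with density `p` on `[0, T]`, and otherwise at `-1`. -/
def refPoint (p T : ℝ) : Measure ℝ :=
  ENNReal.ofReal p • volume.restrict (Set.Icc 0 T) + ENNReal.ofReal (1 - p * T) • Measure.dirac (-1)

/-- Independent points with law `refPoint p T`. -/
def refMeasure (V : Type*) [Fintype V] (p T : ℝ) : Measure (V → ℝ) :=
  Measure.pi fun _ => refPoint p T

variable {p T : ℝ}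

theorem isProbabilityMeasure_refPoint (hp : 0 ≤ p) (hT : 0 ≤ T) (hpT : p * T ≤ 1) :
    IsProbabilityMeasure (refPoint p T) := by
  constructor
  simp only [refPoint, Measure.add_apply, Measure.smul_apply, Measure.restrict_apply_univ,
    Real.volume_Icc, sub_zero, smul_eq_mul, measure_univ, mul_one]
  rw [← ENNReal.ofReal_mul hp, ← ENNReal.ofReal_add (by positivity) (by linarith)]
  simp

theorem refPoint_restrict_Icc :
    (refPoint p T).restrict (Set.Icc 0 T) = ENNReal.ofReal p • volume.restrict (Set.Icc 0 T) := by
  rw [refPoint, Measure.restrict_add, Measure.restrict_smul, Measure.restrict_smul,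
    Measure.restrict_restrict measurableSet_Icc, Set.inter_self,
    restrict_dirac' measurableSet_Icc, if_neg (by norm_num), smul_zero, add_zero]

theorem pi_refPoint_restrict_window (ι : Type*) [Fintype ι] (hp : 0 ≤ p) (hT : 0 ≤ T)
    (hpT : p * T ≤ 1) :
    (Measure.pi fun _ : ι => refPoint p T).restrict (window ι T) =
      ENNReal.ofReal p ^ Fintype.card ι • volume.restrict (window ι T) := by
  have := isProbabilityMeasure_refPoint hp hT hpT
  rw [window, Measure.restrict_pi_pi, volume_pi, Measure.restrict_pi_pi]
  refine Measure.pi_eq fun s hs => ?_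
  simp only [refPoint_restrict_Icc, Measure.smul_apply, Measure.pi_pi, smul_eq_mul]
  rw [Finset.prod_mul_distrib, Finset.prod_const, Finset.card_univ]

variable {V : Type*} [Fintype V]

theorem isProbabilityMeasure_refMeasure (hp : 0 ≤ p) (hT : 0 ≤ T) (hpT : p * T ≤ 1) :
    IsProbabilityMeasure (refMeasure V p T) := by
  have := isProbabilityMeasure_refPoint hp hT hpT
  unfold refMeasure
  infer_instance

theorem map_comp_refMeasure {ι : Type*} [Fintype ι] (hp : 0 ≤ p) (hT : 0 ≤ T) (hpT : p * T ≤ 1)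
    {u : ι → V} (hu : Function.Injective u) :
    (refMeasure V p T).map (fun x a => x (u a)) = Measure.pi fun _ : ι => refPoint p T := by
  have := isProbabilityMeasure_refPoint hp hT hpT
  have := isProbabilityMeasure_refMeasure (V := V) hp hT hpT
  have h1 : iIndepFun (fun (v : V) (x : V → ℝ) => x v) (refMeasure V p T) :=
    iIndepFun_pi (X := fun _ => id) fun _ => aemeasurable_id
  have h2 := (iIndepFun_iff_map_fun_eq_pi_map fun a =>
    (measurable_pi_apply (u a)).aemeasurable).mp (h1.precomp hu)
  rw [h2]
  congr 1
  funext a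
  exact (measurePreserving_eval (fun _ : V => refPoint p T) (u a)).map_eq

theorem integral_indicator_refMeasure {ι : Type*} [Fintype ι] (hp : 0 ≤ p) (hT : 0 ≤ T)
    (hpT : p * T ≤ 1) {u : ι → V} (hu : Function.Injective u) {G : (ι → ℝ) → ℂ}
    (hG : Measurable G) :
    ∫ x, (window ι T).indicator G (fun a => x (u a)) ∂(refMeasure V p T) =
      ((p ^ Fintype.card ι : ℝ) : ℂ) * ∫ y in window ι T, G y := by
  have hmw := measurableSet_window ι T
  have hm : Measurable fun (x : V → ℝ) (a : ι) => x (u a) := by fun_prop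
  rw [← integral_map hm.aemeasurable (hG.indicator hmw).aestronglyMeasurable,
    map_comp_refMeasure hp hT hpT hu, integral_indicator hmw,
    pi_refPoint_restrict_window ι hp hT hpT, integral_smul_measure]
  simp [ENNReal.toReal_ofReal hp]

theorem refMeasure_real_cyl (hp : 0 ≤ p) (hT : 0 ≤ T) (hpT : p * T ≤ 1)
    (η : Finset V) : (refMeasure V p T).real (cyl η T) = (p * T) ^ η.card := by
  classical
  have := isProbabilityMeasure_refPoint hp hT hpT
  have hset : cyl η T = Set.univ.pi fun v => if v ∈ η then Set.Icc 0 T else Set.univ := by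
    ext x
    simp only [cyl, Set.mem_ofPred_eq, Set.mem_univ_pi]
    refine forall_congr' fun v => ?_
    split_ifs with h <;> simp [h]
  have hI : (refPoint p T) (Set.Icc 0 T) = ENNReal.ofReal (p * T) := by
    rw [← Measure.restrict_apply_univ, refPoint_restrict_Icc]
    simp [ENNReal.ofReal_mul hp]
  rw [measureReal_def, refMeasure, hset, Measure.pi_pi]
  have : ∀ v : V, (refPoint p T) (if v ∈ η then Set.Icc 0 T else Set.univ) =
      if v ∈ η then ENNReal.ofReal (p * T) else 1 := by
    intro v
    split_ifs
    · exact hI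
    · exact measure_univ
  simp_rw [this]
  rw [Finset.prod_ite_mem, Finset.univ_inter, Finset.prod_const, ENNReal.toReal_pow,
    ENNReal.toReal_ofReal (by positivity)]

theorem sum_refMeasure_cyl_le (hp : 0 ≤ p) (hT : 0 ≤ T) (hpT : p * T ≤ 1)
    (hpV : p * Fintype.card V = 1) (K : ℕ) :
    ∑ η ∈ Finset.powersetCard K (Finset.univ : Finset V), (refMeasure V p T).real (cyl η T) ≤
      T ^ K / K.factorial := by
  have h1 : ∀ η ∈ Finset.powersetCard K (Finset.univ : Finset V),
      (refMeasure V p T).real (cyl η T) = (p * T) ^ K := by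
    intro η hη
    rw [refMeasure_real_cyl hp hT hpT, (Finset.mem_powersetCard.mp hη).2]
  rw [Finset.sum_congr rfl h1, Finset.sum_const, Finset.card_powersetCard, nsmul_eq_mul,
    Finset.card_univ]
  have h2 := Nat.choose_le_pow_div (α := ℝ) K (Fintype.card V)
  calc ((Fintype.card V).choose K : ℝ) * (p * T) ^ K
      ≤ (Fintype.card V : ℝ) ^ K / K.factorial * (p * T) ^ K := by gcongr
    _ = (p * Fintype.card V * T) ^ K / K.factorial := by
        rw [mul_pow, mul_pow, mul_pow]; ring
    _ = T ^ K / K.factorial := by rw [hpV, one_mul]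

end Reference

/-! ### Classes of configurations and the rescaled spectrum -/

section Classes

variable {n : ℕ}

theorem sum_spin_eq_two_mul_sum_class (hn : 0 < n) {M : Type*} [AddCommMonoid M]
    (f : SpinClass n → M) :
    ∑ σ : Spin n, f (Quotient.mk (flipSetoid n) σ) = 2 • ∑ c, f c := by
  classical
  rw [← Finset.sum_fiberwise_of_maps_to (g := fun σ => Quotient.mk (flipSetoid n) σ)
    (t := Finset.univ) (fun _ _ => Finset.mem_univ _), Finset.smul_sum]
  refine Finset.sum_congr rfl fun c _ => ?_
  induction c using Quotient.inductionOn with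
  | h τ =>
    have hset : (Finset.univ.filter fun σ : Spin n =>
        Quotient.mk (flipSetoid n) σ = Quotient.mk (flipSetoid n) τ) = {τ, -τ} := by
      ext σ
      simp only [Finset.mem_filter, Finset.mem_univ, true_and, Finset.mem_insert,
        Finset.mem_singleton]
      rw [eq_comm, Quotient.eq]
      rfl
    have hne : τ ≠ -τ := by
      intro h
      have := congrFun h ⟨0, hn⟩
      rcases Int.units_eq_one_or (τ ⟨0, hn⟩) with h1 | h1 <;> simp [h1] at this
    rw [Finset.sum_congr rfl (g := fun _ => f (Quotient.mk (flipSetoid n) τ)) (fun σ hσ => by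
      rw [(Finset.mem_filter.mp hσ).2]), hset, Finset.sum_const, Finset.card_pair hne]

theorem card_spinClass (hn : 0 < n) : Fintype.card (SpinClass n) = 2 ^ (n - 1) := by
  have h := sum_spin_eq_two_mul_sum_class hn (fun _ => 1)
  have hcard : Fintype.card (Spin n) = 2 ^ n := by simp [Spin]
  simp only [Finset.sum_const, Finset.card_univ, smul_eq_mul, mul_one, hcard] at h
  obtain ⟨m, rfl⟩ : ∃ m, n = m + 1 := ⟨n - 1, by omega⟩
  rw [pow_succ] at h
  rw [Nat.add_sub_cancel]
  omega

/-- The rescaled spectrum, indexed by the classes. -/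
def rescaledSpectrum (α : ℝ) (X : Couplings n) (c : SpinClass n) : ℝ :=
  (classEnergy X c - α) / scale n α

theorem rescaledSpectrum_mk (α : ℝ) (X : Couplings n) (σ : Spin n) :
    rescaledSpectrum α X (Quotient.mk (flipSetoid n) σ) = (energy X σ - α) / scale n α := rfl

theorem measurable_classEnergy (c : SpinClass n) : Measurable fun X => classEnergy X c := by
  induction c using Quotient.inductionOn with
  | h τ =>
    have : (fun X => classEnergy X (Quotient.mk (flipSetoid n) τ)) = fun X => energy X τ := rfl
    rw [this]
    unfold energy
    fun_prop

theorem measurable_rescaledSpectrum (α : ℝ) :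
    Measurable (rescaledSpectrum α : Couplings n → SpinClass n → ℝ) :=
  measurable_pi_lambda _ fun c => ((measurable_classEnergy c).sub_const _).div_const _

/-- The law of the rescaled spectrum. -/
def spectrumLaw (n : ℕ) (α : ℝ) : Measure (SpinClass n → ℝ) :=
  (disorder n).map (rescaledSpectrum α)

instance isProbabilityMeasure_spectrumLaw (n : ℕ) (α : ℝ) :
    IsProbabilityMeasure (spectrumLaw n α) :=
  Measure.isProbabilityMeasure_map (measurable_rescaledSpectrum α).aemeasurable

end Classes

/-! ### The spectrum compared with the reference law -/

section CylClose

variable {n : ℕ}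

theorem tupleErr_nonneg {ι : Type*} [Fintype ι] [DecidableEq ι] (hn : 0 < n) {α T : ℝ}
    (hα : 0 ≤ α) (hT : 0 ≤ T) (τ : ι → Spin n) : 0 ≤ tupleErr α T τ :=
  (norm_nonneg _).trans (norm_integral_sub_le_tupleErr hn hα hT τ (G := fun _ => 0)
    measurable_const (by simp))

open scoped Classical in
/-- Representatives of the classes in `η`, in some order. -/
def representatives (k : ℕ) (η : Finset (SpinClass n)) : Fin k → Spin n :=
  if h : η.card = k then fun a => ((η.equivFinOfCardEq h).symm a).1.out else 1

-- A test function of the coordinates in η becomes one on `Fin k → ℝ`, with the other coordinates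
-- filled in by -1, as `res` does. The reference integral is then exactly the uniform term in the
-- error of the tuple of representatives.
open scoped Classical in
theorem cylClose_of_card_eq (hn : 0 < n) {α T : ℝ} (hα : 0 ≤ α) (hT : 0 ≤ T)
    (hpT : ((2 : ℝ) ^ (n - 1))⁻¹ * T ≤ 1) {k : ℕ} {η : Finset (SpinClass n)} (hη : η.card = k) :
    CylClose (spectrumLaw n α) (refMeasure (SpinClass n) (((2 : ℝ) ^ (n - 1))⁻¹) T) T η
      (tupleErr α T (representatives k η)) := by
  intro G hG hG1 hGr
  set p := ((2 : ℝ) ^ (n - 1))⁻¹ with hp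
  have hp0 : 0 ≤ p := by positivity
  set u : Fin k → SpinClass n := fun a => ((η.equivFinOfCardEq hη).symm a).1 with hu
  have hui : Function.Injective u :=
    Subtype.val_injective.comp (η.equivFinOfCardEq hη).symm.injective
  have humem : ∀ a, u a ∈ η := fun a => ((η.equivFinOfCardEq hη).symm a).2
  have hsurj : ∀ v (hv : v ∈ η), u (η.equivFinOfCardEq hη ⟨v, hv⟩) = v := by
    intro v hv
    simp [hu]
  set G' : (Fin k → ℝ) → ℂ := fun y =>
    G fun v => if hv : v ∈ η then y (η.equivFinOfCardEq hη ⟨v, hv⟩) else -1 with hG'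
  have hG'm : Measurable G' := by
    refine hG.comp (measurable_pi_lambda _ fun v => ?_)
    by_cases hv : v ∈ η
    · simp only [hv, dif_pos]
      exact measurable_pi_apply _
    · simp only [hv, dif_neg, not_false_eq_true]
      exact measurable_const
  have hind : ∀ x : SpinClass n → ℝ, (cyl η T).indicator G x =
      (window (Fin k) T).indicator G' fun a => x (u a) := by
    intro x
    have hmem : x ∈ cyl η T ↔ (fun a => x (u a)) ∈ window (Fin k) T := by
      constructor
      · intro h a _
        exact h _ (humem a)
      · intro h v hv
        have := h (η.equivFinOfCardEq hη ⟨v, hv⟩) (Set.mem_univ _)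
        simp only [hsurj v hv] at this
        exact this
    have hval : G x = G' fun a => x (u a) := by
      rw [← hGr x]
      simp only [hG']
      congr 1
      funext v
      unfold res
      by_cases hv : v ∈ η
      · simp only [hv, if_true, dif_pos, hsurj v hv]
      · simp only [hv, if_false, dif_neg, not_false_eq_true]
    by_cases hx : x ∈ cyl η T
    · rw [Set.indicator_of_mem hx, Set.indicator_of_mem (hmem.mp hx), hval]
    · rw [Set.indicator_of_notMem hx, Set.indicator_of_notMem fun h => hx (hmem.mpr h)]
  have hrep : ∀ a, Quotient.mk (flipSetoid n) (representatives k η a) = u a := by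
    intro a
    simp only [representatives, hη, dif_pos, hu]
    exact Quotient.out_eq _
  have hmμ : Measurable ((cyl η T).indicator G) := hG.indicator (measurableSet_cyl η T)
  rw [spectrumLaw, integral_map (measurable_rescaledSpectrum α).aemeasurable
    hmμ.aestronglyMeasurable]
  simp_rw [hind]
  rw [integral_indicator_refMeasure hp0 hT hpT hui hG'm]
  have hx : ∀ X : Couplings n, (fun a => rescaledSpectrum α X (u a)) =
      rescaledEnergies α (representatives k η) X := by
    intro X
    funext a
    rw [← hrep a]
    rfl
  simp_rw [hx]
  exact norm_integral_sub_le_tupleErr hn hα hT _ hG'm fun y => hG1 _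

-- Each k-set of classes yields one tuple, with distinct classes, from which the set can be
-- recovered. Hence the sum over sets is part of the sum over tuples.
open scoped Classical in
theorem sum_tupleErr_representatives_le (hn : 0 < n) {α T : ℝ} (hα : 0 ≤ α) (hT : 0 ≤ T) (k : ℕ) :
    ∑ η ∈ Finset.powersetCard k (Finset.univ : Finset (SpinClass n)),
      tupleErr α T (representatives η.card η) ≤ totalErr n k α T := by
  have hmk : ∀ η ∈ Finset.powersetCard k (Finset.univ : Finset (SpinClass n)), ∀ a,
      ∃ h : η.card = k, Quotient.mk (flipSetoid n) (representatives k η a) =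
        ((η.equivFinOfCardEq h).symm a).1 := by
    intro η hη a
    have h := (Finset.mem_powersetCard.mp hη).2
    refine ⟨h, ?_⟩
    simp only [representatives, h, dif_pos]
    exact Quotient.out_eq _
  have hinj : Set.InjOn (fun η : Finset (SpinClass n) => representatives k η)
      (Finset.powersetCard k (Finset.univ : Finset (SpinClass n)) : Set (Finset (SpinClass n))) := by
    have hrange : ∀ η ∈ Finset.powersetCard k (Finset.univ : Finset (SpinClass n)),
        Set.range (fun a => Quotient.mk (flipSetoid n) (representatives k η a)) = η := by
      intro η hη
      ext v
      constructor
      · rintro ⟨a, rfl⟩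
        obtain ⟨h, ha⟩ := hmk η hη a
        simp only [ha]
        exact ((η.equivFinOfCardEq h).symm a).2
      · intro hv
        have h := (Finset.mem_powersetCard.mp hη).2
        refine ⟨η.equivFinOfCardEq h ⟨v, hv⟩, ?_⟩
        obtain ⟨h', ha⟩ := hmk η hη (η.equivFinOfCardEq h ⟨v, hv⟩)
        simp [ha]
    intro η hη η' hη' heq
    have h1 := hrange η hη
    have h2 := hrange η' hη'
    simp only [] at heq
    rw [heq, h2] at h1
    exact_mod_cast h1.symm
  have h1 : ∑ η ∈ Finset.powersetCard k (Finset.univ : Finset (SpinClass n)),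
      tupleErr α T (representatives η.card η) =
      ∑ η ∈ Finset.powersetCard k (Finset.univ : Finset (SpinClass n)),
        tupleErr α T (representatives k η) := by
    refine Finset.sum_congr rfl fun η hη => ?_
    have h := (Finset.mem_powersetCard.mp hη).2
    subst h
    rfl
  rw [h1, ← Finset.sum_image (f := fun τ => tupleErr α T τ) hinj]
  refine Finset.sum_le_sum_of_subset_of_nonneg ?_ fun τ _ _ => tupleErr_nonneg hn hα hT τ
  intro τ hτ
  obtain ⟨η, hη, rfl⟩ := Finset.mem_image.mp hτ
  simp only [Finset.mem_filter, Finset.mem_univ, true_and]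
  intro a b hab
  obtain ⟨h, ha⟩ := hmk η hη a
  obtain ⟨_, hb⟩ := hmk η hη b
  simp only [ha, hb] at hab
  exact (η.equivFinOfCardEq h).symm.injective (Subtype.val_injective hab)

theorem totalErr_nonneg (hn : 0 < n) {α T : ℝ} (hα : 0 ≤ α) (hT : 0 ≤ T) (k : ℕ) :
    0 ≤ totalErr n k α T :=
  Finset.sum_nonneg fun τ _ => tupleErr_nonneg hn hα hT τ

theorem norm_integral_clip_spectrumLaw_sub_le (hn : 0 < n) {α T : ℝ} (hα : 0 ≤ α) (hT : 0 ≤ T)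
    (hpT : ((2 : ℝ) ^ (n - 1))⁻¹ * T ≤ 1) (K : ℕ) {F : (SpinClass n → ℝ) → ℂ}
    (hF : Measurable F) (hF1 : ∀ x, ‖F x‖ ≤ 1) :
    ‖∫ x, F (clip T x) ∂(spectrumLaw n α) -
      ∫ x, F (clip T x) ∂(refMeasure (SpinClass n) (((2 : ℝ) ^ (n - 1))⁻¹) T)‖ ≤
      (∑ k ∈ Finset.range K, 2 ^ k * totalErr n k α T) +
      3 ^ K * (totalErr n K α T + 2 * (T ^ K / K.factorial)) := by
  classical
  have hp0 : 0 ≤ ((2 : ℝ) ^ (n - 1))⁻¹ := by positivity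
  have := isProbabilityMeasure_refMeasure (V := SpinClass n) hp0 hT hpT
  have h := norm_integral_clip_sub_integral_clip_le (spectrumLaw n α)
    (refMeasure (SpinClass n) (((2 : ℝ) ^ (n - 1))⁻¹) T) (T := T)
    (d := fun η => tupleErr α T (representatives η.card η))
    (fun η => cylClose_of_card_eq hn hα hT hpT rfl) K hF hF1
  have hV : ((2 : ℝ) ^ (n - 1))⁻¹ * Fintype.card (SpinClass n) = 1 := by
    rw [card_spinClass hn]
    push_cast
    exact inv_mul_cancel₀ (by positivity)
  have h2 := sum_refMeasure_cyl_le (V := SpinClass n) hp0 hT hpT hV K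
  have h3 : ∀ k, ∑ η ∈ Finset.powersetCard k (Finset.univ : Finset (SpinClass n)),
      tupleErr α T (representatives η.card η) ≤ totalErr n k α T :=
    fun k => sum_tupleErr_representatives_le hn hα hT k
  refine h.trans (add_le_add (Finset.sum_le_sum fun k _ => ?_) ?_)
  · exact mul_le_mul_of_nonneg_left (h3 k) (by positivity)
  · gcongr
    exact h3 K

end CylClose

/-! ### Convergence of the comparison error to zero -/

section Limit

variable {α : ℕ → ℝ}

theorem tendsto_totalErr (hα : ∀ᶠ n : ℕ in atTop, 0 ≤ α n)
    (hα' : α =o[atTop] fun n : ℕ => (n : ℝ)) (k : ℕ) {T : ℝ} (hT : 0 ≤ T) :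
    Tendsto (fun n => totalErr n k (α n) T) atTop (𝓝 0) := by
  obtain ⟨ε, hε, h⟩ := exists_totalErr_le k
  have hb : ∀ᶠ n : ℕ in atTop, 0 ≤ α n ∧ α n ≤ ε * n := by
    filter_upwards [hα, hα'.bound hε] with n h0 h1
    refine ⟨h0, (le_abs_self _).trans ?_⟩
    simpa using h1
  obtain ⟨C, e, hC, he, hle⟩ := h α hb T hT
  have h1 : Tendsto (fun n : ℕ => C * (α n / n) ^ 2 + e n) atTop (𝓝 0) := by
    have := ((hα'.tendsto_div_nhds_zero.pow 2).const_mul C).add he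
    simpa using this
  refine squeeze_zero' ?_ hle h1
  filter_upwards [hα, eventually_ge_atTop 1] with n h0 hn
  exact totalErr_nonneg hn h0 hT k

theorem eventually_inv_two_pow_mul_le (T : ℝ) :
    ∀ᶠ n : ℕ in atTop, ((2 : ℝ) ^ (n - 1))⁻¹ * T ≤ 1 := by
  have h1 : Tendsto (fun n : ℕ => ((2 : ℝ) ^ (n - 1))⁻¹ * T) atTop (𝓝 (0 * T)) := by
    refine Tendsto.mul_const T ?_
    have := (tendsto_pow_atTop_nhds_zero_of_lt_one (r := (1 / 2 : ℝ)) (by norm_num)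
      (by norm_num)).comp (tendsto_sub_atTop_nat 1)
    refine this.congr fun n => ?_
    simp
  rw [zero_mul] at h1
  filter_upwards [h1.eventually_lt_const one_pos] with n hn using hn.le

/-- The rescaled spectrum in `[0, T]` is close in total variation to independent points. -/
theorem tendsto_integral_clip_sub (hα : ∀ᶠ n : ℕ in atTop, 0 ≤ α n)
    (hα' : α =o[atTop] fun n : ℕ => (n : ℝ)) {T : ℝ} (hT : 0 ≤ T)
    {F : ∀ n : ℕ, (SpinClass n → ℝ) → ℂ} (hF : ∀ n, Measurable (F n))
    (hF1 : ∀ n x, ‖F n x‖ ≤ 1) :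
    Tendsto (fun n => ∫ x, F n (clip T x) ∂(spectrumLaw n (α n)) -
      ∫ x, F n (clip T x) ∂(refMeasure (SpinClass n) (((2 : ℝ) ^ (n - 1))⁻¹) T)) atTop (𝓝 0) := by
  rw [Metric.tendsto_atTop']
  intro δ hδ
  -- The truncation level is fixed before n grows: its contribution 2(3T)^K/K! does not depend on n,
  -- and the finitely many total errors vanish afterwards.
  obtain ⟨K, hK⟩ : ∃ K : ℕ, 2 * ((3 * T) ^ K / K.factorial) < δ / 2 := by
    have h := (FloorSemiring.tendsto_pow_div_factorial_atTop (3 * T)).const_mul 2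
    rw [mul_zero] at h
    exact (h.eventually_lt_const (by positivity)).exists
  have h1 : Tendsto (fun n => (∑ k ∈ Finset.range K, 2 ^ k * totalErr n k (α n) T) +
      3 ^ K * (totalErr n K (α n) T + 2 * (T ^ K / K.factorial))) atTop
      (𝓝 (∑ k ∈ Finset.range K, 2 ^ k * 0 + 3 ^ K * (0 + 2 * (T ^ K / K.factorial)))) := by
    refine (tendsto_finsetSum _ fun k _ => (tendsto_totalErr hα hα' k hT).const_mul _).add ?_
    exact ((tendsto_totalErr hα hα' K hT).add_const _).const_mul _
  have h2 : ∑ k ∈ Finset.range K, (2 : ℝ) ^ k * 0 + 3 ^ K * (0 + 2 * (T ^ K / K.factorial)) < δ := by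
    have h3 : (3 : ℝ) ^ K * (0 + 2 * (T ^ K / K.factorial)) = 2 * ((3 * T) ^ K / K.factorial) := by
      rw [mul_pow]; ring
    rw [h3]
    simp only [mul_zero, Finset.sum_const_zero, zero_add]
    linarith
  have h3 := (h1.eventually_lt_const h2).and (hα.and ((eventually_ge_atTop 1).and
    (eventually_inv_two_pow_mul_le T)))
  obtain ⟨N, hN⟩ := eventually_atTop.mp h3
  refine ⟨N, fun n hn => ?_⟩
  obtain ⟨e1, e2, e3, e4⟩ := hN n hn.le
  rw [dist_zero_right]
  exact (norm_integral_clip_spectrumLaw_sub_le e3 e2 hT e4 K (hF n) (hF1 n)).trans_lt e1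

end Limit

/-! ### Counts and their factorial moments -/

section Spectrum

variable {n : ℕ}

theorem countP_energySpectrum (X : Couplings n) (P : ℝ → Prop) [DecidablePred P] :
    (energySpectrum X).countP (fun E => decide (P E)) =
      (Finset.univ.filter fun c : SpinClass n => P (classEnergy X c)).card := by
  unfold energySpectrum
  have h : ((((Finset.univ : Finset (SpinClass n)).val.map (classEnergy X)).sort (· ≤ ·)).countP
      fun E => decide (P E)) = Multiset.countP P
        ((Finset.univ : Finset (SpinClass n)).val.map (classEnergy X)) := by
    conv_rhs => rw [← Multiset.sort_eq ((Finset.univ : Finset (SpinClass n)).val.map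
      (classEnergy X)) (· ≤ ·)]
    rw [Multiset.coe_countP]
  rw [h, Multiset.countP_map]
  rfl

theorem count_eq_card_occ (hn : 0 < n) (α : ℝ) (t : ℝ≥0) (X : Couplings n) :
    count n α t X = (occ (t : ℝ) (rescaledSpectrum α X)).card := by
  have hξ := scale_pos hn α
  unfold count
  rw [countP_energySpectrum X]
  unfold occ
  congr 1
  ext c
  simp only [Finset.mem_filter, Finset.mem_univ, true_and, Set.mem_Icc, rescaledSpectrum]
  rw [le_div_iff₀ hξ, div_le_iff₀ hξ, zero_mul, sub_nonneg, sub_le_iff_le_add']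

theorem measurable_count (n : ℕ) (α : ℝ) (t : ℝ≥0) : Measurable (count n α t) := by
  classical
  have h : count n α t = fun X => ∑ c : SpinClass n,
      if classEnergy X c ∈ Set.Icc α (α + t * scale n α) then 1 else 0 := by
    funext X
    unfold count
    rw [countP_energySpectrum X, Finset.card_filter]
  rw [h]
  refine Finset.measurable_sum _ fun c _ => ?_
  exact Measurable.ite (measurable_classEnergy c measurableSet_Icc) measurable_const
    measurable_const

theorem integral_choose_count (hn : 0 < n) (α : ℝ) (t : ℝ≥0) (k : ℕ) :
    ∫ X, ((count n α t X).choose k : ℝ) ∂(disorder n) =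
      ∑ η ∈ Finset.powersetCard k (Finset.univ : Finset (SpinClass n)),
        (spectrumLaw n α).real (cyl η t) := by
  simp_rw [count_eq_card_occ hn, ← sum_indicator_cyl]
  have hm := measurable_rescaledSpectrum (n := n) α
  have h1 : ∀ η : Finset (SpinClass n), (fun X =>
      (cyl η (t : ℝ)).indicator (fun _ => (1 : ℝ)) (rescaledSpectrum α X)) =
      (rescaledSpectrum α ⁻¹' cyl η (t : ℝ)).indicator fun _ => (1 : ℝ) := fun η => rfl
  rw [integral_finsetSum]
  · refine Finset.sum_congr rfl fun η _ => ?_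
    rw [h1, integral_indicator (hm (measurableSet_cyl η _))]
    simp only [integral_const, measureReal_restrict_apply_univ, smul_eq_mul, mul_one]
    rw [spectrumLaw, map_measureReal_apply hm (measurableSet_cyl η _)]
  · intro η _
    rw [h1]
    exact (integrable_const _).indicator (hm (measurableSet_cyl η _))

theorem abs_integral_choose_count_sub_le (hn : 0 < n) {α : ℝ} (hα : 0 ≤ α) (t : ℝ≥0)
    (hpT : ((2 : ℝ) ^ (n - 1))⁻¹ * t ≤ 1) (k : ℕ) :
    |∫ X, ((count n α t X).choose k : ℝ) ∂(disorder n) -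
      ((2 ^ (n - 1)).choose k : ℝ) * (((2 : ℝ) ^ (n - 1))⁻¹ * t) ^ k| ≤ totalErr n k α t := by
  have hT : (0 : ℝ) ≤ t := t.2
  have hp0 : 0 ≤ ((2 : ℝ) ^ (n - 1))⁻¹ := by positivity
  have := isProbabilityMeasure_refMeasure (V := SpinClass n) hp0 hT hpT
  have h2 : ((2 ^ (n - 1)).choose k : ℝ) * (((2 : ℝ) ^ (n - 1))⁻¹ * t) ^ k =
      ∑ η ∈ Finset.powersetCard k (Finset.univ : Finset (SpinClass n)),
        (refMeasure (SpinClass n) (((2 : ℝ) ^ (n - 1))⁻¹) t).real (cyl η t) := by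
    rw [Finset.sum_congr rfl fun η hη => by
      rw [refMeasure_real_cyl hp0 hT hpT, (Finset.mem_powersetCard.mp hη).2],
      Finset.sum_const, Finset.card_powersetCard, Finset.card_univ, card_spinClass hn,
      nsmul_eq_mul]
  rw [integral_choose_count hn, h2, ← Finset.sum_sub_distrib]
  refine (Finset.abs_sum_le_sum_abs _ _).trans
    (le_trans (Finset.sum_le_sum fun η _ => ?_) (sum_tupleErr_representatives_le hn hα hT k))
  exact (cylClose_of_card_eq hn hα hT hpT rfl).abs_measureReal_sub_le

end Spectrum

/-! ### Convergence in distribution of integer vectors -/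

section Levy

theorem isClosedEmbedding_natCast_euclidean (m : ℕ) :
    IsClosedEmbedding fun y : Fin m → ℕ => WithLp.toLp 2 fun i => (y i : ℝ) := by
  refine Metric.isClosedEmbedding_of_pairwise_le_dist (ε := 1) one_pos fun y z hyz => ?_
  obtain ⟨i, hi⟩ := Function.ne_iff.mp hyz
  rw [EuclideanSpace.dist_eq]
  refine Real.le_sqrt_of_sq_le ?_
  have h1 : (1 : ℝ) ≤ dist (y i : ℝ) (z i : ℝ) := Nat.pairwise_one_le_dist hi
  calc (1 : ℝ) ^ 2 ≤ dist (y i : ℝ) (z i : ℝ) ^ 2 := by gcongr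
    _ ≤ _ := Finset.single_le_sum (f := fun i => dist (y i : ℝ) (z i : ℝ) ^ 2)
        (fun _ _ => sq_nonneg _) (Finset.mem_univ i)

theorem charFun_map_natCast_euclidean {m : ℕ} {Ω : Type*} [MeasurableSpace Ω] (ν : Measure Ω)
    {y : Ω → Fin m → ℕ} (hy : Measurable y) (t : EuclideanSpace ℝ (Fin m)) :
    charFun (ν.map fun ω => WithLp.toLp 2 fun i => (y ω i : ℝ)) t =
      ∫ ω, Complex.exp ((∑ i, (y ω i : ℝ) * t i : ℝ) * Complex.I) ∂ν := by
  have hem : Measurable fun ω => (WithLp.toLp 2 fun i => (y ω i : ℝ) :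
      EuclideanSpace ℝ (Fin m)) :=
    (isClosedEmbedding_natCast_euclidean m).continuous.measurable.comp hy
  rw [charFun_apply, integral_map hem.aemeasurable (by fun_prop)]
  refine integral_congr_ae (Eventually.of_forall fun ω => ?_)
  simp only
  congr 2
  rw [PiLp.inner_apply]
  simp [mul_comm]

theorem integral_map_natCast_euclidean {m : ℕ} {Ω : Type*} [MeasurableSpace Ω] (ν : Measure Ω)
    {y : Ω → Fin m → ℕ} (hy : Measurable y)
    (g : BoundedContinuousFunction (EuclideanSpace ℝ (Fin m)) ℝ) :
    ∫ x, g x ∂(ν.map fun ω => WithLp.toLp 2 fun i => (y ω i : ℝ)) =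
      ∫ x, g (WithLp.toLp 2 fun i => (x i : ℝ)) ∂(ν.map y) := by
  have hem : Measurable fun ω => (WithLp.toLp 2 fun i => (y ω i : ℝ) :
      EuclideanSpace ℝ (Fin m)) :=
    (isClosedEmbedding_natCast_euclidean m).continuous.measurable.comp hy
  rw [integral_map hem.aemeasurable g.continuous.aestronglyMeasurable,
    integral_map hy.aemeasurable (Measurable.of_discrete.aestronglyMeasurable)]

/-- Lévy's continuity theorem is applied in Euclidean space, into which ℕ^m embeds as a closed set;
bounded continuous functions on ℕ^m extend along this embedding, which brings the convergence back.
-/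
theorem tendstoInDistribution_pi_nat {m : ℕ} {Ω : ℕ → Type*} [∀ n, MeasurableSpace (Ω n)]
    {Ω' : Type*} [MeasurableSpace Ω'] {Y : ∀ n, Ω n → Fin m → ℕ} {Z : Ω' → Fin m → ℕ}
    {μ : ∀ n, Measure (Ω n)} [∀ n, IsProbabilityMeasure (μ n)] {μ' : Measure Ω'}
    [IsProbabilityMeasure μ'] (hY : ∀ n, Measurable (Y n)) (hZ : Measurable Z)
    (h : ∀ s : Fin m → ℝ, Tendsto
      (fun n => ∫ ω, Complex.exp ((∑ i, (Y n ω i : ℝ) * s i : ℝ) * Complex.I) ∂(μ n)) atTop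
      (𝓝 (∫ ω, Complex.exp ((∑ i, (Z ω i : ℝ) * s i : ℝ) * Complex.I) ∂μ'))) :
    TendstoInDistribution Y atTop Z μ μ' := by
  set e : (Fin m → ℕ) → EuclideanSpace ℝ (Fin m) := fun y => WithLp.toLp 2 fun i => (y i : ℝ)
    with he
  have hemb : IsClosedEmbedding e := isClosedEmbedding_natCast_euclidean m
  have hem : Measurable e := hemb.continuous.measurable
  have hlev : Tendsto (β := ProbabilityMeasure (EuclideanSpace ℝ (Fin m)))
      (fun n => ⟨(μ n).map (e ∘ Y n), Measure.isProbabilityMeasure_map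
        (hem.comp (hY n)).aemeasurable⟩) atTop
      (𝓝 ⟨μ'.map (e ∘ Z), Measure.isProbabilityMeasure_map (hem.comp hZ).aemeasurable⟩) := by
    refine ProbabilityMeasure.tendsto_of_tendsto_charFun fun t => ?_
    simp only [ProbabilityMeasure.coe_mk]
    refine Eq.subst (motive := fun z => Tendsto _ _ (𝓝 z))
      (charFun_map_natCast_euclidean μ' hZ t).symm ?_
    exact (h fun i => t i).congr fun n => (charFun_map_natCast_euclidean (μ n) (hY n) t).symm
  refine ⟨fun n => (hY n).aemeasurable, hZ.aemeasurable, ?_⟩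
  have hlev' := ProbabilityMeasure.tendsto_iff_forall_integral_tendsto.mp hlev
  refine ProbabilityMeasure.tendsto_iff_forall_integral_tendsto.mpr fun f => ?_
  obtain ⟨g, -, hg⟩ := BoundedContinuousFunction.exists_extension_norm_eq_of_isClosedEmbedding f hemb
  have := hlev' g
  simp only [ProbabilityMeasure.coe_mk] at this ⊢
  have hfg : ∀ y, f y = g (e y) := fun y => (congrFun hg y).symm
  simp_rw [hfg]
  refine Eq.subst (motive := fun z => Tendsto _ _ (𝓝 z))
    (integral_map_natCast_euclidean μ' hZ g) ?_
  exact this.congr fun n => integral_map_natCast_euclidean (μ n) (hY n) g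

end Levy

/-! ### The Poisson limit of the counts -/

section Poisson

variable {m : ℕ}

/-- The weight `exp(i ∑_k s_k 1[0 ≤ x ≤ t_k])` of a point. -/
def pointWeight (t : Fin m → ℝ≥0) (s : Fin m → ℝ) (x : ℝ) : ℂ :=
  Complex.exp ((∑ i, (Set.Icc (0 : ℝ) (t i)).indicator (fun _ => s i) x : ℝ) * Complex.I)

theorem measurable_pointWeight (t : Fin m → ℝ≥0) (s : Fin m → ℝ) :
    Measurable (pointWeight t s) := by
  refine Complex.measurable_exp.comp (Measurable.mul_const ?_ _)
  refine Complex.measurable_ofReal.comp (Finset.measurable_sum _ fun i _ => ?_)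
  exact measurable_const.indicator measurableSet_Icc

theorem norm_pointWeight (t : Fin m → ℝ≥0) (s : Fin m → ℝ) (x : ℝ) :
    ‖pointWeight t s x‖ = 1 := Complex.norm_exp_ofReal_mul_I _

theorem pointWeight_eq_one {t : Fin m → ℝ≥0} {T : ℝ} (hT : ∀ i, (t i : ℝ) ≤ T) (s : Fin m → ℝ)
    {x : ℝ} (hx : x ∉ Set.Icc 0 T) : pointWeight t s x = 1 := by
  have : ∀ i, (Set.Icc (0 : ℝ) (t i)).indicator (fun _ => s i) x = 0 := fun i =>
    Set.indicator_of_notMem (fun h => hx ⟨h.1, h.2.trans (hT i)⟩) _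
  simp [pointWeight, this]

/-- A point is counted at all times from the first k with x ≤ t_k on. The difference of indicators
selects this k, whose weight is exp(i∑_{l≥k} s_l); all other terms vanish. -/
theorem pointWeight_sub_one {t : Fin m → ℝ≥0} (ht : Monotone t) (s : Fin m → ℝ) (x : ℝ) :
    pointWeight t s x - 1 = ∑ k : Fin m,
      ((((Set.Icc (0 : ℝ) (t k)).indicator (fun _ => 1) x -
        (if h : (k : ℕ) = 0 then 0 else
          (Set.Icc (0 : ℝ) (t ⟨(k : ℕ) - 1, by omega⟩)).indicator (fun _ => 1) x) : ℝ)) : ℂ) *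
      (Complex.exp ((∑ i ∈ Finset.Ici k, s i : ℝ) * Complex.I) - 1) := by
  classical
  by_cases hx : ∃ k, x ∈ Set.Icc (0 : ℝ) (t k)
  · obtain ⟨k, hk, hmin⟩ : ∃ k, x ∈ Set.Icc (0 : ℝ) (t k) ∧
        ∀ j, x ∈ Set.Icc (0 : ℝ) (t j) → k ≤ j := by
      have hne : (Finset.univ.filter fun k => x ∈ Set.Icc (0 : ℝ) (t k)).Nonempty := by
        obtain ⟨k, hk⟩ := hx
        exact ⟨k, by simpa using hk⟩
      refine ⟨Finset.min' _ hne, ?_, ?_⟩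
      · have := Finset.min'_mem _ hne
        exact (Finset.mem_filter.mp this).2
      · intro j hj
        exact Finset.min'_le _ j (by simpa using hj)
    have hmem : ∀ j, x ∈ Set.Icc (0 : ℝ) (t j) ↔ k ≤ j := fun j =>
      ⟨hmin j, fun h => ⟨hk.1, hk.2.trans (by exact_mod_cast ht h)⟩⟩
    have hind : ∀ (c : ℝ) j, (Set.Icc (0 : ℝ) (t j)).indicator (fun _ => c) x =
        if k ≤ j then c else 0 := by
      intro c j
      rw [Set.indicator_apply]
      simp only [hmem]
    simp only [hind, pointWeight]
    refine Eq.trans ?_ (Finset.sum_eq_single k ?_ ?_).symm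
    · have h1 : (if h : (k : ℕ) = 0 then (0 : ℝ) else
          if k ≤ (⟨(k : ℕ) - 1, by omega⟩ : Fin m) then 1 else 0) = 0 := by
        split_ifs with h2 h3
        · rfl
        · rw [Fin.le_def] at h3
          simp only at h3
          omega
        · rfl
      rw [h1]
      have h2 : ∑ i, (if k ≤ i then s i else 0) = ∑ i ∈ Finset.Ici k, s i := by
        rw [← Finset.sum_filter]
        congr 1
        ext i
        simp
      rw [h2]
      simp
    · intro j _ hjk
      have h1 : ((if k ≤ j then (1 : ℝ) else 0) - if h : (j : ℕ) = 0 then (0 : ℝ) else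
          if k ≤ (⟨(j : ℕ) - 1, by omega⟩ : Fin m) then 1 else 0) = 0 := by
        have hne : (j : ℕ) ≠ k := fun h => hjk (Fin.ext h)
        simp only [Fin.le_def]
        split_ifs <;> first | omega | norm_num
      rw [h1]
      simp
    · simp
  · push Not at hx
    have hind : ∀ (c : ℝ) j, (Set.Icc (0 : ℝ) (t j)).indicator (fun _ => c) x = 0 := fun c j =>
      Set.indicator_of_notMem (hx j) _
    simp [hind, pointWeight]

theorem setIntegral_indicator_Icc {T : ℝ} {u : ℝ≥0} (hu : (u : ℝ) ≤ T) :
    ∫ x in Set.Icc 0 T, (Set.Icc (0 : ℝ) u).indicator (fun _ => (1 : ℝ)) x = u := by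
  rw [setIntegral_indicator measurableSet_Icc, Set.inter_eq_self_of_subset_right
    (Set.Icc_subset_Icc_right hu)]
  simp

theorem integrableOn_indicator_Icc (T : ℝ) (u : ℝ≥0) :
    IntegrableOn ((Set.Icc (0 : ℝ) u).indicator fun _ => (1 : ℝ)) (Set.Icc 0 T) :=
  (integrable_const (1 : ℝ)).indicator measurableSet_Icc

theorem setIntegral_pointWeight_sub_one {t : Fin m → ℝ≥0} (ht : Monotone t) {T : ℝ}
    (hT : ∀ i, (t i : ℝ) ≤ T) (s : Fin m → ℝ) :
    ∫ x in Set.Icc 0 T, (pointWeight t s x - 1) =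
      ∑ k : Fin m, ((timeStep t k : ℝ) : ℂ) *
        (Complex.exp ((∑ i ∈ Finset.Ici k, s i : ℝ) * Complex.I) - 1) := by
  simp_rw [pointWeight_sub_one ht]
  have h_int : ∀ k : Fin m, IntegrableOn (fun x => (Set.Icc (0 : ℝ) (t k)).indicator (fun _ => 1) x -
        (if h : (k : ℕ) = 0 then 0 else
          (Set.Icc (0 : ℝ) (t ⟨(k : ℕ) - 1, by omega⟩)).indicator (fun _ => 1) x) : ℝ → ℝ)
        (Set.Icc 0 T) := by
    intro k
    refine (integrableOn_indicator_Icc T _).sub ?_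
    split_ifs with h
    · exact integrable_zero _ _ _
    · exact integrableOn_indicator_Icc T _
  rw [integral_finsetSum]
  · refine Finset.sum_congr rfl fun k _ => ?_
    rw [integral_mul_const, integral_complex_ofReal]
    congr 2
    rw [timeStep]
    by_cases h : (k : ℕ) = 0
    · simp only [h, dif_pos, sub_zero, tsub_zero]
      exact setIntegral_indicator_Icc (hT k)
    · simp only [h, dif_neg, not_false_eq_true]
      rw [integral_sub (integrableOn_indicator_Icc T _) (integrableOn_indicator_Icc T _),
        setIntegral_indicator_Icc (hT _), setIntegral_indicator_Icc (hT _), NNReal.coe_sub]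
      exact ht (by rw [Fin.le_def]; simp)
  · intro k _
    exact (h_int k).ofReal.mul_const _

/-- Summation by parts turns the weights on the partial sums into tail sums of s on the independent
increments, so the expectation factorises. -/
theorem integral_exp_poisson_partialSums (t : Fin m → ℝ≥0) (s : Fin m → ℝ) :
    ∫ Y : Fin m → ℕ, Complex.exp ((∑ i, ((∑ k ∈ Finset.Iic i, Y k : ℕ) : ℝ) * s i : ℝ) * Complex.I)
      ∂(Measure.pi fun i => poissonMeasure (timeStep t i)) =
      Complex.exp (∑ k : Fin m, ((timeStep t k : ℝ) : ℂ) *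
        (Complex.exp ((∑ i ∈ Finset.Ici k, s i : ℝ) * Complex.I) - 1)) := by
  have h1 : ∀ Y : Fin m → ℕ,
      Complex.exp ((∑ i, ((∑ k ∈ Finset.Iic i, Y k : ℕ) : ℝ) * s i : ℝ) * Complex.I) =
      ∏ k, Complex.exp (((∑ i ∈ Finset.Ici k, s i : ℝ) : ℂ) * (Y k : ℝ) * Complex.I) := by
    intro Y
    rw [← Complex.exp_sum, ← Finset.sum_mul]
    congr 2
    have h2 : ∑ i, ((∑ k ∈ Finset.Iic i, Y k : ℕ) : ℝ) * s i =
        ∑ k, (∑ i ∈ Finset.Ici k, s i) * (Y k : ℝ) := by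
      simp_rw [Nat.cast_sum, Finset.sum_mul]
      rw [Finset.sum_comm' (t' := Finset.univ) (s' := fun k => Finset.Ici k)]
      · exact Finset.sum_congr rfl fun k _ => Finset.sum_congr rfl fun i _ => mul_comm _ _
      · simp
    rw [h2]
    push_cast
    rfl
  simp_rw [h1]
  rw [integral_fintype_prod_eq_prod (f := fun k (y : ℕ) =>
    Complex.exp (((∑ i ∈ Finset.Ici k, s i : ℝ) : ℂ) * (y : ℝ) * Complex.I)), Complex.exp_sum]
  refine Finset.prod_congr rfl fun k _ => ?_
  have := charFun_map_cast_poissonMeasure (timeStep t k) (∑ i ∈ Finset.Ici k, s i)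
  rw [charFun_apply_real, integral_map .of_discrete (by fun_prop)] at this
  exact this

theorem integral_prod_refMeasure {V : Type*} [Fintype V] {p T : ℝ} (hp : 0 ≤ p) (hT : 0 ≤ T)
    (hpT : p * T ≤ 1) {φ : ℝ → ℂ} (hφ : Measurable φ) (hφ1 : ∀ x, ‖φ x‖ ≤ 1) (hφc : φ (-1) = 1) :
    ∫ x, ∏ v, φ (x v) ∂(refMeasure V p T) =
      (1 + p * ∫ x in Set.Icc 0 T, (φ x - 1)) ^ Fintype.card V := by
  have := isProbabilityMeasure_refPoint hp hT hpT
  rw [refMeasure, integral_fintype_prod_eq_pow]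
  congr 1
  have hi : IntegrableOn φ (Set.Icc 0 T) := by
    refine Measure.integrableOn_of_bounded (M := 1) (by simp) hφ.aestronglyMeasurable
      (Eventually.of_forall hφ1)
  rw [refPoint, integral_add_measure, integral_smul_measure, integral_smul_measure,
    integral_dirac, hφc, integral_sub hi (integrable_const _)]
  · simp only [ENNReal.toReal_ofReal hp, ENNReal.toReal_ofReal (sub_nonneg.mpr hpT)]
    simp [hT]
    ring
  · exact Integrable.smul_measure hi ENNReal.ofReal_ne_top
  · refine Integrable.smul_measure ?_ ENNReal.ofReal_ne_top
    exact integrable_dirac (by simp)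

theorem convergesToPoissonProcess {α : ℕ → ℝ} (hα : ∀ᶠ n : ℕ in atTop, 0 ≤ α n)
    (hα' : α =o[atTop] fun n : ℕ => (n : ℝ)) : ConvergesToPoissonProcess α := by
  intro m t ht
  refine tendstoInDistribution_pi_nat
    (fun n => measurable_pi_lambda _ fun i => measurable_count n (α n) (t i))
    Measurable.of_discrete fun s => ?_
  rw [integral_exp_poisson_partialSums]
  -- Any common upper bound of the times would do; the sum also covers the case of no times.
  set T : ℝ := ∑ i, (t i : ℝ) with hTd
  have hT0 : 0 ≤ T := Finset.sum_nonneg fun i _ => (t i).2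
  have hT : ∀ i, (t i : ℝ) ≤ T := fun i =>
    Finset.single_le_sum (f := fun i => (t i : ℝ)) (fun i _ => (t i).2) (Finset.mem_univ i)
  set F : ∀ n : ℕ, (SpinClass n → ℝ) → ℂ := fun n x => ∏ v, pointWeight t s (x v) with hF
  have hFm : ∀ n, Measurable (F n) := fun n =>
    Finset.measurable_prod _ fun v _ => (measurable_pointWeight t s).comp (measurable_pi_apply v)
  have hF1 : ∀ n x, ‖F n x‖ ≤ 1 := fun n x => by
    simp only [hF]
    rw [norm_prod]
    simp [norm_pointWeight]
  have hneg : (-1 : ℝ) ∉ Set.Icc 0 T := fun h => by linarith [h.1]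
  -- Points outside [0,T] have weight 1, and so does the point -1 to which they are moved.
  have hclip : ∀ n x, F n (clip T x) = F n x := by
    intro n x
    refine Finset.prod_congr rfl fun v _ => ?_
    by_cases hv : x v ∈ Set.Icc 0 T
    · simp only [clip, res, occ, Finset.mem_filter, Finset.mem_univ, true_and, hv, if_true]
    · have : clip T x v = -1 := by
        simp only [clip, res, occ, Finset.mem_filter, Finset.mem_univ, true_and, hv, if_false]
      rw [this, pointWeight_eq_one hT s hv, pointWeight_eq_one hT s hneg]
  have hcmp := tendsto_integral_clip_sub hα hα' hT0 hFm hF1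
  simp only [hclip] at hcmp
  set θ := ∑ k : Fin m, ((timeStep t k : ℝ) : ℂ) *
        (Complex.exp ((∑ i ∈ Finset.Ici k, s i : ℝ) * Complex.I) - 1) with hθ
  have href : Tendsto (fun n => ∫ x, F n x ∂(refMeasure (SpinClass n) (((2 : ℝ) ^ (n - 1))⁻¹) T))
      atTop (𝓝 (Complex.exp θ)) := by
    -- The reference characteristic function is exactly (1 + θ/N)^N with N = 2^{n-1}.
    have h1 := (Complex.tendsto_one_add_div_pow_exp θ).comp
      ((tendsto_pow_atTop_atTop_of_one_lt (r := 2) one_lt_two).comp (tendsto_sub_atTop_nat 1))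
    refine h1.congr' ?_
    filter_upwards [eventually_ge_atTop 1, eventually_inv_two_pow_mul_le T] with n hn hpT
    simp only [hF]
    rw [integral_prod_refMeasure (by positivity) hT0 hpT (measurable_pointWeight t s)
      (fun x => (norm_pointWeight t s x).le) (pointWeight_eq_one hT s hneg),
      setIntegral_pointWeight_sub_one ht hT, ← hθ, card_spinClass hn]
    simp only [Function.comp]
    congr 2
    push_cast
    rw [div_eq_inv_mul]
  have hsum := hcmp.add href
  simp only [sub_add_cancel, zero_add] at hsum
  refine hsum.congr' ?_
  filter_upwards [eventually_ge_atTop 1] with n hn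
  rw [spectrumLaw, integral_map (measurable_rescaledSpectrum _).aemeasurable
    (hFm n).aestronglyMeasurable]
  refine integral_congr_ae (Eventually.of_forall fun X => ?_)
  simp only [hF, pointWeight]
  rw [← Complex.exp_sum, ← Finset.sum_mul, ← Complex.ofReal_sum]
  congr 3
  rw [Finset.sum_comm]
  refine Finset.sum_congr rfl fun i _ => ?_
  classical
  rw [count_eq_card_occ hn, occ, Finset.card_filter]
  push_cast
  rw [Finset.sum_mul]
  refine Finset.sum_congr rfl fun v _ => ?_
  rw [Set.indicator_apply]
  split_ifs <;> simp

end Poisson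

/-! ### Entries of a sorted list in terms of counts -/

section SortedList

/-- Counts do not depend on the ordering of the list, so this removes the sorting from the
definition of the levels and makes their measurability accessible. -/
theorem getElem?_eq_some_iff_of_pairwise {l : List ℝ} (hl : l.Pairwise (· ≤ ·)) (m : ℕ) (e : ℝ) :
    l[m]? = some e ↔
      l.countP (fun x => decide (x < e)) ≤ m ∧ m < l.countP (fun x => decide (x ≤ e)) := by
  induction l generalizing m with
  | nil => simp
  | cons b l ih =>
    rw [List.pairwise_cons] at hl
    have h0 : ∀ {c}, c ≤ b → l.countP (fun x => decide (x < c)) = 0 := fun hc => by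
      simp only [List.countP_eq_zero, decide_eq_true_eq, not_lt]
      exact fun x hx => hc.trans (hl.1 x hx)
    have h0' : ∀ {c}, c < b → l.countP (fun x => decide (x ≤ c)) = 0 := fun hc => by
      simp only [List.countP_eq_zero, decide_eq_true_eq, not_le]
      exact fun x hx => hc.trans_le (hl.1 x hx)
    cases m with
    | zero =>
      simp only [List.getElem?_cons_zero, Option.some.injEq, List.countP_cons, decide_eq_true_eq]
      rcases lt_trichotomy b e with h | h | h
      · simp [h, h.ne]
      · subst h
        simp [h0 le_rfl]
      · simp [h.ne', h0' h, h.not_ge]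
    | succ m =>
      simp only [List.getElem?_cons_succ, ih hl.2, List.countP_cons, decide_eq_true_eq]
      rcases lt_trichotomy b e with h | h | h
      · simp [h, h.le]
      · subst h
        simp [h0 le_rfl]
      · simp [h0' h, h.not_ge]

end SortedList

/-! ### Measurability of the levels and absence of ties -/

section Levels

variable {n : ℕ}

open scoped Classical in
theorem mem_levelSet_iff (a : ℝ) (i : ℕ) (X : Couplings n) (σ : Spin n) :
    σ ∈ levelSet a i X ↔
      (Finset.univ.filter fun c => classEnergy X c < energy X σ).card ≤
        (Finset.univ.filter fun c => classEnergy X c < a).card + (i - 1) ∧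
      (Finset.univ.filter fun c => classEnergy X c < a).card + (i - 1) <
        (Finset.univ.filter fun c => classEnergy X c ≤ energy X σ).card := by
  have hs : (energySpectrum X).Pairwise (· ≤ ·) := Multiset.pairwise_sort _ _
  have hr : rankBelow a X = (Finset.univ.filter fun c => classEnergy X c < a).card :=
    countP_energySpectrum X (· < a)
  rw [levelSet, Set.mem_ofPred_eq, getElem?_eq_some_iff_of_pairwise hs, hr,
    ← countP_energySpectrum X (· < energy X σ), ← countP_energySpectrum X (· ≤ energy X σ)]

theorem measurableSet_mem_levelSet (a : ℝ) (i : ℕ) (σ : Spin n) :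
    MeasurableSet {X : Couplings n | σ ∈ levelSet a i X} := by
  classical
  have hσ : Measurable fun X : Couplings n => energy X σ :=
    measurable_classEnergy (Quotient.mk (flipSetoid n) σ)
  have hc : ∀ {P : Couplings n → SpinClass n → Prop}, (∀ c, MeasurableSet {X | P X c}) →
      Measurable fun X => (Finset.univ.filter fun c => P X c).card := by
    intro P hP
    simp_rw [Finset.card_filter]
    exact Finset.measurable_sum _ fun c _ =>
      Measurable.ite (hP c) measurable_const measurable_const
  have h1 : Measurable fun X : Couplings n =>
      (Finset.univ.filter fun c => classEnergy X c < energy X σ).card :=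
    hc fun c => measurableSet_lt (measurable_classEnergy c) hσ
  have h2 : Measurable fun X : Couplings n =>
      (Finset.univ.filter fun c => classEnergy X c < a).card :=
    hc fun c => measurableSet_lt (measurable_classEnergy c) measurable_const
  have h3 : Measurable fun X : Couplings n =>
      (Finset.univ.filter fun c => classEnergy X c ≤ energy X σ).card :=
    hc fun c => measurableSet_le (measurable_classEnergy c) hσ
  simp_rw [mem_levelSet_iff]
  exact (measurableSet_le h1 (h2.add_const _)).inter (measurableSet_lt (h2.add_const _) h3)

theorem measurable_levelSet (a : ℝ) (i : ℕ) :
    Measurable (levelSet a i : Couplings n → Set (Spin n)) :=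
  measurable_set_iff.mpr fun σ => measurableSet_setOfPred.mp (measurableSet_mem_levelSet a i σ)

/-- The couplings enter only through the two level sets, which take finitely many values. Any choice
of representatives is a function on a discrete space, hence harmless. -/
theorem measurable_rescaledOverlap (n : ℕ) (a : ℝ) (i j : ℕ) :
    Measurable (rescaledOverlap n a i j) := by
  classical
  have hS : DiscreteMeasurableSpace (Set (Spin n)) :=
    @MeasurableSingletonClass.toDiscreteMeasurableSpace _ _
      (inferInstanceAs (MeasurableSingletonClass (Spin n → Prop)))
      (Finite.to_countable)
  obtain ⟨rep, hrep⟩ : ∃ rep : Set (Spin n) → Bool → Spin n, ∀ k X b,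
      levelSpin a k X b = rep (levelSet a k X) b :=
    ⟨fun S b => if b then (if h : S.Nonempty then h.some else 1) else
      -(if h : S.Nonempty then h.some else 1), fun k X b => rfl⟩
  have hψ : Measurable fun z : (Set (Spin n) × Set (Spin n)) × (Bool × Bool) =>
      √(n : ℝ) * overlap (rep z.1.1 z.2.1) (rep z.1.2 z.2.2) := Measurable.of_discrete
  have hcomp := hψ.comp ((((measurable_levelSet a i).comp measurable_fst).prodMk
    ((measurable_levelSet a j).comp measurable_fst)).prodMk
    (measurable_snd (α := Couplings n) (β := Bool × Bool)))
  have heq : rescaledOverlap n a i j = fun ω : Couplings n × (Bool × Bool) =>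
      √(n : ℝ) * overlap (rep (levelSet a i ω.1) ω.2.1) (rep (levelSet a j ω.1) ω.2.2) := by
    funext ω
    rw [rescaledOverlap, hrep, hrep]
  rw [heq]
  exact hcomp

/-- For distinct classes the difference of the energies is a nonzero linear functional of the
couplings. Its kernel is a proper subspace, null for Lebesgue measure and so for the Gaussian law.
-/
theorem ae_injective_classEnergy (hn : 0 < n) :
    ∀ᵐ X ∂(disorder n), Function.Injective (classEnergy X) := by
  have hac : disorder n ≪ volume := by
    rw [disorder, pi_gaussianReal_eq_withDensity]
    exact withDensity_absolutelyContinuous _ _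
  have hpair : ∀ σ τ : Spin n, ¬ (σ = τ ∨ σ = -τ) →
      ∀ᵐ X ∂(disorder n), energy X σ ≠ energy X τ := by
    intro σ τ hστ
    suffices h : ∀ᵐ X : Couplings n, energy X σ ≠ energy X τ from hac.ae_le h
    let L : Couplings n →ₗ[ℝ] ℝ :=
      { toFun := fun X => energy X σ - energy X τ
        map_add' := fun X Y => by
          simp only [energy, Pi.add_apply, add_mul, Finset.sum_add_distrib]
          ring
        map_smul' := fun c X => by
          simp only [energy, Pi.smul_apply, smul_eq_mul, mul_assoc, ← Finset.mul_sum,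
            RingHom.id_apply]
          ring }
    have hne : LinearMap.ker L ≠ ⊤ := by
      intro htop
      refine hστ (spin_eq_or_eq_neg_of_mul_eq hn fun i j => ?_)
      have h1 : L (Pi.single (i, j) 1) = 0 := by
        rw [← LinearMap.mem_ker, htop]
        trivial
      have h2 : ∀ ρ : Spin n, energy (Pi.single (i, j) 1) ρ =
          1 / √(n : ℝ) * (((ρ i : ℤ) : ℝ) * ((ρ j : ℤ) : ℝ)) := by
        intro ρ
        rw [energy, Finset.sum_eq_single i, Finset.sum_eq_single j]
        · simp
        · intro b _ hb
          rw [Pi.single_eq_of_ne (by simp [hb])]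
          simp
        · simp
        · intro b _ hb
          refine Finset.sum_eq_zero fun k _ => ?_
          rw [Pi.single_eq_of_ne (by simp [hb])]
          simp
        · simp
      have h3 : energy (Pi.single (i, j) 1) σ - energy (Pi.single (i, j) 1) τ = 0 := h1
      rw [h2, h2, ← mul_sub] at h3
      have h4 : (1 : ℝ) / √(n : ℝ) ≠ 0 := by positivity
      exact sub_eq_zero.mp ((mul_eq_zero.mp h3).resolve_left h4)
    have hz := Measure.addHaar_submodule volume (LinearMap.ker L) hne
    rw [ae_iff]
    refine measure_mono_null (fun X hX => ?_) hz
    simp only [ne_eq, not_not, Set.mem_ofPred_eq] at hX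
    exact LinearMap.mem_ker.mpr (sub_eq_zero.mpr hX)
  have hall : ∀ᵐ X ∂(disorder n), ∀ σ τ : Spin n, ¬ (σ = τ ∨ σ = -τ) →
      energy X σ ≠ energy X τ := by
    simp_rw [ae_all_iff]
    exact hpair
  filter_upwards [hall] with X hX c d hcd
  induction c using Quotient.inductionOn with
  | h σ =>
    induction d using Quotient.inductionOn with
    | h τ =>
      by_contra hne
      refine hX σ τ (fun h => hne ?_) hcd
      refine Quotient.sound ?_
      rcases h with h | h
      · exact Or.inl h.symm
      · exact Or.inr (by rw [h, neg_neg])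

end Levels

/-! ### Levels of a point configuration -/

section StrictLevel

variable {V : Type*} [Fintype V]

open scoped Classical in
/-- The point `u` is the `i`-th smallest nonnegative point of the configuration `x`, without
ties. -/
def IsStrictLevel (x : V → ℝ) (i : ℕ) (u : V) : Prop :=
  0 ≤ x u ∧ (Finset.univ.filter fun w => 0 ≤ x w ∧ x w < x u).card + 1 = i ∧
    (Finset.univ.filter fun w => 0 ≤ x w ∧ x w ≤ x u).card = i

theorem IsStrictLevel.unique {x : V → ℝ} {i : ℕ} {u v : V} (hu : IsStrictLevel x i u)
    (hv : IsStrictLevel x i v) : u = v := by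
  classical
  have key : ∀ {u v : V}, IsStrictLevel x i u → IsStrictLevel x i v → ¬ x u < x v := by
    intro u v hu hv hlt
    have : (Finset.univ.filter fun w => 0 ≤ x w ∧ x w ≤ x u).card ≤
        (Finset.univ.filter fun w => 0 ≤ x w ∧ x w < x v).card := by
      refine Finset.card_le_card fun w hw => ?_
      simp only [Finset.mem_filter, Finset.mem_univ, true_and] at hw ⊢
      exact ⟨hw.1, hw.2.trans_lt hlt⟩
    have h1 := hu.2.2
    have h2 := hv.2.1
    omega
  have hx : x u = x v := le_antisymm (not_lt.mp (key hv hu)) (not_lt.mp (key hu hv))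
  by_contra hne
  -- A tie between two different points would put i + 1 points at or below the level i.
  have hsub : insert v (insert u (Finset.univ.filter fun w => 0 ≤ x w ∧ x w < x u)) ⊆
      Finset.univ.filter fun w => 0 ≤ x w ∧ x w ≤ x u := by
    intro w hw
    simp only [Finset.mem_insert, Finset.mem_filter, Finset.mem_univ, true_and] at hw ⊢
    rcases hw with rfl | rfl | hw
    · exact ⟨hv.1, hx.ge⟩
    · exact ⟨hu.1, le_rfl⟩
    · exact ⟨hw.1, hw.2.le⟩
  have hcard := Finset.card_le_card hsub
  rw [Finset.card_insert_of_notMem (by simp [hx, Ne.symm hne]),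
    Finset.card_insert_of_notMem (by simp)] at hcard
  have h1 := hu.2.1
  have h2 := hu.2.2
  omega

theorem IsStrictLevel.index_unique {x : V → ℝ} {i j : ℕ} {u : V} (hi : IsStrictLevel x i u)
    (hj : IsStrictLevel x j u) : i = j := hi.2.2.symm.trans hj.2.2

theorem measurableSet_isStrictLevel (i : ℕ) (u : V) :
    MeasurableSet {x : V → ℝ | IsStrictLevel x i u} := by
  classical
  have hc : ∀ {P : (V → ℝ) → V → Prop} [∀ x, DecidablePred (P x)], (∀ c, MeasurableSet {x | P x c}) →
      Measurable fun x => (Finset.univ.filter fun c => P x c).card := by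
    intro P _ hP
    simp_rw [Finset.card_filter]
    exact Finset.measurable_sum _ fun c _ =>
      Measurable.ite (hP c) measurable_const measurable_const
  have h0 : ∀ w : V, MeasurableSet {x : V → ℝ | 0 ≤ x w} := fun w =>
    measurableSet_le measurable_const (measurable_pi_apply w)
  have h1 : Measurable fun x : V → ℝ =>
      (Finset.univ.filter fun w => 0 ≤ x w ∧ x w < x u).card :=
    hc (P := fun x w => 0 ≤ x w ∧ x w < x u) fun w => (h0 w).inter
      (measurableSet_lt (measurable_pi_apply w) (measurable_pi_apply u))
  have h2 : Measurable fun x : V → ℝ =>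
      (Finset.univ.filter fun w => 0 ≤ x w ∧ x w ≤ x u).card :=
    hc (P := fun x w => 0 ≤ x w ∧ x w ≤ x u) fun w => (h0 w).inter
      (measurableSet_le (measurable_pi_apply w) (measurable_pi_apply u))
  exact (h0 u).inter ((measurableSet_eq_fun (h1.add_const 1) measurable_const).inter
    (measurableSet_eq_fun h2 measurable_const))

theorem isStrictLevel_comp (π : Equiv.Perm V) (x : V → ℝ) (i : ℕ) (u : V) :
    IsStrictLevel (fun w => x (π w)) i u ↔ IsStrictLevel x i (π u) := by
  classical
  have h : ∀ (P : V → Prop) [DecidablePred P] [DecidablePred fun w => P (π w)], (Finset.univ.filter fun w => P (π w)).card =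
      (Finset.univ.filter P).card := by
    intro P _ _
    refine Finset.card_equiv π fun w => ?_
    simp
  simp only [IsStrictLevel]
  rw [h fun w => 0 ≤ x w ∧ x w < x (π u), h fun w => 0 ≤ x w ∧ x w ≤ x (π u)]

theorem isStrictLevel_clip_iff {T : ℝ} (x : V → ℝ) (i : ℕ) (u : V) :
    IsStrictLevel (clip T x) i u ↔ IsStrictLevel x i u ∧ x u ≤ T := by
  classical
  have hin : ∀ w, x w ∈ Set.Icc 0 T → clip T x w = x w := fun w hw => by
    simp only [clip, res, occ, Finset.mem_filter, Finset.mem_univ, true_and, hw, if_true]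
  have hout : ∀ w, x w ∉ Set.Icc 0 T → clip T x w = -1 := fun w hw => by
    simp only [clip, res, occ, Finset.mem_filter, Finset.mem_univ, true_and, hw, if_false]
  by_cases hu : x u ∈ Set.Icc 0 T
  · have h1 : ∀ w, (0 ≤ clip T x w ∧ clip T x w < clip T x u) ↔ (0 ≤ x w ∧ x w < x u) := by
      intro w
      rw [hin u hu]
      by_cases hw : x w ∈ Set.Icc 0 T
      · rw [hin w hw]
      · rw [hout w hw]
        refine ⟨fun h => absurd h.1 (by norm_num), fun h => absurd ⟨h.1, h.2.le.trans hu.2⟩ hw⟩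
    have h2 : ∀ w, (0 ≤ clip T x w ∧ clip T x w ≤ clip T x u) ↔ (0 ≤ x w ∧ x w ≤ x u) := by
      intro w
      rw [hin u hu]
      by_cases hw : x w ∈ Set.Icc 0 T
      · rw [hin w hw]
      · rw [hout w hw]
        refine ⟨fun h => absurd h.1 (by norm_num), fun h => absurd ⟨h.1, h.2.trans hu.2⟩ hw⟩
    unfold IsStrictLevel
    simp only [h1, h2]
    rw [hin u hu]
    exact ⟨fun h => ⟨h, hu.2⟩, fun h => h.1⟩
  · refine ⟨fun h => ?_, fun h => absurd ⟨h.1.1, h.2⟩ hu⟩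
    have := h.1
    rw [hout u hu] at this
    norm_num at this

theorem isStrictLevel_iff_of_injective {x : V → ℝ} (hx : Function.Injective x) {i : ℕ} {u : V} :
    open scoped Classical in
    IsStrictLevel x i u ↔ 0 ≤ x u ∧ (Finset.univ.filter fun w => 0 ≤ x w ∧ x w < x u).card + 1 = i
    := by
  classical
  have h : 0 ≤ x u → (Finset.univ.filter fun w => 0 ≤ x w ∧ x w ≤ x u).card =
      (Finset.univ.filter fun w => 0 ≤ x w ∧ x w < x u).card + 1 := by
    intro h0
    have : (Finset.univ.filter fun w => 0 ≤ x w ∧ x w ≤ x u) =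
        insert u (Finset.univ.filter fun w => 0 ≤ x w ∧ x w < x u) := by
      ext w
      simp only [Finset.mem_insert, Finset.mem_filter, Finset.mem_univ, true_and]
      constructor
      · rintro ⟨h1, h2⟩
        rcases h2.eq_or_lt with h3 | h3
        · exact Or.inl (hx h3)
        · exact Or.inr ⟨h1, h3⟩
      · rintro (rfl | h1)
        · exact ⟨h0, le_rfl⟩
        · exact ⟨h1.1, h1.2.le⟩
    rw [this, Finset.card_insert_of_notMem (by simp)]
  unfold IsStrictLevel
  constructor
  · exact fun h1 => ⟨h1.1, h1.2.1⟩
  · exact fun h1 => ⟨h1.1, h1.2, (h h1.1).trans h1.2⟩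

/-- The required point is the i-th element, in increasing order, of the finite set of values in
[0,T]. -/
theorem exists_isStrictLevel_of_le_card {x : V → ℝ} (hx : Function.Injective x) {T : ℝ} {i : ℕ}
    (hi : 0 < i) (hc : i ≤ (occ T x).card) : ∃ u, IsStrictLevel x i u ∧ x u ≤ T := by
  classical
  set A := (occ T x).image x with hA
  have hAc : A.card = (occ T x).card := Finset.card_image_of_injective _ hx
  have hlt : i - 1 < A.card := by omega
  obtain ⟨u, hu, hux⟩ := Finset.mem_image.mp (A.orderEmbOfFin_mem rfl ⟨i - 1, hlt⟩)
  have huT : x u ∈ Set.Icc 0 T := (Finset.mem_filter.mp hu).2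
  refine ⟨u, ?_, huT.2⟩
  rw [isStrictLevel_iff_of_injective hx]
  refine ⟨huT.1, ?_⟩
  have h1 : (Finset.univ.filter fun w => 0 ≤ x w ∧ x w < x u).card =
      (A.filter (· < x u)).card := by
    rw [← Finset.card_image_of_injective _ hx]
    congr 1
    ext y
    simp only [hA, occ, Finset.mem_image, Finset.mem_filter, Finset.mem_univ, true_and, Set.mem_Icc]
    constructor
    · rintro ⟨w, ⟨h1, h2⟩, rfl⟩
      exact ⟨⟨w, ⟨h1, h2.le.trans huT.2⟩, rfl⟩, h2⟩
    · rintro ⟨⟨w, h1, rfl⟩, h2⟩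
      exact ⟨w, ⟨h1.1, h2⟩, rfl⟩
  have h2 : A.filter (· < x u) =
      (Finset.Iio (⟨i - 1, hlt⟩ : Fin A.card)).map (A.orderEmbOfFin rfl).toEmbedding := by
    ext y
    simp only [Finset.mem_filter, Finset.mem_map, Finset.mem_Iio]
    constructor
    · rintro ⟨hy, hyu⟩
      obtain ⟨k, rfl⟩ : y ∈ Set.range (A.orderEmbOfFin rfl) := by
        rw [Finset.range_orderEmbOfFin]
        exact hy
      refine ⟨k, ?_, rfl⟩
      rw [hux] at hyu
      exact (OrderEmbedding.lt_iff_lt _).mp hyu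
    · rintro ⟨k, hk, rfl⟩
      refine ⟨A.orderEmbOfFin_mem rfl k, ?_⟩
      rw [hux]
      exact (OrderEmbedding.lt_iff_lt _).mpr hk
  rw [h1, h2, Finset.card_map, Fin.card_Iio]
  simp only
  omega

end StrictLevel

/-! ### Levels of the energy spectrum -/

section LevelSpectrum

variable {n : ℕ}

theorem mem_levelSet_iff_isStrictLevel (hn : 0 < n) {a : ℝ} {i : ℕ} (hi : 0 < i) {X : Couplings n}
    (hX : Function.Injective (classEnergy X)) (σ : Spin n) :
    σ ∈ levelSet a i X ↔
      IsStrictLevel (rescaledSpectrum a X) i (Quotient.mk (flipSetoid n) σ) := by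
  classical
  have hξ := scale_pos hn a
  have hlt : ∀ c d, rescaledSpectrum a X c < rescaledSpectrum a X d ↔
      classEnergy X c < classEnergy X d := fun c d => by
    unfold rescaledSpectrum
    rw [div_lt_div_iff_of_pos_right hξ, sub_lt_sub_iff_right]
  have h0 : ∀ c, 0 ≤ rescaledSpectrum a X c ↔ a ≤ classEnergy X c := fun c => by
    unfold rescaledSpectrum
    rw [le_div_iff₀ hξ, zero_mul, sub_nonneg]
  have hinj : Function.Injective (rescaledSpectrum a X) := by
    intro c d hcd
    refine hX ?_
    unfold rescaledSpectrum at hcd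
    rw [div_left_inj' hξ.ne', sub_left_inj] at hcd
    exact hcd
  rw [mem_levelSet_iff, isStrictLevel_iff_of_injective hinj]
  simp only [hlt, h0]
  have hE : classEnergy X (Quotient.mk (flipSetoid n) σ) = energy X σ := rfl
  rw [hE]
  set e := energy X σ with he
  have hle : (Finset.univ.filter fun c => classEnergy X c ≤ e).card =
      (Finset.univ.filter fun c => classEnergy X c < e).card + 1 := by
    have : (Finset.univ.filter fun c => classEnergy X c ≤ e) =
        insert (Quotient.mk (flipSetoid n) σ) (Finset.univ.filter fun c => classEnergy X c < e) := by
      ext c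
      simp only [Finset.mem_insert, Finset.mem_filter, Finset.mem_univ, true_and]
      constructor
      · intro h
        rcases h.eq_or_lt with h | h
        · exact Or.inl (hX h)
        · exact Or.inr h
      · rintro (rfl | h)
        · exact hE.le
        · exact h.le
    rw [this, Finset.card_insert_of_notMem (by simp [hE])]
  rw [hle]
  by_cases hae : a ≤ e
  · have hsplit : (Finset.univ.filter fun c => classEnergy X c < e).card =
        (Finset.univ.filter fun c => classEnergy X c < a).card +
          (Finset.univ.filter fun c => a ≤ classEnergy X c ∧ classEnergy X c < e).card := by
      rw [← Finset.card_union_of_disjoint]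
      · congr 1
        ext c
        simp only [Finset.mem_union, Finset.mem_filter, Finset.mem_univ, true_and]
        constructor
        · intro h
          rcases lt_or_ge (classEnergy X c) a with h' | h'
          · exact Or.inl h'
          · exact Or.inr ⟨h', h⟩
        · rintro (h | h)
          · exact h.trans_le hae
          · exact h.2
      · rw [Finset.disjoint_filter]
        exact fun c _ h1 h2 => absurd h1 (not_lt.mpr h2.1)
    simp only [hae, true_and]
    omega
  -- An energy below `a` cannot be a level: the energies at or below it are among those below `a`.
  · simp only [hae, false_and, iff_false, not_and, not_lt]
    intro _
    rw [← hle]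
    refine (Finset.card_le_card fun c hc => ?_).trans (Nat.le_add_right _ _)
    simp only [Finset.mem_filter, Finset.mem_univ, true_and] at hc ⊢
    exact hc.trans_lt (not_le.mp hae)

theorem mk_levelSpin_eq (hn : 0 < n) {a : ℝ} {i : ℕ} (hi : 0 < i) {X : Couplings n}
    (hX : Function.Injective (classEnergy X)) {u : SpinClass n}
    (hu : IsStrictLevel (rescaledSpectrum a X) i u) :
    Quotient.mk (flipSetoid n) (levelSpin a i X true) = u := by
  have hne : (levelSet a i X).Nonempty := by
    refine ⟨u.out, ?_⟩
    rw [mem_levelSet_iff_isStrictLevel hn hi hX, Quotient.out_eq]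
    exact hu
  have h1 : levelSpin a i X true = hne.some := by
    simp [levelSpin, hne]
  rw [h1]
  exact IsStrictLevel.unique
    ((mem_levelSet_iff_isStrictLevel hn hi hX _).mp hne.some_mem) hu

end LevelSpectrum

/-! ### Exchangeability of the reference points -/

section PairSum

variable {V : Type*} [Fintype V]

open scoped Classical in
/-- The value of `g` at the pair formed by the `i`-th and the `j`-th nonnegative point. -/
def pairSum (g : V → V → ℂ) (i j : ℕ) (x : V → ℝ) : ℂ :=
  ∑ u, ∑ v, if IsStrictLevel x i u ∧ IsStrictLevel x j v then g u v else 0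

theorem pairSum_eq (g : V → V → ℂ) {i j : ℕ} {x : V → ℝ} {u v : V} (hu : IsStrictLevel x i u)
    (hv : IsStrictLevel x j v) : pairSum g i j x = g u v := by
  classical
  rw [pairSum, Finset.sum_eq_single u, Finset.sum_eq_single v]
  · rw [if_pos ⟨hu, hv⟩]
  · exact fun w _ hw => if_neg fun h => hw (h.2.unique hv)
  · simp
  · exact fun w _ hw => Finset.sum_eq_zero fun w' _ => if_neg fun h => hw (h.1.unique hu)
  · simp

theorem norm_pairSum_le {g : V → V → ℂ} (hg : ∀ u v, ‖g u v‖ ≤ 1) (i j : ℕ) (x : V → ℝ) :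
    ‖pairSum g i j x‖ ≤ 1 := by
  classical
  by_cases h : ∃ u v, IsStrictLevel x i u ∧ IsStrictLevel x j v
  · obtain ⟨u, v, hu, hv⟩ := h
    rw [pairSum_eq g hu hv]
    exact hg u v
  · push Not at h
    have : pairSum g i j x = 0 := Finset.sum_eq_zero fun u _ => Finset.sum_eq_zero fun v _ =>
      if_neg fun h' => h u v h'.1 h'.2
    simp [this]

theorem measurable_pairSum (g : V → V → ℂ) (i j : ℕ) : Measurable (pairSum g i j) := by
  classical
  refine Finset.measurable_sum _ fun u _ => Finset.measurable_sum _ fun v _ => ?_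
  exact Measurable.ite ((measurableSet_isStrictLevel i u).inter (measurableSet_isStrictLevel j v))
    measurable_const measurable_const

theorem pairSum_clip_eq (g : V → V → ℂ) {i j : ℕ} {x : V → ℝ} {T : ℝ} {u v : V}
    (hu : IsStrictLevel x i u ∧ x u ≤ T) (hv : IsStrictLevel x j v ∧ x v ≤ T) :
    pairSum g i j (clip T x) = g u v :=
  pairSum_eq g ((isStrictLevel_clip_iff x i u).mpr hu) ((isStrictLevel_clip_iff x j v).mpr hv)

theorem exists_perm_pair {V : Type*} {u v u' v' : V} (huv : u ≠ v) (huv' : u' ≠ v') :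
    ∃ π : Equiv.Perm V, π u = u' ∧ π v = v' := by
  classical
  refine ⟨Equiv.swap (Equiv.swap u u' v) v' * Equiv.swap u u', ?_, ?_⟩
  · rw [Equiv.Perm.mul_apply, Equiv.swap_apply_left]
    refine Equiv.swap_apply_of_ne_of_ne ?_ huv'
    intro h
    have h2 : Equiv.swap u u' u = Equiv.swap u u' v := by rw [Equiv.swap_apply_left]; exact h
    exact huv ((Equiv.swap u u').injective h2)
  · rw [Equiv.Perm.mul_apply, Equiv.swap_apply_left]

variable {p T : ℝ}

theorem refMeasure_real_preimage_perm (hp : 0 ≤ p) (hT : 0 ≤ T) (hpT : p * T ≤ 1)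
    (π : Equiv.Perm V) {A : Set (V → ℝ)} (hA : MeasurableSet A) :
    (refMeasure V p T).real ((fun x w => x (π w)) ⁻¹' A) = (refMeasure V p T).real A := by
  have hm : Measurable fun (x : V → ℝ) (w : V) => x (π w) := by fun_prop
  have h := map_comp_refMeasure (V := V) hp hT hpT π.injective
  rw [← map_measureReal_apply hm hA, h]
  rfl

/-- By exchangeability, the average of `g` over the pair of levels is its average over all
pairs, up to the diagonal. -/
theorem norm_integral_pairSum_sub_le (hp : 0 ≤ p) (hT : 0 ≤ T) (hpT : p * T ≤ 1)
    (hV : 1 < Fintype.card V) {g : V → V → ℂ} (hg : ∀ u v, ‖g u v‖ ≤ 1) {S : ℂ}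
    (hS : ∑ u, ∑ v, g u v = (Fintype.card V : ℂ) ^ 2 * S) (hS1 : ‖S‖ ≤ 1) {i j : ℕ} (hij : i ≠ j) :
    ‖∫ x, pairSum g i j (clip T x) ∂(refMeasure V p T) -
      S * ∫ x, pairSum (fun _ _ => 1) i j (clip T x) ∂(refMeasure V p T)‖ ≤
      2 / ((Fintype.card V : ℝ) - 1) := by
  classical
  have := isProbabilityMeasure_refMeasure (V := V) hp hT hpT
  set μ := refMeasure V p T with hμ
  set A : V → V → Set (V → ℝ) := fun u v =>
    {x | IsStrictLevel (clip T x) i u ∧ IsStrictLevel (clip T x) j v} with hA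
  have hAm : ∀ u v, MeasurableSet (A u v) := fun u v =>
    ((measurable_clip T) (measurableSet_isStrictLevel i u)).inter
      ((measurable_clip T) (measurableSet_isStrictLevel j v))
  have hAdiag : ∀ u, A u u = ∅ := fun u =>
    Set.eq_empty_iff_forall_notMem.mpr fun x hx => hij (hx.1.index_unique hx.2)
  obtain ⟨u₀, v₀, h₀⟩ := Fintype.exists_pair_of_one_lt_card hV
  set c := μ.real (A u₀ v₀) with hc
  have hc0 : 0 ≤ c := measureReal_nonneg
  have hAc : ∀ u v, u ≠ v → μ.real (A u v) = c := by
    intro u v huv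
    obtain ⟨π, rfl, rfl⟩ := exists_perm_pair h₀ huv
    rw [hc, ← refMeasure_real_preimage_perm hp hT hpT π (hAm u₀ v₀)]
    congr 1
    ext x
    simp only [hA, Set.mem_ofPred_eq, Set.mem_preimage, isStrictLevel_clip_iff,
      isStrictLevel_comp π x]
  have h_int : ∀ h : V → V → ℂ, ∫ x, pairSum h i j (clip T x) ∂μ =
      ∑ u, ∑ v, (μ.real (A u v) : ℂ) * h u v := by
    intro h
    have h1 : ∀ u v, (fun x : V → ℝ => if IsStrictLevel (clip T x) i u ∧
        IsStrictLevel (clip T x) j v then h u v else 0) = (A u v).indicator fun _ => h u v := by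
      intro u v
      funext x
      rw [Set.indicator_apply]
      rfl
    have h2 : ∀ u v, Integrable (fun x : V → ℝ => if IsStrictLevel (clip T x) i u ∧
        IsStrictLevel (clip T x) j v then h u v else 0) μ := fun u v => by
      rw [h1]
      exact (integrable_const _).indicator (hAm u v)
    simp only [pairSum]
    rw [integral_finsetSum _ fun u _ => integrable_finsetSum _ fun v _ => h2 u v]
    refine Finset.sum_congr rfl fun u _ => ?_
    rw [integral_finsetSum _ fun v _ => h2 u v]
    refine Finset.sum_congr rfl fun v _ => ?_
    rw [h1, integral_indicator (hAm u v)]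
    simp
  have hval : ∀ h : V → V → ℂ, ∫ x, pairSum h i j (clip T x) ∂μ =
      c * (∑ u, ∑ v, h u v - ∑ u, h u u) := by
    intro h
    rw [h_int, ← Finset.sum_sub_distrib, Finset.mul_sum]
    refine Finset.sum_congr rfl fun u _ => ?_
    rw [← Finset.add_sum_erase _ _ (Finset.mem_univ u),
      ← Finset.add_sum_erase Finset.univ (fun v => h u v) (Finset.mem_univ u), hAdiag,
      add_sub_cancel_left, Finset.mul_sum]
    simp only [measureReal_empty, Complex.ofReal_zero, zero_mul, zero_add]
    exact Finset.sum_congr rfl fun v hv => by rw [hAc u v (Finset.ne_of_mem_erase hv).symm]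
  set N : ℝ := (Fintype.card V : ℝ) with hN
  have hN1 : 1 < N := by rw [hN]; exact_mod_cast hV
  have hone : ∫ x, pairSum (fun _ _ => (1 : ℂ)) i j (clip T x) ∂μ = ((c * (N * (N - 1)) : ℝ) : ℂ) := by
    rw [hval]
    simp only [Finset.sum_const, Finset.card_univ, nsmul_eq_mul, mul_one, hN]
    push_cast
    ring
  -- With g = 1 the integral is the probability that both levels exist in the window. This bounds
  -- the probability c of one given pair, and the diagonal error 2Nc becomes 2/(N - 1).
  have hcN : c * (N * (N - 1)) ≤ 1 := by
    have h1 : ‖∫ x, pairSum (fun _ _ => (1 : ℂ)) i j (clip T x) ∂μ‖ ≤ 1 := by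
      refine (norm_integral_le_of_norm_le_const (C := 1) (Eventually.of_forall fun x =>
        norm_pairSum_le (by simp) i j _)).trans ?_
      simp
    rw [hone, Complex.norm_real, Real.norm_eq_abs] at h1
    exact (le_abs_self _).trans h1
  have hdiff : ∫ x, pairSum g i j (clip T x) ∂μ -
      S * ∫ x, pairSum (fun _ _ => 1) i j (clip T x) ∂μ = c * (N * S - ∑ u, g u u) := by
    rw [hone, hval, hS, hN]
    push_cast
    ring
  rw [hdiff, norm_mul, Complex.norm_real, Real.norm_eq_abs, abs_of_nonneg hc0]
  have h3 : ‖(N : ℂ) * S - ∑ u, g u u‖ ≤ 2 * N := by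
    refine (norm_sub_le _ _).trans ?_
    have h4 : ‖(N : ℂ) * S‖ ≤ N := by
      rw [norm_mul, Complex.norm_real, Real.norm_eq_abs, abs_of_pos (by linarith)]
      exact mul_le_of_le_one_right (by linarith) hS1
    have h5 : ‖∑ u, g u u‖ ≤ N := by
      refine (norm_sum_le _ _).trans ((Finset.sum_le_sum fun u _ => hg u u).trans ?_)
      simp [hN]
    linarith
  calc c * ‖(N : ℂ) * S - ∑ u, g u u‖ ≤ c * (2 * N) := by gcongr
    _ ≤ 2 / (N - 1) := by
        rw [le_div_iff₀ (by linarith)]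
        nlinarith

end PairSum

/-! ### Averages of the characteristic function over pairs of classes -/

section CosAverage

variable {n : ℕ}

theorem overlap_neg_left (σ τ : Spin n) : overlap (-σ) τ = -overlap σ τ := by
  simp [overlap]

theorem overlap_neg_right (σ τ : Spin n) : overlap σ (-τ) = -overlap σ τ := by
  simp [overlap]

theorem sum_spin_cexp_mul (σ : Spin n) (z : ℂ) :
    ∑ τ : Spin n, Complex.exp (z * (∑ k, ((σ k : ℤ) : ℝ) * ((τ k : ℤ) : ℝ) : ℝ)) =
      2 ^ n * Complex.cosh z ^ n := by
  have h : ∀ τ : Spin n, Complex.exp (z * (∑ k, ((σ k : ℤ) : ℝ) * ((τ k : ℤ) : ℝ) : ℝ)) =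
      ∏ k, Complex.exp (z * (((σ k : ℤ) : ℂ) * ((τ k : ℤ) : ℂ))) := by
    intro τ
    push_cast
    rw [Finset.mul_sum, Complex.exp_sum]
  simp_rw [h]
  have h2 := Finset.prod_univ_sum (fun _ : Fin n => (Finset.univ : Finset ℤˣ))
    fun k s => Complex.exp (z * (((σ k : ℤ) : ℂ) * ((s : ℤ) : ℂ)))
  rw [Fintype.piFinset_univ] at h2
  rw [← h2]
  have h3 : ∀ k, ∑ s : ℤˣ, Complex.exp (z * (((σ k : ℤ) : ℂ) * ((s : ℤ) : ℂ))) =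
      2 * Complex.cosh z := by
    intro k
    rw [Complex.cosh]
    have hu : (Finset.univ : Finset ℤˣ) = {1, -1} := rfl
    rw [hu, Finset.sum_pair (by decide)]
    rcases Int.units_eq_one_or (σ k) with h | h <;> simp [h] <;> ring
  rw [Finset.prod_congr rfl fun k _ => h3 k, Finset.prod_const, Finset.card_univ, Fintype.card_fin,
    mul_pow]

theorem sum_spin_cos_mul (σ : Spin n) (x : ℝ) :
    ∑ τ : Spin n, Real.cos (x * ∑ k, ((σ k : ℤ) : ℝ) * ((τ k : ℤ) : ℝ)) =
      2 ^ n * Real.cos x ^ n := by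
  have h1 := sum_spin_cexp_mul σ (x * Complex.I)
  have h2 := sum_spin_cexp_mul σ (-(x * Complex.I))
  rw [Complex.cosh_neg] at h2
  rw [Complex.cosh_mul_I] at h1 h2
  have h3 : ((∑ τ : Spin n, Real.cos (x * ∑ k, ((σ k : ℤ) : ℝ) * ((τ k : ℤ) : ℝ)) : ℝ) : ℂ) =
      ((2 ^ n * Real.cos x ^ n : ℝ) : ℂ) := by
    have h4 : ∀ τ : Spin n,
        ((Real.cos (x * ∑ k, ((σ k : ℤ) : ℝ) * ((τ k : ℤ) : ℝ)) : ℝ) : ℂ) =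
        (Complex.exp (x * Complex.I * (∑ k, ((σ k : ℤ) : ℝ) * ((τ k : ℤ) : ℝ) : ℝ)) +
          Complex.exp (-(x * Complex.I) * (∑ k, ((σ k : ℤ) : ℝ) * ((τ k : ℤ) : ℝ) : ℝ))) / 2 := by
      intro τ
      rw [Complex.ofReal_cos, Complex.cos]
      push_cast
      congr 3 <;> ring
    rw [Complex.ofReal_sum, Finset.sum_congr rfl fun τ _ => h4 τ, ← Finset.sum_div,
      Finset.sum_add_distrib, h1, h2]
    push_cast
    ring
  exact_mod_cast h3

/-- The characteristic function of the rescaled overlap of two random representatives of a pair of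
classes. -/
def cosOverlap (s : ℝ) (u v : SpinClass n) : ℂ :=
  (Real.cos (s * (√(n : ℝ) * overlap u.out v.out)) : ℝ)

theorem cosOverlap_mk (s : ℝ) (σ τ : Spin n) :
    cosOverlap s (Quotient.mk (flipSetoid n) σ) (Quotient.mk (flipSetoid n) τ) =
      (Real.cos (s * (√(n : ℝ) * overlap σ τ)) : ℝ) := by
  have h1 : ∀ ρ : Spin n, ρ = (Quotient.mk (flipSetoid n) ρ).out ∨
      ρ = -(Quotient.mk (flipSetoid n) ρ).out := fun ρ => Quotient.mk_out (s := flipSetoid n) ρ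
  unfold cosOverlap
  congr 1
  have h2 : overlap σ τ = overlap (Quotient.mk (flipSetoid n) σ).out
        (Quotient.mk (flipSetoid n) τ).out ∨
      overlap σ τ = -overlap (Quotient.mk (flipSetoid n) σ).out
        (Quotient.mk (flipSetoid n) τ).out := by
    have h3 := h1 σ
    have h4 := h1 τ
    generalize (Quotient.mk (flipSetoid n) σ).out = σ' at *
    generalize (Quotient.mk (flipSetoid n) τ).out = τ' at *
    rcases h3 with rfl | rfl <;> rcases h4 with rfl | rfl <;>
      simp [overlap_neg_left, overlap_neg_right]
  rcases h2 with h2 | h2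
  · rw [h2]
  · rw [h2, mul_neg, mul_neg, Real.cos_neg]

theorem norm_cosOverlap_le (s : ℝ) (u v : SpinClass n) : ‖cosOverlap s u v‖ ≤ 1 := by
  rw [cosOverlap, Complex.norm_real, Real.norm_eq_abs]
  exact Real.abs_cos_le_one _

/-- The value does not depend on the representatives, so the sum may be taken over configurations,
where it factorises over the sites. -/
theorem sum_cosOverlap (hn : 0 < n) (s : ℝ) :
    ∑ u : SpinClass n, ∑ v : SpinClass n, cosOverlap s u v =
      (Fintype.card (SpinClass n) : ℂ) ^ 2 * ((Real.cos (s / √(n : ℝ)) ^ n : ℝ) : ℂ) := by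
  have h1 : ∑ σ : Spin n, ∑ τ : Spin n, cosOverlap s (Quotient.mk (flipSetoid n) σ)
      (Quotient.mk (flipSetoid n) τ) = 4 * ∑ u : SpinClass n, ∑ v : SpinClass n, cosOverlap s u v := by
    simp_rw [sum_spin_eq_two_mul_sum_class hn]
    rw [← Finset.smul_sum, sum_spin_eq_two_mul_sum_class hn fun u => ∑ v, cosOverlap s u v]
    simp only [nsmul_eq_mul]
    push_cast
    ring
  have h2 : ∑ σ : Spin n, ∑ τ : Spin n, cosOverlap s (Quotient.mk (flipSetoid n) σ)
      (Quotient.mk (flipSetoid n) τ) = (4 : ℂ) ^ n * ((Real.cos (s / √(n : ℝ)) ^ n : ℝ) : ℂ) := by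
    have hn' : (0 : ℝ) < n := by exact_mod_cast hn
    have h3 : ∀ σ τ : Spin n, s * (√(n : ℝ) * overlap σ τ) =
        s / √(n : ℝ) * ∑ k, ((σ k : ℤ) : ℝ) * ((τ k : ℤ) : ℝ) := by
      intro σ τ
      have h4 : √(n : ℝ) * (1 / n) = 1 / √(n : ℝ) := by
        rw [mul_one_div, div_eq_div_iff hn'.ne' (Real.sqrt_pos.mpr hn').ne', one_mul,
          Real.mul_self_sqrt hn'.le]
      rw [overlap, ← mul_assoc (√(n : ℝ)), h4]
      ring
    simp_rw [cosOverlap_mk, h3, ← Complex.ofReal_sum, sum_spin_cos_mul]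
    simp only [Finset.sum_const, Finset.card_univ, Fintype.card_pi, Fintype.card_units_int,
      Finset.prod_const, Fintype.card_fin, nsmul_eq_mul]
    push_cast
    rw [← mul_assoc, ← mul_pow]
    norm_num
  rw [h1] at h2
  have h5 : (4 : ℂ) ^ n = 4 * ((2 : ℂ) ^ (n - 1)) ^ 2 := by
    obtain ⟨m, rfl⟩ : ∃ m, n = m + 1 := ⟨n - 1, by omega⟩
    rw [Nat.add_sub_cancel, ← pow_mul, mul_comm m 2, pow_mul, pow_succ]
    norm_num [mul_comm]
  rw [h5, mul_assoc] at h2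
  have h6 := mul_left_cancel₀ (by norm_num : (4 : ℂ) ≠ 0) h2
  rw [h6, card_spinClass hn]
  push_cast
  rfl

theorem tendsto_cos_div_sqrt_pow (s : ℝ) :
    Tendsto (fun n : ℕ => Real.cos (s / √(n : ℝ)) ^ n) atTop (𝓝 (Real.exp (-(s ^ 2 / 2)))) := by
  have h := Real.tendsto_one_add_pow_exp_of_tendsto
    (g := fun n : ℕ => Real.cos (s / √(n : ℝ)) - 1) (t := -(s ^ 2 / 2)) ?_
  · simpa using h
  have hz : Tendsto (fun n : ℕ => s ^ 4 * (5 / 96) * (n : ℝ)⁻¹) atTop (𝓝 0) := by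
    have := (tendsto_inv_atTop_nhds_zero_nat (𝕜 := ℝ)).const_mul
      (s ^ 4 * (5 / 96))
    simpa using this
  rw [tendsto_iff_norm_sub_tendsto_zero]
  refine squeeze_zero' (Eventually.of_forall fun n => norm_nonneg _) ?_ hz
  have hs : ∀ᶠ n : ℕ in atTop, s ^ 2 ≤ n := by
    filter_upwards [eventually_ge_atTop ⌈s ^ 2⌉₊] with n hn
    exact (Nat.le_ceil _).trans (by exact_mod_cast hn)
  filter_upwards [hs, eventually_ge_atTop 1] with n hsn hn
  have hn' : (0 : ℝ) < n := by exact_mod_cast hn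
  have hsq : (s / √(n : ℝ)) ^ 2 = s ^ 2 / n := by rw [div_pow, Real.sq_sqrt hn'.le]
  have hle : |s / √(n : ℝ)| ≤ 1 := by
    rw [← sq_le_one_iff_abs_le_one, hsq]
    exact (div_le_one hn').mpr hsn
  have hb := Real.cos_bound hle
  have h4 : |s / √(n : ℝ)| ^ 4 = s ^ 4 / n ^ 2 := by
    have : |s / √(n : ℝ)| ^ 4 = ((s / √(n : ℝ)) ^ 2) ^ 2 := by
      rw [← sq_abs (s / √(n : ℝ))]; ring
    rw [this, hsq]
    ring
  rw [h4, hsq] at hb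
  have h5 : (n : ℝ) * (Real.cos (s / √(n : ℝ)) - 1) - -(s ^ 2 / 2) =
      n * (Real.cos (s / √(n : ℝ)) - (1 - s ^ 2 / n / 2)) := by
    field_simp
    ring
  rw [Real.norm_eq_abs, h5, abs_mul, abs_of_pos hn']
  calc (n : ℝ) * |Real.cos (s / √(n : ℝ)) - (1 - s ^ 2 / n / 2)|
      ≤ n * (s ^ 4 / n ^ 2 * (5 / 96)) := by gcongr
    _ = s ^ 4 * (5 / 96) * (n : ℝ)⁻¹ := by
        field_simp

end CosAverage

/-! ### The characteristic function of the rescaled overlap -/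

section CharFun

variable {n : ℕ}

theorem integral_fairCoins (f : Bool × Bool → ℂ) :
    ∫ b, f b ∂fairCoins =
      (f (true, true) + f (true, false) + f (false, true) + f (false, false)) / 4 := by
  rw [fairCoins, PMF.integral_eq_sum, Fintype.sum_prod_type]
  simp [PMF.uniformOfFintype_apply]
  ring

/-- Averaging e^{isQ} over the two independent signs leaves the cosine, which is even; thus only the
classes of the two levels matter, not the chosen representatives. -/
theorem charFun_rescaledOverlap (a : ℝ) (i j : ℕ) (s : ℝ) :
    charFun (((disorder n).prod fairCoins).map (rescaledOverlap n a i j)) s =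
      ∫ X, cosOverlap s (Quotient.mk (flipSetoid n) (levelSpin a i X true))
        (Quotient.mk (flipSetoid n) (levelSpin a j X true)) ∂(disorder n) := by
  have hm := measurable_rescaledOverlap n a i j
  rw [charFun_apply_real, integral_map hm.aemeasurable (by fun_prop), integral_prod]
  · refine integral_congr_ae (Eventually.of_forall fun X => ?_)
    simp only
    rw [integral_fairCoins, cosOverlap_mk]
    have hneg : ∀ k, levelSpin a k X false = -levelSpin a k X true := fun k => by simp [levelSpin]
    simp only [rescaledOverlap, hneg, overlap_neg_left, overlap_neg_right]
    rw [Complex.ofReal_cos, Complex.cos]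
    push_cast
    simp only [mul_neg, neg_neg, neg_mul]
    ring_nf
  · refine Integrable.of_bound (C := 1) ?_ (Eventually.of_forall fun ω => ?_)
    · refine Measurable.aestronglyMeasurable ?_
      fun_prop
    · rw [← Complex.ofReal_mul, Complex.norm_exp_ofReal_mul_I]

end CharFun

/-! ### Consequences of the Poisson limit at a single time -/

section Marginal

theorem ConvergesToPoissonProcess.tendsto_integral {α : ℕ → ℝ} (h : ConvergesToPoissonProcess α)
    (t : ℝ≥0) {f : ℕ → ℝ} {C : ℝ} (hf : ∀ k, |f k| ≤ C) :
    Tendsto (fun n => ∫ X, f (count n (α n) t X) ∂(disorder n)) atTop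
      (𝓝 (∫ k, f k ∂(poissonMeasure t))) := by
  have h1 := (h 1 (fun _ => t) monotone_const).tendsto
  let g : BoundedContinuousFunction (Fin 1 → ℕ) ℝ :=
    BoundedContinuousFunction.ofNormedAddCommGroup (fun y => f (y 0)) continuous_of_discreteTopology
      C fun y => hf (y 0)
  have h2 := ProbabilityMeasure.tendsto_iff_forall_integral_tendsto.mp h1 g
  simp only [ProbabilityMeasure.coe_mk] at h2
  have hg : ∀ y, g y = f (y 0) := fun y => rfl
  have hlim : ∫ y, g y ∂((Measure.pi fun i : Fin 1 =>
      poissonMeasure (timeStep (fun _ => t) i)).map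
        fun (Y : Fin 1 → ℕ) (i : Fin 1) => ∑ k ∈ Finset.Iic i, Y k) =
      ∫ k, f k ∂(poissonMeasure t) := by
    rw [integral_map Measurable.of_discrete.aemeasurable
      Measurable.of_discrete.aestronglyMeasurable]
    have h3 : ∀ Y : Fin 1 → ℕ, g (fun i => ∑ k ∈ Finset.Iic i, Y k) = f (Y 0) := by
      intro Y
      rw [hg]
      congr 1
    simp_rw [h3]
    have h4 := measurePreserving_eval
      (fun i : Fin 1 => poissonMeasure (timeStep (fun _ => t) i)) 0
    have h5 : timeStep (fun _ : Fin 1 => t) 0 = t := by simp [timeStep]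
    rw [h5] at h4
    rw [← h4.map_eq, integral_map (measurable_pi_apply 0).aemeasurable
      Measurable.of_discrete.aestronglyMeasurable]
  refine Eq.subst (motive := fun z => Tendsto _ _ (𝓝 z)) hlim (h2.congr fun n => ?_)
  rw [integral_map (measurable_pi_lambda _ fun i => measurable_count n (α n) t).aemeasurable
    Measurable.of_discrete.aestronglyMeasurable]
  rfl

/-- Together with the Poisson limit this shows that the first j levels lie in a long window with
high probability. -/
theorem tendsto_poissonMeasure_real_Iio (j : ℕ) :
    Tendsto (fun T : ℕ => (poissonMeasure (T : ℝ≥0)).real (Set.Iio j)) atTop (𝓝 0) := by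
  have h1 : ∀ T : ℕ, (poissonMeasure (T : ℝ≥0)).real (Set.Iio j) =
      ∑ k ∈ Finset.range j, (T : ℝ) ^ k * Real.exp (-T) / k.factorial := by
    intro T
    have : Set.Iio j = ((Finset.range j : Finset ℕ) : Set ℕ) := by ext; simp
    rw [this, ← sum_measureReal_singleton]
    refine Finset.sum_congr rfl fun k _ => ?_
    rw [poissonMeasure_real_singleton]
    simp [mul_comm]
  simp_rw [h1]
  have h2 : Tendsto (fun T : ℕ => ∑ k ∈ Finset.range j, (T : ℝ) ^ k * Real.exp (-T) / k.factorial)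
      atTop (𝓝 (∑ k ∈ Finset.range j, (0 : ℝ) / k.factorial)) :=
    tendsto_finsetSum _ fun k _ => Tendsto.div_const
      ((Real.tendsto_pow_mul_exp_neg_atTop_nhds_zero k).comp tendsto_natCast_atTop_atTop) _
  simpa using h2

end Marginal

/-! ### The Gaussian limit of the overlaps -/

section Overlap

theorem norm_integral_sub_integral_le {Ω : Type*} [MeasurableSpace Ω] {μ : Measure Ω}
    [IsProbabilityMeasure μ] {f h : Ω → ℂ} (hf : AEStronglyMeasurable f μ)
    (hh : AEStronglyMeasurable h μ) (hf1 : ∀ ω, ‖f ω‖ ≤ 1) (hh1 : ∀ ω, ‖h ω‖ ≤ 1) {B : Set Ω}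
    (hB : MeasurableSet B) (heq : ∀ᵐ ω ∂μ, ω ∉ B → f ω = h ω) :
    ‖∫ ω, f ω ∂μ - ∫ ω, h ω ∂μ‖ ≤ 2 * μ.real B := by
  have hfi : Integrable f μ := Integrable.of_bound hf 1 (Eventually.of_forall hf1)
  have hhi : Integrable h μ := Integrable.of_bound hh 1 (Eventually.of_forall hh1)
  rw [← integral_sub hfi hhi]
  have hle : ‖∫ ω, (f ω - h ω) ∂μ‖ ≤ ∫ ω, B.indicator (fun _ => (2 : ℝ)) ω ∂μ := by
    refine norm_integral_le_of_norm_le ((integrable_const _).indicator hB) ?_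
    filter_upwards [heq] with ω hω
    by_cases hb : ω ∈ B
    · rw [Set.indicator_of_mem hb]
      refine (norm_sub_le _ _).trans ?_
      linarith [hf1 ω, hh1 ω]
    · rw [Set.indicator_of_notMem hb, hω hb, sub_self, norm_zero]
  refine hle.trans ?_
  rw [integral_indicator hB]
  simp [mul_comm]

variable {n : ℕ}

theorem measurable_cosOverlap_levelSpin (a : ℝ) (i j : ℕ) (s : ℝ) :
    Measurable fun X : Couplings n =>
      cosOverlap s (Quotient.mk (flipSetoid n) (levelSpin a i X true))
        (Quotient.mk (flipSetoid n) (levelSpin a j X true)) := by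
  simp_rw [cosOverlap_mk]
  have h : Measurable fun X : Couplings n => rescaledOverlap n a i j (X, (true, true)) :=
    (measurable_rescaledOverlap n a i j).comp (measurable_id.prodMk measurable_const)
  exact Complex.measurable_ofReal.comp (Real.measurable_cos.comp (h.const_mul s))

theorem exists_isStrictLevel_of_le_count (hn : 0 < n) {a : ℝ} {t : ℝ≥0} {X : Couplings n}
    (hX : Function.Injective (classEnergy X)) {i : ℕ} (hi : 0 < i) (hc : i ≤ count n a t X) :
    ∃ u, IsStrictLevel (rescaledSpectrum a X) i u ∧ rescaledSpectrum a X u ≤ t := by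
  have hξ := scale_pos hn a
  have hinj : Function.Injective (rescaledSpectrum a X) := by
    intro c d hcd
    refine hX ?_
    unfold rescaledSpectrum at hcd
    rw [div_left_inj' hξ.ne', sub_left_inj] at hcd
    exact hcd
  rw [count_eq_card_occ hn] at hc
  exact exists_isStrictLevel_of_le_card hinj hi hc

/-- If the window contains at least j points and there are no ties, both levels are seen by the
clipped configuration and the integrands agree. Otherwise they differ by at most 2. -/
theorem norm_charFun_rescaledOverlap_sub_le (hn : 0 < n) (a : ℝ) (t : ℝ≥0) {i j : ℕ} (hi : 0 < i)
    (hij : i < j) (s : ℝ) :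
    ‖charFun (((disorder n).prod fairCoins).map (rescaledOverlap n a i j)) s -
      ∫ x, pairSum (cosOverlap s) i j (clip t x) ∂(spectrumLaw n a)‖ ≤
      2 * (disorder n).real {X | count n a t X < j} := by
  have hm := measurable_rescaledSpectrum (n := n) a
  have hp : Measurable fun x : SpinClass n → ℝ => pairSum (cosOverlap s) i j (clip t x) :=
    (measurable_pairSum _ i j).comp (measurable_clip _)
  rw [charFun_rescaledOverlap, spectrumLaw, integral_map hm.aemeasurable hp.aestronglyMeasurable]
  refine norm_integral_sub_integral_le (measurable_cosOverlap_levelSpin a i j s).aestronglyMeasurable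
    (hp.comp hm).aestronglyMeasurable (fun X => norm_cosOverlap_le _ _ _)
    (fun X => norm_pairSum_le (norm_cosOverlap_le s) i j _)
    (measurableSet_lt (measurable_count n a t) measurable_const) ?_
  filter_upwards [ae_injective_classEnergy hn] with X hX hXc
  replace hXc : j ≤ count n a t X := not_lt.mp hXc
  obtain ⟨u, hu⟩ := exists_isStrictLevel_of_le_count hn hX hi (hij.le.trans hXc)
  obtain ⟨v, hv⟩ := exists_isStrictLevel_of_le_count hn hX (hi.trans hij) hXc
  rw [Function.comp, pairSum_clip_eq _ hu hv, mk_levelSpin_eq hn hi hX hu.1,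
    mk_levelSpin_eq hn (hi.trans hij) hX hv.1]

theorem norm_integral_pairSum_one_sub_one_le (hn : 0 < n) (a : ℝ) (t : ℝ≥0) {i j : ℕ} (hi : 0 < i)
    (hij : i < j) :
    ‖∫ x, pairSum (fun _ _ => 1) i j (clip t x) ∂(spectrumLaw n a) - 1‖ ≤
      2 * (disorder n).real {X | count n a t X < j} := by
  have hm := measurable_rescaledSpectrum (n := n) a
  have hp : Measurable fun x : SpinClass n → ℝ => pairSum (fun _ _ => 1) i j (clip t x) :=
    (measurable_pairSum _ i j).comp (measurable_clip _)
  have h1 : (1 : ℂ) = ∫ _ : Couplings n, (1 : ℂ) ∂(disorder n) := by simp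
  rw [spectrumLaw, integral_map hm.aemeasurable hp.aestronglyMeasurable]
  nth_rewrite 2 [h1]
  refine norm_integral_sub_integral_le
    (hp.comp hm).aestronglyMeasurable aestronglyMeasurable_const
    (fun X => norm_pairSum_le (by simp) i j _) (by simp)
    (measurableSet_lt (measurable_count n a t) measurable_const) ?_
  filter_upwards [ae_injective_classEnergy hn] with X hX hXc
  replace hXc : j ≤ count n a t X := not_lt.mp hXc
  obtain ⟨u, hu⟩ := exists_isStrictLevel_of_le_count hn hX hi (hij.le.trans hXc)
  obtain ⟨v, hv⟩ := exists_isStrictLevel_of_le_count hn hX (hi.trans hij) hXc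
  rw [Function.comp, pairSum_clip_eq _ hu hv]

theorem overlapConvergesToNormal {α : ℕ → ℝ} (hα : ∀ᶠ n : ℕ in atTop, 0 ≤ α n)
    (hα' : α =o[atTop] fun n : ℕ => (n : ℝ)) {i j : ℕ} (hi : 0 < i) (hij : i < j) :
    OverlapConvergesToNormal α i j := by
  refine ⟨fun n => (measurable_rescaledOverlap n (α n) i j).aemeasurable, aemeasurable_id, ?_⟩
  refine ProbabilityMeasure.tendsto_of_tendsto_charFun fun s => ?_
  simp only [ProbabilityMeasure.coe_mk, Measure.map_id, charFun_gaussianReal]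
  have hlim : (Complex.exp (s * (0 : ℝ) * Complex.I - (1 : ℝ≥0) * s ^ 2 / 2)) =
      ((Real.exp (-(s ^ 2 / 2)) : ℝ) : ℂ) := by
    push_cast
    congr 1
    simp
  rw [hlim]
  set φ : ℕ → ℂ := fun n =>
    charFun (((disorder n).prod fairCoins).map (rescaledOverlap n (α n) i j)) s with hφ
  set S : ℕ → ℂ := fun n => ((Real.cos (s / √(n : ℝ)) ^ n : ℝ) : ℂ) with hS
  have hS1 : ∀ n, ‖S n‖ ≤ 1 := fun n => by
    rw [hS, Complex.norm_real, Real.norm_eq_abs, abs_pow]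
    exact pow_le_one₀ (abs_nonneg _) (Real.abs_cos_le_one _)
  have hSlim : Tendsto S atTop (𝓝 ((Real.exp (-(s ^ 2 / 2)) : ℝ) : ℂ)) :=
    (Complex.continuous_ofReal.tendsto _).comp (tendsto_cos_div_sqrt_pow s)
  suffices hdiff : Tendsto (fun n => φ n - S n) atTop (𝓝 0) by
    have := hdiff.add hSlim
    simpa using this
  rw [Metric.tendsto_atTop']
  intro δ hδ
  -- The 4 is 2 + 2: missing levels cost twice the probability once for the characteristic function
  -- and once for the normalisation.
  obtain ⟨T, hT⟩ : ∃ T : ℕ, 4 * (poissonMeasure (T : ℝ≥0)).real (Set.Iio j) < δ := by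
    have h1 := (tendsto_poissonMeasure_real_Iio j).const_mul 4
    rw [mul_zero] at h1
    exact (h1.eventually_lt_const hδ).exists
  have hT0 : (0 : ℝ) ≤ ((T : ℝ≥0) : ℝ) := NNReal.coe_nonneg _
  have hr : Tendsto (fun n => (disorder n).real {X | count n (α n) (T : ℝ≥0) X < j}) atTop
      (𝓝 ((poissonMeasure (T : ℝ≥0)).real (Set.Iio j))) := by
    have h1 := (convergesToPoissonProcess hα hα').tendsto_integral (T : ℝ≥0)
      (f := (Set.Iio j).indicator fun _ => 1) (C := 1) (fun k => by
        rw [Set.indicator_apply]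
        split_ifs <;> simp)
    rw [integral_indicator (MeasurableSet.of_discrete), setIntegral_const, smul_eq_mul,
      mul_one] at h1
    refine h1.congr fun n => ?_
    have hms : MeasurableSet {X : Couplings n | count n (α n) (T : ℝ≥0) X < j} :=
      measurableSet_lt (measurable_count n (α n) _) measurable_const
    have h2 : (fun X : Couplings n => (Set.Iio j).indicator (fun _ => (1 : ℝ))
        (count n (α n) (T : ℝ≥0) X)) =
        {X | count n (α n) (T : ℝ≥0) X < j}.indicator fun _ => 1 := rfl
    rw [h2, integral_indicator hms, setIntegral_const, smul_eq_mul, mul_one]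
  have hd1 := tendsto_integral_clip_sub hα hα' hT0
    (F := fun n => pairSum (cosOverlap (n := n) s) i j) (fun n => measurable_pairSum _ i j)
    (fun n x => norm_pairSum_le (norm_cosOverlap_le s) i j x)
  have hd2 := tendsto_integral_clip_sub hα hα' hT0
    (F := fun n => pairSum (fun _ _ : SpinClass n => 1) i j) (fun n => measurable_pairSum _ i j)
    (fun n x => norm_pairSum_le (by simp) i j x)
  have hN : Tendsto (fun n : ℕ => 2 / ((2 : ℝ) ^ (n - 1) - 1)) atTop (𝓝 0) := by
    refine Tendsto.div_atTop tendsto_const_nhds ?_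
    refine tendsto_atTop_add_const_right _ _ ?_
    exact (tendsto_pow_atTop_atTop_of_one_lt (r := (2 : ℝ)) one_lt_two).comp
      (tendsto_sub_atTop_nat 1)
  have htot := (((hr.const_mul 4).add hd1.norm).add hd2.norm).add hN
  simp only [norm_zero, add_zero] at htot
  obtain ⟨n₀, hn₀⟩ := eventually_atTop.mp ((htot.eventually_lt_const hT).and
    ((eventually_inv_two_pow_mul_le (((T : ℝ≥0)) : ℝ)).and (eventually_ge_atTop 2)))
  refine ⟨n₀, fun n hn => ?_⟩
  obtain ⟨e1, e2, e3⟩ := hn₀ n hn.le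
  rw [dist_zero_right]
  refine lt_of_le_of_lt ?_ e1
  have hn0 : 0 < n := by omega
  have hcard : 1 < Fintype.card (SpinClass n) := by
    rw [card_spinClass hn0]
    exact Nat.one_lt_two_pow (by omega)
  have b1 := norm_charFun_rescaledOverlap_sub_le hn0 (α n) (T : ℝ≥0) hi hij s
  have b2 := norm_integral_pairSum_one_sub_one_le hn0 (α n) (T : ℝ≥0) hi hij
  have b3 := norm_integral_pairSum_sub_le (S := S n) (by positivity) hT0 e2 hcard (norm_cosOverlap_le s)
    (sum_cosOverlap hn0 s) (hS1 n) hij.ne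
  rw [card_spinClass hn0, Nat.cast_pow, Nat.cast_ofNat] at b3
  have hφn : φ n = charFun (((disorder n).prod fairCoins).map (rescaledOverlap n (α n) i j)) s := rfl
  rw [← hφn] at b1
  generalize φ n = z at *
  generalize ∫ x, pairSum (cosOverlap s) i j (clip (T : ℝ≥0) x) ∂(spectrumLaw n (α n)) = P at *
  generalize ∫ x, pairSum (fun _ _ => 1) i j (clip (T : ℝ≥0) x) ∂(spectrumLaw n (α n)) = P₁ at *
  generalize ∫ x, pairSum (cosOverlap s) i j (clip (T : ℝ≥0) x)
    ∂(refMeasure (SpinClass n) (((2 : ℝ) ^ (n - 1))⁻¹) (T : ℝ≥0)) = R at *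
  generalize ∫ x, pairSum (fun _ _ => 1) i j (clip (T : ℝ≥0) x)
    ∂(refMeasure (SpinClass n) (((2 : ℝ) ^ (n - 1))⁻¹) (T : ℝ≥0)) = R₁ at *
  -- The chain passes from the overlap to the clipped spectrum, to the reference points, to the pair
  -- average times the probability R₁ that both levels exist, and finally removes that probability.
  have hdec : z - S n = (z - P) + (P - R) + (R - S n * R₁) + (-(S n * (P₁ - R₁))) +
      S n * (P₁ - 1) := by ring
  have c1 : ‖-(S n * (P₁ - R₁))‖ ≤ ‖P₁ - R₁‖ := by
    rw [norm_neg, norm_mul]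
    exact mul_le_of_le_one_left (norm_nonneg _) (hS1 n)
  have c2 : ‖S n * (P₁ - 1)‖ ≤ ‖P₁ - 1‖ := by
    rw [norm_mul]
    exact mul_le_of_le_one_left (norm_nonneg _) (hS1 n)
  rw [hdec]
  have t1 := norm_add_le ((z - P) + (P - R) + (R - S n * R₁) + (-(S n * (P₁ - R₁))))
    (S n * (P₁ - 1))
  have t2 := norm_add_le ((z - P) + (P - R) + (R - S n * R₁)) (-(S n * (P₁ - R₁)))
  have t3 := norm_add_le ((z - P) + (P - R)) (R - S n * R₁)
  have t4 := norm_add_le (z - P) (P - R)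
  linarith

end Overlap

/-! ### The expected count -/

section FirstMoment

/-- The increment of the Gaussian exponent over a window of length `T`. -/
def exponentShift (n : ℕ) (α T : ℝ) : ℝ := ((α + scale n α * T) ^ 2 - α ^ 2) / (2 * n)

theorem exponentShift_nonneg {n : ℕ} (hn : 0 < n) {α T : ℝ} (hα : 0 ≤ α) (hT : 0 ≤ T) :
    0 ≤ exponentShift n α T := by
  have hξ := scale_pos hn α
  have h : 0 ≤ scale n α * T := by positivity
  unfold exponentShift
  refine div_nonneg ?_ (by positivity)
  nlinarith

theorem exponentShift_le {n : ℕ} (hn : 0 < n) {α T : ℝ} (hα : 0 ≤ α) (hαn : α ≤ n) (hT : 0 ≤ T) :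
    exponentShift n α T ≤ scaleBound n * T + (scaleBound n * T) ^ 2 := by
  have hn' : (1 : ℝ) ≤ n := by exact_mod_cast hn
  have hξ := scale_pos hn α
  have h0 : 0 ≤ scale n α * T := by positivity
  have h1 : scale n α * T ≤ scaleBound n * T :=
    mul_le_mul_of_nonneg_right (scale_le_scaleBound hn hα hαn) hT
  refine le_trans (b := scale n α * T + (scale n α * T) ^ 2) ?_ (by gcongr)
  unfold exponentShift
  rw [div_le_iff₀ (by positivity)]
  have h2 : α * (scale n α * T) ≤ n * (scale n α * T) := by gcongr
  nlinarith [sq_nonneg (scale n α * T)]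

theorem tendsto_exponentShift {α : ℕ → ℝ} (hα : ∀ᶠ n : ℕ in atTop, 0 ≤ α n ∧ α n ≤ n) {T : ℝ}
    (hT : 0 ≤ T) : Tendsto (fun n => exponentShift n (α n) T) atTop (𝓝 0) := by
  have h := (tendsto_scaleBound.mul_const T).add ((tendsto_scaleBound.mul_const T).pow 2)
  simp only [zero_mul, ne_eq, OfNat.ofNat_ne_zero, not_false_eq_true, zero_pow, add_zero] at h
  refine squeeze_zero' ?_ ?_ h
  · filter_upwards [hα, eventually_ge_atTop 1] with n hn h1
    exact exponentShift_nonneg h1 hn.1 hT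
  · filter_upwards [hα, eventually_ge_atTop 1] with n hn h1
    exact exponentShift_le h1 hn.1 hn.2 hT

/-- A single configuration has no off-diagonal overlaps, so the only error is the variation of the
Gaussian density over the window. Consequently the first moment converges already for α ≤ n. -/
theorem totalErr_one {n : ℕ} (hn : 0 < n) (α T : ℝ) :
    totalErr n 1 α T = 2 * T * (Real.exp (exponentShift n α T) - 1) := by
  classical
  have h1 : ∀ τ : Fin 1 → Spin n, offSum (overlapMatrix τ) = 0 := fun τ => by simp [offSum]
  have h2 : ∀ τ : Fin 1 → Spin n,
      Function.Injective fun a => Quotient.mk (flipSetoid n) (τ a) := fun τ =>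
    Function.injective_of_subsingleton _
  have h3 : ∀ τ : Fin 1 → Spin n, tupleErr α T τ =
      ((2 : ℝ) ^ (n - 1))⁻¹ * T * (Real.exp (exponentShift n α T) - 1) := by
    intro τ
    rw [tupleErr, h1, if_pos (by norm_num)]
    simp [exponentShift]
  rw [totalErr, Finset.filter_true_of_mem fun τ _ => h2 τ, Finset.sum_congr rfl fun τ _ => h3 τ]
  simp only [Finset.sum_const, Finset.card_univ, Fintype.card_pi, Fintype.card_units_int,
    Finset.prod_const, Fintype.card_fin, nsmul_eq_mul, pow_one]
  obtain ⟨m, rfl⟩ : ∃ m, n = m + 1 := ⟨n - 1, by omega⟩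
  rw [Nat.add_sub_cancel]
  push_cast
  rw [pow_succ]
  field_simp

theorem tendsto_integral_count {α : ℕ → ℝ} (hα : ∀ᶠ n : ℕ in atTop, 0 ≤ α n ∧ α n ≤ n) (t : ℝ≥0) :
    Tendsto (fun n => ∫ X, (count n (α n) t X : ℝ) ∂(disorder n)) atTop (𝓝 (t : ℝ)) := by
  rw [tendsto_iff_norm_sub_tendsto_zero]
  have h1 : Tendsto (fun n => 2 * (t : ℝ) * (Real.exp (exponentShift n (α n) t) - 1)) atTop
      (𝓝 0) := by
    have := (((Real.continuous_exp.tendsto 0).comp (tendsto_exponentShift hα t.2)).sub_const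
      1).const_mul (2 * (t : ℝ))
    simpa using this
  refine squeeze_zero' (Eventually.of_forall fun n => norm_nonneg _) ?_ h1
  filter_upwards [hα, eventually_ge_atTop 1, eventually_inv_two_pow_mul_le t] with n hαn hn hpT
  have h2 := abs_integral_choose_count_sub_le hn hαn.1 t hpT 1
  rw [totalErr_one hn] at h2
  simp only [Nat.choose_one_right, pow_one] at h2
  rw [Nat.cast_pow, Nat.cast_ofNat, mul_inv_cancel_left₀ (by positivity)] at h2
  exact h2

end FirstMoment

/-! ### Lower bound for the density of two energies -/

section SecondMoment

variable {n : ℕ}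

theorem sum_spin_mul (k l : Fin n) :
    ∑ τ : Spin n, ((τ k : ℤ) : ℝ) * ((τ l : ℤ) : ℝ) = if k = l then (2 : ℝ) ^ n else 0 := by
  classical
  split_ifs with h
  · subst h
    simp_rw [spin_mul_self]
    simp
  · have h1 := Equiv.sum_comp (Equiv.mulRight (Pi.mulSingle k (-1) : Spin n))
      fun τ : Spin n => ((τ k : ℤ) : ℝ) * ((τ l : ℤ) : ℝ)
    have h2 : ∀ τ : Spin n, (((Equiv.mulRight (Pi.mulSingle k (-1) : Spin n) τ) k : ℤ) : ℝ) *
        (((Equiv.mulRight (Pi.mulSingle k (-1) : Spin n) τ) l : ℤ) : ℝ) =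
        -(((τ k : ℤ) : ℝ) * ((τ l : ℤ) : ℝ)) := by
      intro τ
      simp [Pi.mulSingle_eq_of_ne (Ne.symm h)]
    rw [Finset.sum_congr rfl fun τ _ => h2 τ, Finset.sum_neg_distrib] at h1
    linarith

theorem sum_overlap_sq (σ : Spin n) : ∑ τ : Spin n, overlap σ τ ^ 2 = 2 ^ n / n := by
  have h1 : ∀ τ : Spin n, overlap σ τ ^ 2 = (1 / (n : ℝ)) ^ 2 *
      ∑ k, ∑ l, (((σ k : ℤ) : ℝ) * ((σ l : ℤ) : ℝ)) * (((τ k : ℤ) : ℝ) * ((τ l : ℤ) : ℝ)) := by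
    intro τ
    rw [overlap, mul_pow, sq (∑ k, _), Finset.sum_mul_sum]
    congr 1
    exact Finset.sum_congr rfl fun k _ => Finset.sum_congr rfl fun l _ => by ring
  simp_rw [h1]
  rw [← Finset.mul_sum, Finset.sum_comm]
  have h2 : ∀ k, ∑ τ : Spin n, ∑ l,
      (((σ k : ℤ) : ℝ) * ((σ l : ℤ) : ℝ)) * (((τ k : ℤ) : ℝ) * ((τ l : ℤ) : ℝ)) = 2 ^ n := by
    intro k
    rw [Finset.sum_comm]
    simp_rw [← Finset.mul_sum, sum_spin_mul]
    simp [spin_mul_self]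
  simp_rw [h2]
  rcases Nat.eq_zero_or_pos n with rfl | hn
  · simp
  · have hn' : (0 : ℝ) < n := by exact_mod_cast hn
    simp only [Finset.sum_const, Finset.card_univ, Fintype.card_fin, nsmul_eq_mul]
    field_simp

/-- The squared overlap of two classes. -/
def sqOverlap (u v : SpinClass n) : ℝ := overlap u.out v.out ^ 2

theorem sqOverlap_mk (σ τ : Spin n) :
    sqOverlap (Quotient.mk (flipSetoid n) σ) (Quotient.mk (flipSetoid n) τ) = overlap σ τ ^ 2 := by
  have h1 : ∀ ρ : Spin n, ρ = (Quotient.mk (flipSetoid n) ρ).out ∨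
      ρ = -(Quotient.mk (flipSetoid n) ρ).out := fun ρ => Quotient.mk_out (s := flipSetoid n) ρ
  unfold sqOverlap
  have h3 := h1 σ
  have h4 := h1 τ
  generalize (Quotient.mk (flipSetoid n) σ).out = σ' at *
  generalize (Quotient.mk (flipSetoid n) τ).out = τ' at *
  rcases h3 with rfl | rfl <;> rcases h4 with rfl | rfl <;>
    simp [overlap_neg_left, overlap_neg_right]

theorem sqOverlap_self (hn : 0 < n) (u : SpinClass n) : sqOverlap u u = 1 := by
  rw [sqOverlap, overlap_self hn, one_pow]

theorem sum_sqOverlap (hn : 0 < n) :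
    ∑ u : SpinClass n, ∑ v : SpinClass n, sqOverlap u v = ((2 : ℝ) ^ (n - 1)) ^ 2 / n := by
  have h1 : ∑ σ : Spin n, ∑ τ : Spin n, sqOverlap (Quotient.mk (flipSetoid n) σ)
      (Quotient.mk (flipSetoid n) τ) = 4 * ∑ u : SpinClass n, ∑ v : SpinClass n, sqOverlap u v := by
    simp_rw [sum_spin_eq_two_mul_sum_class hn]
    rw [← Finset.smul_sum, sum_spin_eq_two_mul_sum_class hn fun u => ∑ v, sqOverlap u v]
    simp only [nsmul_eq_mul]
    push_cast
    ring
  simp_rw [sqOverlap_mk, sum_overlap_sq] at h1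
  simp only [Finset.sum_const, Finset.card_univ, Fintype.card_pi, Fintype.card_units_int,
    Finset.prod_const, Fintype.card_fin, nsmul_eq_mul] at h1
  obtain ⟨m, rfl⟩ : ∃ m, n = m + 1 := ⟨n - 1, by omega⟩
  rw [Nat.add_sub_cancel]
  have h2 : (((2 ^ (m + 1) : ℕ) : ℝ)) * (2 ^ (m + 1) / ((m + 1 : ℕ) : ℝ)) =
      4 * (((2 : ℝ) ^ m) ^ 2 / ((m + 1 : ℕ) : ℝ)) := by
    push_cast
    rw [pow_succ]
    ring
  linarith

theorem overlap_sq_ne_one (hn : 0 < n) {σ τ : Spin n} (h1 : σ ≠ τ) (h2 : σ ≠ -τ) :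
    overlap σ τ ^ 2 ≠ 1 := by
  have hn' : (0 : ℝ) < n := by exact_mod_cast hn
  have key : ∀ ρ : Spin n, overlap σ ρ = 1 → σ = ρ := by
    intro ρ h
    have hsum : ∑ k, (1 - ((σ k : ℤ) : ℝ) * ((ρ k : ℤ) : ℝ)) = 0 := by
      rw [Finset.sum_sub_distrib]
      rw [overlap, one_div, inv_mul_eq_iff_eq_mul₀ hn'.ne'] at h
      rw [h]
      simp
    have hle : ∀ k, ((σ k : ℤ) : ℝ) * ((ρ k : ℤ) : ℝ) ≤ 1 := by
      intro k
      rcases Int.units_eq_one_or (σ k) with ha | ha <;>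
        rcases Int.units_eq_one_or (ρ k) with hb | hb <;> simp [ha, hb]
    funext k
    have hk := (Finset.sum_eq_zero_iff_of_nonneg fun k _ => sub_nonneg.mpr (hle k)).mp hsum k
      (Finset.mem_univ k)
    rcases Int.units_eq_one_or (σ k) with ha | ha <;>
      rcases Int.units_eq_one_or (ρ k) with hb | hb <;> simp [ha, hb] at hk ⊢
  intro h
  rw [sq] at h
  rcases mul_self_eq_one_iff.mp h with h | h
  · exact h1 (key τ h)
  · exact h2 (key (-τ) (by rw [overlap_neg_right, h, neg_neg]))

theorem overlapMatrix_pair (hn : 0 < n) (σ τ : Spin n) :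
    overlapMatrix ![σ, τ] = !![1, overlap σ τ ^ 2; overlap σ τ ^ 2, 1] := by
  ext a b
  fin_cases a <;> fin_cases b <;> simp [overlapMatrix, overlap_self hn, overlap_comm τ σ]

-- In this form the possibly large factor 1/(1 - m²) multiplies only (y₀ - y₁)², which is
-- exponentially small for two energies in the same window.
open Matrix in
theorem quadForm_inv_pair {m : ℝ} (hm : 1 - m ^ 2 ≠ 0) (y : Fin 2 → ℝ) :
    y ⬝ᵥ (!![1, m; m, 1] : Matrix (Fin 2) (Fin 2) ℝ)⁻¹ *ᵥ y =
      (y 0 - y 1) ^ 2 / (1 - m ^ 2) + 2 * (y 0 * y 1) / (1 + m) := by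
  have h1 : 1 + m ≠ 0 := fun h => hm (by
    have : m = -1 := by linarith
    rw [this]; norm_num)
  have hdet : (!![1, m; m, 1] : Matrix (Fin 2) (Fin 2) ℝ).det = 1 - m ^ 2 := by
    rw [det_fin_two_of]; ring
  rw [inv_def, hdet, Ring.inverse_eq_inv', adjugate_fin_two_of]
  simp only [dotProduct, mulVec, Matrix.smul_apply, Fin.sum_univ_two, of_apply, cons_val_zero,
    cons_val_one, smul_eq_mul, cons_val']
  have h2 : 1 - m ^ 2 = (1 + m) * (1 - m) := by ring
  have h3 : 1 - m ≠ 0 := fun h => hm (by rw [h2, h, mul_zero])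
  rw [h2]
  simp
  field_simp
  ring

theorem le_relDensity_pair (hn : 0 < n) {α : ℝ} (hα : 0 ≤ α) {σ τ : Spin n} (h1 : σ ≠ τ)
    (h2 : σ ≠ -τ) {y : Fin 2 → ℝ} (hy : y ∈ window (Fin 2) 1) :
    Real.exp (-(2 * exponentShift n α 1 + ((n : ℝ) ^ 2 * scale n α) ^ 2)) *
      (1 + α ^ 2 / (2 * n) * overlap σ τ ^ 2) ≤
      relDensity n α (overlapMatrix ![σ, τ]) y := by
  have hn' : (1 : ℝ) ≤ n := by exact_mod_cast hn
  have hξ := scale_pos hn α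
  set ξ := scale n α with hξd
  have hm1 := overlap_sq_ne_one hn h1 h2
  have hm1' : overlap σ τ ^ 2 ≤ 1 := by
    rw [sq_le_one_iff_abs_le_one]
    exact abs_overlap_le_one _ _
  have hm0 : 0 ≤ overlap σ τ ^ 2 := sq_nonneg _
  have hMp := overlapMatrix_pair hn σ τ
  set m := overlap σ τ ^ 2 with hm
  have hmlt : m < 1 := lt_of_le_of_ne hm1' hm1
  have hdet : (overlapMatrix ![σ, τ]).det = 1 - m ^ 2 := by
    rw [hMp, Matrix.det_fin_two_of]; ring
  have hpos : 0 < 1 - m ^ 2 := by nlinarith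
  have hinv : (√(1 - m ^ 2))⁻¹ ≤ (n : ℝ) ^ 2 := by
    have := inv_sqrt_det_overlapMatrix_le hn ![σ, τ] (by rw [hdet]; exact hpos.ne')
    rwa [hdet, Fintype.card_fin] at this
  have hinv2 : 1 / (1 - m ^ 2) ≤ (n : ℝ) ^ 4 := by
    have : 1 / (1 - m ^ 2) = ((√(1 - m ^ 2))⁻¹) ^ 2 := by
      rw [inv_pow, Real.sq_sqrt hpos.le, one_div]
    rw [this, show (n : ℝ) ^ 4 = ((n : ℝ) ^ 2) ^ 2 by ring]
    gcongr
  have hone : 1 ≤ (√(1 - m ^ 2))⁻¹ := by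
    rw [one_le_inv₀ (Real.sqrt_pos.mpr hpos), Real.sqrt_le_one]
    nlinarith
  rw [relDensity, hdet, hMp, quadForm_inv_pair hpos.ne']
  simp only [Fintype.card_fin]
  have hy0 := hy 0 (Set.mem_univ _)
  have hy1 := hy 1 (Set.mem_univ _)
  simp only [Set.mem_Icc] at hy0 hy1
  have hexp : α ^ 2 / (2 * n) * m - (2 * exponentShift n α 1 + ((n : ℝ) ^ 2 * ξ) ^ 2) ≤
      (((2 : ℕ) : ℝ) * α ^ 2 - ((α + ξ * y 0 - (α + ξ * y 1)) ^ 2 / (1 - m ^ 2) +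
        2 * ((α + ξ * y 0) * (α + ξ * y 1)) / (1 + m))) / (2 * n) := by
    have e1 : (α + ξ * y 0 - (α + ξ * y 1)) ^ 2 / (1 - m ^ 2) ≤ ξ ^ 2 * (n : ℝ) ^ 4 := by
      have : (α + ξ * y 0 - (α + ξ * y 1)) ^ 2 ≤ ξ ^ 2 := by
        have e : (α + ξ * y 0 - (α + ξ * y 1)) ^ 2 = ξ ^ 2 * (y 0 - y 1) ^ 2 := by ring
        rw [e]
        refine mul_le_of_le_one_right (by positivity) ?_
        rw [sq_le_one_iff_abs_le_one, abs_le]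
        constructor <;> linarith
      rw [div_eq_mul_one_div]
      gcongr
    have e2 : (α + ξ * y 0) * (α + ξ * y 1) ≤ (α + ξ * 1) ^ 2 := by
      rw [sq]
      have := hy0.1
      have := hy1.1
      gcongr
      · exact hy0.2
      · exact hy1.2
    have e3 : 2 * ((α + ξ * y 0) * (α + ξ * y 1)) / (1 + m) ≤ 2 * (α + ξ * 1) ^ 2 / (1 + m) := by
      gcongr
    -- The gain comes from 2/(1 + m) ≤ 2 - m for 0 ≤ m ≤ 1, which leaves α²m/(2n) in the exponent.
    have e4 : 2 * (α + ξ * 1) ^ 2 / (1 + m) ≤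
        2 * α ^ 2 - α ^ 2 * m + 2 * ((α + ξ * 1) ^ 2 - α ^ 2) := by
      rw [div_le_iff₀ (by linarith)]
      have d : 0 ≤ (α + ξ * 1) ^ 2 - α ^ 2 := by nlinarith
      nlinarith [mul_nonneg (mul_nonneg (sq_nonneg α) hm0) (sub_nonneg.mpr hm1'),
        mul_nonneg d hm0]
    have e5 : exponentShift n α 1 = ((α + ξ * 1) ^ 2 - α ^ 2) / (2 * n) := rfl
    rw [le_div_iff₀ (by positivity), e5]
    have e6 : (α ^ 2 / (2 * n) * m - (2 * (((α + ξ * 1) ^ 2 - α ^ 2) / (2 * n)) +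
        ((n : ℝ) ^ 2 * ξ) ^ 2)) * (2 * n) =
        α ^ 2 * m - 2 * ((α + ξ * 1) ^ 2 - α ^ 2) - ξ ^ 2 * (n : ℝ) ^ 4 * (2 * n) := by
      field_simp
      ring
    rw [e6]
    have e7 : ξ ^ 2 * (n : ℝ) ^ 4 ≤ ξ ^ 2 * (n : ℝ) ^ 4 * (2 * n) :=
      le_mul_of_one_le_right (by positivity) (by linarith)
    push_cast
    linarith
  calc Real.exp (-(2 * exponentShift n α 1 + ((n : ℝ) ^ 2 * ξ) ^ 2)) * (1 + α ^ 2 / (2 * n) * m)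
      ≤ Real.exp (-(2 * exponentShift n α 1 + ((n : ℝ) ^ 2 * ξ) ^ 2)) *
        Real.exp (α ^ 2 / (2 * n) * m) := by
        gcongr
        rw [add_comm]
        exact Real.add_one_le_exp _
    _ = Real.exp (α ^ 2 / (2 * n) * m - (2 * exponentShift n α 1 + ((n : ℝ) ^ 2 * ξ) ^ 2)) := by
        rw [← Real.exp_add]
        congr 1
        ring
    _ ≤ 1 * Real.exp ((((2 : ℕ) : ℝ) * α ^ 2 - ((α + ξ * y 0 - (α + ξ * y 1)) ^ 2 / (1 - m ^ 2) +
        2 * ((α + ξ * y 0) * (α + ξ * y 1)) / (1 + m))) / (2 * n)) := by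
        rw [one_mul]
        exact Real.exp_le_exp.mpr hexp
    _ ≤ _ := by gcongr

end SecondMoment

/-! ### Lower bound for the second factorial moment -/

section FactorialMoment

variable {n : ℕ}

theorem integrable_comp_count (α : ℝ) (t : ℝ≥0) (f : ℕ → ℝ) :
    Integrable (fun X => f (count n α t X)) (disorder n) := by
  classical
  refine Integrable.of_bound (C := ∑ k ∈ Finset.range (Fintype.card (SpinClass n) + 1), |f k|)
    ((Measurable.of_discrete (f := f)).comp (measurable_count n α t)).aestronglyMeasurable
    (Eventually.of_forall fun X => ?_)
  have h : count n α t X ≤ Fintype.card (SpinClass n) := by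
    unfold count
    rw [countP_energySpectrum X]
    exact Finset.card_le_univ _
  exact Finset.single_le_sum (f := fun k => |f k|) (fun k _ => abs_nonneg _)
    (Finset.mem_range.mpr (by omega))

theorem mk_ne_mk_iff {σ τ : Spin n} :
    Quotient.mk (flipSetoid n) σ ≠ Quotient.mk (flipSetoid n) τ ↔ σ ≠ τ ∧ σ ≠ -τ := by
  rw [← not_or, not_iff_not]
  constructor
  · intro h
    rcases Quotient.exact h with h | h
    · exact Or.inl h.symm
    · exact Or.inr (by rw [h, neg_neg])
  · intro h
    refine Quotient.sound ?_
    rcases h with h | h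
    · exact Or.inl h.symm
    · exact Or.inr (by rw [h, neg_neg])

theorem le_prob_pair (hn : 0 < n) {α : ℝ} (hα : 0 ≤ α) {u v : SpinClass n} (huv : u ≠ v) :
    (((2 : ℝ) ^ (n - 1))⁻¹) ^ 2 *
      (Real.exp (-(2 * exponentShift n α 1 + ((n : ℝ) ^ 2 * scale n α) ^ 2)) *
      (1 + α ^ 2 / (2 * n) * sqOverlap u v)) ≤
      (disorder n).real {X | rescaledSpectrum α X u ∈ Set.Icc 0 1 ∧
        rescaledSpectrum α X v ∈ Set.Icc 0 1} := by
  obtain ⟨h1, h2⟩ : u.out ≠ v.out ∧ u.out ≠ -v.out := by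
    rw [← mk_ne_mk_iff, Quotient.out_eq, Quotient.out_eq]
    exact huv
  have hdet : (overlapMatrix ![u.out, v.out]).det ≠ 0 := by
    rw [overlapMatrix_pair hn, Matrix.det_fin_two_of]
    have h3 := overlap_sq_ne_one hn h1 h2
    have h4 : 0 ≤ overlap u.out v.out ^ 2 := sq_nonneg _
    intro h
    refine h3 ?_
    nlinarith
  have h := le_prob_window hn α zero_le_one ![u.out, v.out] hdet
    fun y hy => le_relDensity_pair hn hα h1 h2 hy
  rw [mul_one, Fintype.card_fin] at h
  refine h.trans (le_of_eq ?_)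
  congr 1
  ext X
  have h5 : ∀ w : SpinClass n, rescaledSpectrum α X w = (energy X w.out - α) / scale n α := by
    intro w
    rw [← rescaledSpectrum_mk, Quotient.out_eq]
  simp only [window, Set.mem_preimage, Set.mem_univ_pi, Fin.forall_fin_two, rescaledEnergies, h5,
    Matrix.cons_val_zero, Matrix.cons_val_one, Set.mem_ofPred_eq]

/-- The pair bounds are summed over ordered pairs of distinct classes. The squared overlaps have
average 1/n, which turns α²/(2n) into (α/n)²/2; the terms with 2^{-(n-1)} account for the removed
diagonal. -/
theorem le_integral_count_mul (hn : 0 < n) {α : ℝ} (hα : 0 ≤ α) :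
    Real.exp (-(2 * exponentShift n α 1 + ((n : ℝ) ^ 2 * scale n α) ^ 2)) *
      (1 - ((2 : ℝ) ^ (n - 1))⁻¹ + (α / n) ^ 2 / 2 * (1 - n * ((2 : ℝ) ^ (n - 1))⁻¹)) ≤
      ∫ X, (count n α 1 X : ℝ) * (count n α 1 X - 1) ∂(disorder n) := by
  classical
  have hn' : (0 : ℝ) < n := by exact_mod_cast hn
  set D := Real.exp (-(2 * exponentShift n α 1 + ((n : ℝ) ^ 2 * scale n α) ^ 2)) with hD
  set N : ℝ := (2 : ℝ) ^ (n - 1) with hN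
  have hN0 : 0 < N := by positivity
  set A : SpinClass n → SpinClass n → Set (Couplings n) := fun u v =>
    {X | rescaledSpectrum α X u ∈ Set.Icc 0 1 ∧ rescaledSpectrum α X v ∈ Set.Icc 0 1} with hA
  have hAm : ∀ u v, MeasurableSet (A u v) := fun u v =>
    ((measurable_pi_apply u).comp (measurable_rescaledSpectrum α) measurableSet_Icc).inter
      ((measurable_pi_apply v).comp (measurable_rescaledSpectrum α) measurableSet_Icc)
  have hcount : ∀ X : Couplings n, (count n α 1 X : ℝ) * (count n α 1 X - 1) =
      ∑ u : SpinClass n, ∑ v ∈ Finset.univ.erase u, (A u v).indicator (fun _ => (1 : ℝ)) X := by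
    intro X
    have h1 : (count n α 1 X : ℝ) = ∑ u : SpinClass n,
        if rescaledSpectrum α X u ∈ Set.Icc (0 : ℝ) 1 then 1 else 0 := by
      rw [count_eq_card_occ hn, NNReal.coe_one, occ, Finset.card_filter, Nat.cast_sum]
      exact Finset.sum_congr rfl fun u _ => by split_ifs <;> simp
    rw [h1, Finset.sum_mul]
    refine Finset.sum_congr rfl fun u _ => ?_
    rw [← Finset.add_sum_erase Finset.univ (fun v => if rescaledSpectrum α X v ∈ Set.Icc (0 : ℝ) 1
      then (1 : ℝ) else 0) (Finset.mem_univ u)]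
    simp only [Set.indicator_apply, hA, Set.mem_ofPred_eq]
    by_cases hu : rescaledSpectrum α X u ∈ Set.Icc (0 : ℝ) 1
    · simp only [hu, if_true, true_and]
      ring
    · simp only [hu, if_false, false_and, Finset.sum_const_zero, zero_mul]
  have hind : ∀ u v, Integrable ((A u v).indicator fun _ => (1 : ℝ)) (disorder n) := fun u v =>
    (integrable_const _).indicator (hAm u v)
  simp_rw [hcount]
  rw [integral_finsetSum _ fun u _ => integrable_finsetSum _ fun v _ => hind u v]
  have hlow : ∑ u : SpinClass n, ∑ v ∈ Finset.univ.erase u,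
      (N⁻¹ ^ 2 * (D * (1 + α ^ 2 / (2 * n) * sqOverlap u v))) ≤
      ∑ u : SpinClass n, ∫ X, ∑ v ∈ Finset.univ.erase u,
        (A u v).indicator (fun _ => (1 : ℝ)) X ∂(disorder n) := by
    refine Finset.sum_le_sum fun u _ => ?_
    rw [integral_finsetSum _ fun v _ => hind u v]
    refine Finset.sum_le_sum fun v hv => ?_
    rw [integral_indicator (hAm u v)]
    simp only [integral_const, measureReal_restrict_apply_univ, smul_eq_mul, mul_one]
    exact le_prob_pair hn hα (Finset.ne_of_mem_erase hv).symm
  refine le_trans (le_of_eq ?_) hlow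
  have herase : ∀ u : SpinClass n, ∑ v ∈ Finset.univ.erase u,
      (N⁻¹ ^ 2 * (D * (1 + α ^ 2 / (2 * n) * sqOverlap u v))) =
      N⁻¹ ^ 2 * (D * ((N + α ^ 2 / (2 * n) * ∑ v, sqOverlap u v) - (1 + α ^ 2 / (2 * n)))) := by
    intro u
    rw [← Finset.mul_sum, ← Finset.mul_sum, Finset.sum_erase_eq_sub (Finset.mem_univ u),
      Finset.sum_add_distrib, ← Finset.mul_sum, sqOverlap_self hn]
    simp only [Finset.sum_const, Finset.card_univ, card_spinClass hn, nsmul_eq_mul, mul_one, hN]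
    push_cast
    rfl
  rw [Finset.sum_congr rfl fun u _ => herase u, ← Finset.mul_sum, ← Finset.mul_sum,
    Finset.sum_sub_distrib, Finset.sum_add_distrib, ← Finset.mul_sum, sum_sqOverlap hn]
  simp only [Finset.sum_const, Finset.card_univ, card_spinClass hn, nsmul_eq_mul]
  rw [Nat.cast_pow, Nat.cast_ofNat, ← hN]
  field_simp
  ring

end FactorialMoment

/-! ### Necessity of α = o(n) -/

section OnlyIf

/-- The second factorial power, truncated. -/
def truncFactorial (B k : ℕ) : ℝ := if k < B + 2 then (k : ℝ) * (k - 1) else 0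

theorem truncFactorial_nonneg (B k : ℕ) : 0 ≤ truncFactorial B k := by
  unfold truncFactorial
  split_ifs
  · rcases k with _ | k
    · simp
    · push_cast
      rw [add_sub_cancel_right]
      positivity
  · exact le_rfl

theorem abs_truncFactorial_le (B k : ℕ) : |truncFactorial B k| ≤ ((B : ℝ) + 2) ^ 2 := by
  rw [abs_of_nonneg (truncFactorial_nonneg B k)]
  unfold truncFactorial
  split_ifs with h
  · have h1 : (k : ℝ) ≤ B + 2 := by exact_mod_cast h.le
    have h2 : (0 : ℝ) ≤ k := Nat.cast_nonneg k
    nlinarith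
  · positivity

/-- Convergence in distribution only handles the bounded truncation. Beyond it, k(k-1) =
6·C(k,3)/(k-2) with k - 2 ≥ B, so the third factorial moment controls the tail. -/
theorem mul_sub_one_le_truncFactorial_add {B : ℕ} (hB : 0 < B) (k : ℕ) :
    (k : ℝ) * (k - 1) ≤ truncFactorial B k + 6 / B * (k.choose 3 : ℝ) := by
  have hB' : (0 : ℝ) < B := by exact_mod_cast hB
  unfold truncFactorial
  split_ifs with h
  · have : 0 ≤ 6 / (B : ℝ) * (k.choose 3 : ℝ) := by positivity
    linarith
  · push Not at h
    obtain ⟨m, rfl⟩ : ∃ m, k = m + 2 := ⟨k - 2, by omega⟩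
    have hm : (B : ℝ) ≤ m := by exact_mod_cast (by omega : B ≤ m)
    have h1 : (((m + 2).choose 3 : ℕ) : ℝ) = ((m : ℝ) + 2) * (m + 1) * m / 6 := by
      have h2 : (m + 2).descFactorial 3 = Nat.factorial 3 * (m + 2).choose 3 :=
        Nat.descFactorial_eq_factorial_mul_choose _ _
      have h3 : (m + 2).descFactorial 3 = m * ((m + 1) * (m + 2)) := by
        simp [Nat.descFactorial_succ]
      have h4 : ((m : ℝ)) * ((m + 1) * (m + 2)) = 6 * ((m + 2).choose 3 : ℝ) := by
        rw [h3] at h2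
        have : Nat.factorial 3 = 6 := rfl
        rw [this] at h2
        exact_mod_cast h2
      linarith
    rw [h1, zero_add]
    have h5 : 6 / (B : ℝ) * (((m : ℝ) + 2) * (m + 1) * m / 6) =
        ((m : ℝ) + 2) * (m + 1) * (m / B) := by
      field_simp
    rw [h5]
    have h6 : 1 ≤ (m : ℝ) / B := (one_le_div hB').mpr hm
    push_cast
    have h7 : 0 ≤ ((m : ℝ) + 2) * (m + 1) := by positivity
    nlinarith

theorem integral_truncFactorial_poisson_le (B : ℕ) :
    ∫ k, truncFactorial B k ∂(poissonMeasure 1) ≤ 1 := by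
  rw [integral_poissonMeasure, tsum_eq_sum (s := Finset.range (B + 2))]
  · rw [Finset.sum_range_succ', Finset.sum_range_succ']
    have h1 : ∀ k ∈ Finset.range B, (Real.exp (-((1 : ℝ≥0) : ℝ)) * ((1 : ℝ≥0) : ℝ) ^ (k + 1 + 1) /
        ((k + 1 + 1).factorial : ℝ)) • truncFactorial B (k + 1 + 1) =
        Real.exp (-1) * (1 ^ k / (k.factorial : ℝ)) := by
      intro k hk
      have hk' := Finset.mem_range.mp hk
      rw [truncFactorial, if_pos (by omega), smul_eq_mul, Nat.factorial_succ, Nat.factorial_succ]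
      push_cast
      have : (k.factorial : ℝ) ≠ 0 := by positivity
      field_simp
      ring
    rw [Finset.sum_congr rfl h1, ← Finset.mul_sum]
    have h2 := Real.sum_le_exp_of_nonneg (x := 1) zero_le_one B
    have h3 : Real.exp (-1) * ∑ k ∈ Finset.range B, (1 : ℝ) ^ k / (k.factorial : ℝ) ≤ 1 := by
      calc _ ≤ Real.exp (-1) * Real.exp 1 := by gcongr
        _ = 1 := by rw [← Real.exp_add]; simp
    have h4 : truncFactorial B 0 = 0 := by simp [truncFactorial]
    have h5 : truncFactorial B (0 + 1) = 0 := by simp [truncFactorial]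
    rw [h4, h5]
    simpa using h3
  · intro k hk
    rw [truncFactorial, if_neg (by simpa using hk), smul_zero]

theorem exists_integral_choose_three_le : ∃ ε : ℝ, 0 < ε ∧ ∀ α : ℕ → ℝ,
    (∀ᶠ n : ℕ in atTop, 0 ≤ α n ∧ α n ≤ ε * n) → ∃ C : ℝ, 0 ≤ C ∧
      ∀ᶠ n : ℕ in atTop, ∫ X, ((count n (α n) 1 X).choose 3 : ℝ) ∂(disorder n) ≤ C := by
  obtain ⟨ε, hε, h⟩ := exists_totalErr_le 3
  refine ⟨ε, hε, fun α hα => ?_⟩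
  obtain ⟨C, e, hC, he, hle⟩ := h α hα 1 zero_le_one
  refine ⟨C * ε ^ 2 + 1 + 1, by positivity, ?_⟩
  filter_upwards [hle, he.eventually_lt_const one_pos, hα, eventually_ge_atTop 1,
    eventually_inv_two_pow_mul_le 1] with n h1 h2 h3 h4 h5
  have hn' : (0 : ℝ) < n := by exact_mod_cast h4
  have h6 := (abs_le.mp (abs_integral_choose_count_sub_le h4 h3.1 1 (by simpa using h5) 3)).2
  have h7 : (α n / n) ^ 2 ≤ ε ^ 2 := by
    have := h3.1
    gcongr
    rw [div_le_iff₀ hn']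
    exact h3.2
  have h8 : ((2 ^ (n - 1)).choose 3 : ℝ) * (((2 : ℝ) ^ (n - 1))⁻¹ * ((1 : ℝ≥0) : ℝ)) ^ 3 ≤ 1 := by
    have h9 : ((2 ^ (n - 1)).choose 3 : ℝ) ≤ ((2 : ℝ) ^ (n - 1)) ^ 3 := by
      exact_mod_cast Nat.choose_le_pow _ _
    calc _ ≤ ((2 : ℝ) ^ (n - 1)) ^ 3 * (((2 : ℝ) ^ (n - 1))⁻¹ * ((1 : ℝ≥0) : ℝ)) ^ 3 := by gcongr
      _ = 1 := by
        rw [← mul_pow, NNReal.coe_one, mul_one, mul_inv_cancel₀ (by positivity), one_pow]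
  have h10 : C * (α n / n) ^ 2 ≤ C * ε ^ 2 := by gcongr
  rw [NNReal.coe_one] at h6 h8
  linarith

theorem tendsto_pow_mul_inv_two_pow (j : ℕ) :
    Tendsto (fun n : ℕ => (n : ℝ) ^ j * ((2 : ℝ) ^ (n - 1))⁻¹) atTop (𝓝 0) := by
  have h := (tendsto_pow_const_mul_const_pow_of_abs_lt_one j
    (by rw [abs_of_pos] <;> norm_num : |(1 / 2 : ℝ)| < 1)).const_mul 2
  rw [mul_zero] at h
  refine h.congr' ?_
  filter_upwards [eventually_ge_atTop 1] with n hn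
  obtain ⟨m, rfl⟩ : ∃ m, n = m + 1 := ⟨n - 1, by omega⟩
  rw [Nat.add_sub_cancel, pow_succ (1 / 2 : ℝ), one_div, inv_pow]
  ring

theorem exists_isLittleO_of_convergesToPoissonProcess : ∃ ε : ℝ, 0 < ε ∧ ∀ α : ℕ → ℝ,
    (∀ᶠ n : ℕ in atTop, 0 ≤ α n ∧ α n ≤ ε * n) → ConvergesToPoissonProcess α →
      α =o[atTop] fun n : ℕ => (n : ℝ) := by
  obtain ⟨ε, hε, h3⟩ := exists_integral_choose_three_le
  refine ⟨min ε 1, lt_min hε one_pos, fun α hα hP => ?_⟩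
  have hαε : ∀ᶠ n : ℕ in atTop, 0 ≤ α n ∧ α n ≤ ε * n := by
    filter_upwards [hα] with n hn
    exact ⟨hn.1, hn.2.trans (mul_le_mul_of_nonneg_right (min_le_left _ _) (Nat.cast_nonneg n))⟩
  have hα1 : ∀ᶠ n : ℕ in atTop, 0 ≤ α n ∧ α n ≤ n := by
    filter_upwards [hα] with n hn
    refine ⟨hn.1, hn.2.trans ?_⟩
    exact (mul_le_mul_of_nonneg_right (min_le_right _ _) (Nat.cast_nonneg n)).trans (one_mul _).le
  obtain ⟨C, hC, hmom⟩ := h3 α hαε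
  rw [Asymptotics.isLittleO_iff]
  intro c hc
  -- The tail and the passage to the Poisson limit take c²/8 each, so the upper bound 1 + c²/4 stays
  -- below the lower bound 1 + c²/2 that α > cn would imply.
  obtain ⟨B, hB0, hB⟩ : ∃ B : ℕ, 0 < B ∧ 6 / (B : ℝ) * C < c ^ 2 / 8 := by
    have h4 : Tendsto (fun B : ℕ => 6 / (B : ℝ) * C) atTop (𝓝 0) := by
      have := (tendsto_const_div_atTop_nhds_zero_nat (6 : ℝ)).mul_const C
      simpa using this
    obtain ⟨B, h5, h6⟩ := ((h4.eventually_lt_const (by positivity : 0 < c ^ 2 / 8)).and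
      (eventually_gt_atTop 0)).exists
    exact ⟨B, h6, h5⟩
  have hup : ∀ᶠ n : ℕ in atTop, ∫ X, (count n (α n) 1 X : ℝ) * (count n (α n) 1 X - 1)
      ∂(disorder n) ≤ 1 + c ^ 2 / 4 := by
    have h4 := hP.tendsto_integral 1 (abs_truncFactorial_le B)
    have h5 := integral_truncFactorial_poisson_le B
    filter_upwards [hmom, h4.eventually_lt_const (lt_of_le_of_lt h5
      (by nlinarith [sq_pos_of_pos hc] : (1 : ℝ) < 1 + c ^ 2 / 8))] with n h6 h7
    have h8 : ∫ X, (count n (α n) 1 X : ℝ) * (count n (α n) 1 X - 1) ∂(disorder n) ≤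
        ∫ X, (truncFactorial B (count n (α n) 1 X) +
          6 / B * ((count n (α n) 1 X).choose 3 : ℝ)) ∂(disorder n) :=
      integral_mono (integrable_comp_count (α n) 1 fun k => (k : ℝ) * (k - 1))
        (integrable_comp_count (α n) 1 fun k => truncFactorial B k + 6 / B * (k.choose 3 : ℝ))
        fun X => mul_sub_one_le_truncFactorial_add hB0 _
    rw [integral_add (integrable_comp_count (α n) 1 (truncFactorial B))
      (integrable_comp_count (α n) 1 fun k => 6 / B * (k.choose 3 : ℝ)),
      integral_const_mul] at h8
    have h9 : 6 / (B : ℝ) * ∫ X, ((count n (α n) 1 X).choose 3 : ℝ) ∂(disorder n) ≤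
        6 / (B : ℝ) * C := by gcongr
    linarith
  have hlow : Tendsto (fun n : ℕ => Real.exp (-(2 * exponentShift n (α n) 1 +
      ((n : ℝ) ^ 2 * scale n (α n)) ^ 2)) * (1 - ((2 : ℝ) ^ (n - 1))⁻¹ +
      c ^ 2 / 2 * (1 - n * ((2 : ℝ) ^ (n - 1))⁻¹))) atTop (𝓝 (1 + c ^ 2 / 2)) := by
    have h4 := tendsto_exponentShift hα1 zero_le_one
    have h5 : Tendsto (fun n : ℕ => (n : ℝ) ^ 2 * scale n (α n)) atTop (𝓝 0) := by
      refine squeeze_zero' ?_ ?_ (tendsto_pow_mul_scaleBound 2)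
      · filter_upwards [eventually_ge_atTop 1] with n hn
        have := scale_pos hn (α n)
        positivity
      · filter_upwards [hα1, eventually_ge_atTop 1] with n h6 hn
        have := scale_le_scaleBound hn h6.1 h6.2
        gcongr
    have h8 := tendsto_pow_mul_inv_two_pow 0
    have h9 := tendsto_pow_mul_inv_two_pow 1
    simp only [pow_zero, one_mul, pow_one] at h8 h9
    have h10 := ((Real.continuous_exp.tendsto _).comp
      (((h4.const_mul 2).add (h5.pow 2)).neg)).mul
      ((h8.const_sub 1).add ((h9.const_sub 1).const_mul (c ^ 2 / 2)))
    simpa using h10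
  filter_upwards [hup, hα1, eventually_ge_atTop 1, hlow.eventually_const_lt
    (by nlinarith [sq_pos_of_pos hc] : 1 + c ^ 2 / 4 < 1 + c ^ 2 / 2),
    (tendsto_pow_mul_inv_two_pow 1).eventually_le_const one_pos] with n h4 h5 hn h6 h7
  rw [Real.norm_eq_abs, abs_of_nonneg h5.1, Real.norm_eq_abs, abs_of_nonneg (Nat.cast_nonneg n)]
  by_contra hcon
  push Not at hcon
  have hn' : (0 : ℝ) < n := by exact_mod_cast hn
  have h8 : c ^ 2 ≤ (α n / n) ^ 2 := by
    gcongr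
    rw [le_div_iff₀ hn']
    exact hcon.le
  have h9 := le_integral_count_mul hn h5.1
  -- The lower bound increases with α/n, so it is at least its value with c in place of α/n.
  refine absurd (h6.trans_le (le_trans ?_ (h9.trans h4))) (lt_irrefl _)
  rw [pow_one] at h7
  have h10 : 0 ≤ 1 - (n : ℝ) * ((2 : ℝ) ^ (n - 1))⁻¹ := sub_nonneg.mpr h7
  gcongr

end OnlyIf

end SK

end

theorem theorem2p2 :
    ∃ ε₀ : ℝ, 0 < ε₀ ∧ ∀ α : ℕ → ℝ, (∀ n : ℕ, 1 ≤ n → 0 < α n ∧ α n ≤ ε₀ * n) →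
      (∀ t : NNReal,
        Filter.Tendsto
          (fun n : ℕ => ∫ X, (SK.count n (α n) t X : ℝ) ∂(SK.disorder n))
          Filter.atTop (nhds (t : ℝ))) ∧
      (SK.LocalREM α ↔ α =o[Filter.atTop] fun n : ℕ => (n : ℝ)) := by
  obtain ⟨ε, hε, h⟩ := SK.exists_isLittleO_of_convergesToPoissonProcess
  -- The constant ε keeps the third factorial moment bounded in the converse; the bound by 1 is what
  -- the first moment requires.
  refine ⟨min ε 1, lt_min hε one_pos, fun α hα => ?_⟩
  have hα0 : ∀ᶠ n : ℕ in atTop, 0 ≤ α n := by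
    filter_upwards [eventually_ge_atTop 1] with n hn using (hα n hn).1.le
  have hαε : ∀ᶠ n : ℕ in atTop, 0 ≤ α n ∧ α n ≤ ε * n := by
    filter_upwards [eventually_ge_atTop 1] with n hn
    exact ⟨(hα n hn).1.le, (hα n hn).2.trans
      (mul_le_mul_of_nonneg_right (min_le_left _ _) (Nat.cast_nonneg n))⟩
  have hα1 : ∀ᶠ n : ℕ in atTop, 0 ≤ α n ∧ α n ≤ n := by
    filter_upwards [eventually_ge_atTop 1] with n hn
    exact ⟨(hα n hn).1.le, (hα n hn).2.trans
      ((mul_le_mul_of_nonneg_right (min_le_right _ _) (Nat.cast_nonneg n)).trans (one_mul _).le)⟩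
  -- The Poisson half of the conjecture alone already forces α = o(n).
  refine ⟨SK.tendsto_integral_count hα1, fun hREM => h α hαε hREM.1, fun ho => ⟨?_, ?_⟩⟩
  · exact SK.convergesToPoissonProcess hα0 ho
  · exact fun i j hi hij => SK.overlapConvergesToNormal hα0 ho hi hij
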